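/- Let $(\zeta_j)_{j\in\mathbb Z}$ be i.i.d. positive random variables with finite mean $\mu$, and let the environment $\omega=(\omega_k)_{k\in\mathbb Z}$ be given by $\omega_0=0$, $\omega_k=\omega_{k-1}+\zeta_k$; denote its law by $P$. Let $(\xi_i)_{i\ge 1}$ be i.i.d. $\mathbb Z$-valued random variables on a probability space with measure $Q$, with density $(p_k)_{k\in\mathbb Z}$ such that $p_k=p_{-k}$ for all $k$, $p_{k+1}\le p_k$ for all $k\ge 0$, and $v_p:=\sum_k k^2p_k\in(0,\infty)$. Put $S_0=0$, $S_n=\sum_{i=1}^n\xi_i$, $Y_n=\omega_{S_n}$, $\tau(n)=\sum_{k=1}^n|\omega_{S_k}-\omega_{S_{k-1}}|$, and $$X(t)=Y_n+\operatorname{sgn}(\xi_{n+1})\,(t-\tau(n))\qquad\text{for } t\in[\tau(n),\tau(n+1)).$$ For a fixed environment $\omega$ let $E_\omega$ denote the expectation over $(\xi_i)$, i.e. with respect to $Q$. Let $$\bar m=\sum_k|k|\,p_k,\qquad \bar q=\sup\Big\{q>0:\ \sum_k|k|^qp_k<\infty\Big\}\in[2,\infty],$$ and for $q\ge 0$ let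 $m_q$ be the $q$-th absolute moment of the centered normal distribution with variance $v_p$. Let $q$ be a real number with $0\le q\le\bar q$. Then: (a) If $\sum_k|k|^qp_k<\infty$, then $E_Q(|S_n|^q)<\infty$ for all $n$ and $m_q=\lim_{n\to\infty}E_Q(|S_n|^q)/n^{q/2}$. (b) For $P$-a.e. $\omega$, $|X(t)|^q$ is integrable for every $t\ge 0$ and $$\lim_{t\to\infty}\frac{E_\omega(|X(t)|^q)}{t^{q/2}}=\Big(\frac{\mu}{\bar m}\Big)^{q/2}m_q .$$ (c) If in addition $q$ is an odd positive integer, then for $P$-a.e. $\omega$, $X(t)^q$ is integrable for every $t\ge 0$ and $$\lim_{t\to\infty}\frac{E_\omega(X(t)^q)}{t^{q/2}}=0 .$$ -/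

import Mathlib

namespace LevyEnv

noncomputable section

/-- The environment (array of targets) with gap sequence `z`: for `k ≥ 0` the target `ω_k` is
`z_1 + ⋯ + z_k`, and for `k < 0` it is `-(z_{k+1} + ⋯ + z_0)`. -/
def environment (z : ℤ → ℝ) (k : ℤ) : ℝ :=
  ∑ j ∈ Finset.Ioc 0 k, z j - ∑ j ∈ Finset.Ioc k 0, z j

theorem environment_zero (z : ℤ → ℝ) : environment z 0 = 0 := by
  simp [environment]

theorem environment_rec (z : ℤ → ℝ) (k : ℤ) :
    environment z k = environment z (k - 1) + z k := by
  unfold environment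
  rcases le_or_gt k 0 with h | h
  · have h1 : Finset.Ioc (0 : ℤ) k = ∅ := Finset.Ioc_eq_empty (by omega)
    have h2 : Finset.Ioc (0 : ℤ) (k - 1) = ∅ := Finset.Ioc_eq_empty (by omega)
    have h3 : Finset.Ioc (k - 1) (0 : ℤ) = insert k (Finset.Ioc k 0) := by
      ext j; simp only [Finset.mem_Ioc, Finset.mem_insert]; omega
    rw [h1, h2, h3, Finset.sum_insert (by simp)]
    simp
  · have h1 : Finset.Ioc k (0 : ℤ) = ∅ := Finset.Ioc_eq_empty (by omega)
    have h2 : Finset.Ioc (k - 1) (0 : ℤ) = ∅ := Finset.Ioc_eq_empty (by omega)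
    have h3 : Finset.Ioc (0 : ℤ) k = insert k (Finset.Ioc 0 (k - 1)) := by
      ext j; simp only [Finset.mem_Ioc, Finset.mem_insert]; omega
    rw [h1, h2, h3, Finset.sum_insert (by simp)]
    simp [add_comm]

/-- The underlying walk `S_n` with increments `x`. The increment of step `n + 1`, usually written
`ξ_{n+1}`, is `x n`. -/
def walk (x : ℕ → ℤ) (n : ℕ) : ℤ := ∑ i ∈ Finset.range n, x i

/-- The collision time `τ(n)`: the total length of the first `n` jumps of `Y_n = ω_{S_n}`. -/
def collisionTime (w : ℤ → ℝ) (x : ℕ → ℤ) (n : ℕ) : ℝ :=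
  ∑ i ∈ Finset.range n, |w (walk x (i + 1)) - w (walk x i)|

/-- The number of collisions up to time `t`, i.e. the largest `m` with `τ(m) ≤ t`. -/
def collisionNumber (w : ℤ → ℝ) (x : ℕ → ℤ) (t : ℝ) : ℕ :=
  sSup {m : ℕ | collisionTime w x m ≤ t}

/-- The continuous-time walk: `X(t) = Y_n + sgn(ξ_{n+1}) (t - τ(n))` for
`τ(n) ≤ t < τ(n+1)`. -/
def process (w : ℤ → ℝ) (x : ℕ → ℤ) (t : ℝ) : ℝ :=
  w (walk x (collisionNumber w x t)) +
    ((x (collisionNumber w x t)).sign : ℝ) * (t - collisionTime w x (collisionNumber w x t))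

theorem collisionTime_mono (w : ℤ → ℝ) (x : ℕ → ℤ) : Monotone (collisionTime w x) := by
  refine monotone_nat_of_le_succ fun n => ?_
  simp only [collisionTime, Finset.sum_range_succ]
  exact le_add_of_nonneg_right (abs_nonneg _)

theorem process_eq (w : ℤ → ℝ) (x : ℕ → ℤ) (n : ℕ) (t : ℝ)
    (h1 : collisionTime w x n ≤ t) (h2 : t < collisionTime w x (n + 1)) :
    process w x t = w (walk x n) + ((x n).sign : ℝ) * (t - collisionTime w x n) := by
  have h : collisionNumber w x t = n := by
    have : IsGreatest {m : ℕ | collisionTime w x m ≤ t} n := by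
      refine ⟨h1, fun m hm => ?_⟩
      by_contra hlt
      exact absurd (lt_of_lt_of_le h2 (collisionTime_mono w x (by omega : n + 1 ≤ m)))
        (not_lt.mpr hm)
    exact this.csSup_eq
  unfold process
  rw [h]

/-- The variance `v_p = ∑ k² p_k` of the jump distribution. -/
def jumpVariance (p : ℤ → ℝ) : ℝ := ∑' k : ℤ, (k : ℝ) ^ 2 * p k

/-- The mean absolute jump `∑ |k| p_k`. -/
def meanAbsJump (p : ℤ → ℝ) : ℝ := ∑' k : ℤ, |(k : ℝ)| * p k

/-- The supremum in `[0, ∞]` of the exponents `q > 0` with `∑ |k|^q p_k < ∞`. -/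
def qbar (p : ℤ → ℝ) : EReal :=
  sSup ((fun q : ℝ => (q : EReal)) ''
    {q : ℝ | 0 < q ∧ Summable fun k : ℤ => |(k : ℝ)| ^ q * p k})

/-- The `q`-th absolute moment `m_q` of the centered normal law with variance `v_p`. -/
def gaussMoment (p : ℤ → ℝ) (q : ℝ) : ℝ :=
  ∫ y, |y| ^ q ∂(ProbabilityTheory.gaussianReal 0 (jumpVariance p).toNNReal)

end

end LevyEnv

/-! Between collisions X moves at unit speed, and the targets satisfy ω_k ≈ μk. If n jumps are
completed by time t, then X(t) ≈ μ S_n, while τ(n) ≈ μ m̄ n. Hence n ≈ t/(μ m̄), and the central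
limit theorem for S_n makes X(t)/√t converge to √(μ/m̄) times the centered normal law of variance
v_p (`tendstoInDistribution_process`). Uniform integrability of the q-th powers (`momentUI_process`)
upgrades this to convergence of moments (`tendsto_integral_of_momentUI`); odd moments of the limit
vanish by symmetry. Two points are hard: the law of large numbers for τ(n) in almost every fixed
environment, and the moments at the critical exponent q = q̄, where ∑ |k|^q p_k may diverge.

Environment (`ae_regularEnvironment`). With gaps capped and long jumps discarded, τ(n) is a linear
combination of independent bounded gaps whose weights count crossings. For a fixed walk Hoeffding's
inequality applies, and its variance is governed by the maximal local time. That local time is below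
n^(5/6) outside an event of rapidly decaying probability, because an energy estimate and a Nash
inequality for the symmetric decreasing heat kernel make the cubes of the return probabilities
summable. Tonelli and Borel–Cantelli turn the averaged estimate into a quenched one. For the
discarded part only means are needed: a symmetric decreasing law is a mixture of uniform laws on
intervals [-N, N], so the walk sees averages of the environment, which the strong law controls.

Moments. Steps are split at √m. The small ones form a walk whose rescaled maximum has uniformly
exponential tails; the large ones are rare, and the moments of their sum follow from a product
bound. Since |X(t)| ≤ t, large jumps may be capped at order t, and after capping a finite moment of
some order r with 1 + q/2 < r < q suffices. Such an r exists when 2 < q ≤ q̄ and the q-th moment is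
infinite; for q ≤ 2 the variance is enough. The comparison with the walk needs at most t/c
collisions by time t; the failure of this has rapidly decaying probability, which beats the
deterministic bound |X(t)| ≤ t. -/

namespace LevyEnv

open MeasureTheory ProbabilityTheory Filter
open scoped Topology ENNReal NNReal

/-! ### Path space, first-step decomposition and maximal inequalities. -/

section PathLaw

variable (ρ : Measure ℤ) [IsProbabilityMeasure ρ]

/-- The law of an i.i.d. sequence of integers with common law `ρ`. -/
noncomputable def pathLaw : Measure (ℕ → ℤ) := Measure.infinitePi fun _ => ρ

instance : IsProbabilityMeasure (pathLaw ρ) := by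
  unfold pathLaw; infer_instance

/-- Prepend a first step to a sequence of steps. -/
def pathCons (z : ℤ) (x : ℕ → ℤ) : ℕ → ℤ
  | 0 => z
  | n + 1 => x n

@[simp] theorem pathCons_zero (z : ℤ) (x : ℕ → ℤ) : pathCons z x 0 = z := rfl

@[simp] theorem pathCons_succ (z : ℤ) (x : ℕ → ℤ) (n : ℕ) : pathCons z x (n + 1) = x n := rfl

theorem measurable_pathCons : Measurable fun u : ℤ × (ℕ → ℤ) => pathCons u.1 u.2 := by
  refine measurable_pi_lambda _ fun n => ?_
  cases n with
  | zero => exact measurable_fst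
  | succ n => exact (measurable_pi_apply n).comp measurable_snd

/-- This is the Markov property at time one, on which every induction over the number of steps
rests. It is enough to compare measures on finite-dimensional boxes, which determine an infinite
product. -/
theorem measurePreserving_pathCons :
    MeasurePreserving (fun u : ℤ × (ℕ → ℤ) => pathCons u.1 u.2)
      (ρ.prod (pathLaw ρ)) (pathLaw ρ) := by
  refine ⟨measurable_pathCons, ?_⟩
  refine Measure.eq_infinitePi (μ := fun _ : ℕ => ρ) fun s t ht => ?_
  classical
  rw [Measure.map_apply measurable_pathCons (MeasurableSet.pi s.countable_toSet fun i _ => ht i)]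
  let s' : Finset ℕ := s.preimage Nat.succ (Nat.succ_injective.injOn)
  have hpre : (fun u : ℤ × (ℕ → ℤ) => pathCons u.1 u.2) ⁻¹' Set.pi (s : Set ℕ) t =
      (if 0 ∈ s then t 0 else Set.univ) ×ˢ Set.pi (s' : Set ℕ) fun i => t (i + 1) := by
    ext ⟨z, x⟩
    simp only [Set.mem_preimage, Set.mem_pi, Finset.mem_coe, Set.mem_prod, s', Finset.mem_preimage]
    constructor
    · intro h
      refine ⟨?_, fun i hi => h (i + 1) hi⟩
      split_ifs with h0
      · exact h 0 h0
      · trivial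
    · rintro ⟨h0, h1⟩ i hi
      cases i with
      | zero => simpa [hi] using h0
      | succ i => exact h1 i hi
  rw [hpre, Measure.prod_prod]
  have h2 : pathLaw ρ (Set.pi (s' : Set ℕ) fun i => t (i + 1)) = ∏ i ∈ s', ρ (t (i + 1)) :=
    Measure.infinitePi_pi (μ := fun _ : ℕ => ρ) fun i _ => ht (i + 1)
  rw [h2]
  have h3 : ∏ i ∈ s', ρ (t (i + 1)) = ∏ i ∈ s.erase 0, ρ (t i) := by
    refine Finset.prod_bij (fun i _ => i + 1) ?_ ?_ ?_ ?_
    · intro i hi; simpa [s'] using hi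
    · intro i _ j _ h; omega
    · intro j hj
      rw [Finset.mem_erase] at hj
      obtain ⟨k, rfl⟩ := Nat.exists_eq_succ_of_ne_zero hj.1
      exact ⟨k, by simpa [s'] using hj.2, rfl⟩
    · intro i _; rfl
  rw [h3]
  split_ifs with h0
  · exact Finset.mul_prod_erase s (fun i => ρ (t i)) h0
  · simp [Finset.erase_eq_of_notMem h0]

theorem lintegral_pathLaw {F : (ℕ → ℤ) → ℝ≥0∞} (hF : Measurable F) :
    ∫⁻ x, F x ∂pathLaw ρ = ∫⁻ z, ∫⁻ x, F (pathCons z x) ∂pathLaw ρ ∂ρ := by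
  rw [← (measurePreserving_pathCons ρ).lintegral_comp hF,
    lintegral_prod (fun u : ℤ × (ℕ → ℤ) => F (pathCons u.1 u.2))
      (hF.comp measurable_pathCons).aemeasurable]

theorem measure_pathLaw {A : Set (ℕ → ℤ)} (hA : MeasurableSet A) :
    pathLaw ρ A = ∫⁻ z, pathLaw ρ {x | pathCons z x ∈ A} ∂ρ := by
  rw [← lintegral_indicator_one hA, lintegral_pathLaw ρ (measurable_one.indicator hA)]
  refine lintegral_congr fun z => ?_
  have : Measurable fun x : ℕ → ℤ => pathCons z x :=
    measurable_pathCons.comp (measurable_const.prodMk measurable_id)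
  exact lintegral_indicator_one (this hA)

theorem measurePreserving_shift (m : ℕ) :
    MeasurePreserving (fun (x : ℕ → ℤ) i => x (m + i)) (pathLaw ρ) (pathLaw ρ) :=
  ⟨by fun_prop, Measure.map_infinitePi_infinitePi_of_inj (P := fun _ : ℕ => ρ)
    (add_right_injective m)⟩

theorem measurePreserving_eval (i : ℕ) :
    MeasurePreserving (fun x : ℕ → ℤ => x i) (pathLaw ρ) ρ :=
  measurePreserving_eval_infinitePi (fun _ => ρ) i

theorem iIndepFun_pathLaw {β : Type*} [MeasurableSpace β] (φ : ℤ → β) :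
    iIndepFun (fun i (x : ℕ → ℤ) => φ (x i)) (pathLaw ρ) :=
  iIndepFun_infinitePi (X := fun _ => φ) fun _ => measurable_of_countable φ

theorem measurable_walk (n : ℕ) : Measurable fun x : ℕ → ℤ => walk x n := by
  unfold walk
  exact Finset.measurable_sum _ fun i _ => measurable_pi_apply i

theorem walk_pathCons (z : ℤ) (x : ℕ → ℤ) (n : ℕ) :
    walk (pathCons z x) (n + 1) = z + walk x n := by
  simp [walk, Finset.sum_range_succ', add_comm]

theorem measurable_stepSum {M : Type*} [AddCommMonoid M] [MeasurableSpace M] [MeasurableAdd₂ M]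
    (φ : ℤ → M) (n : ℕ) :
    Measurable fun x : ℕ → ℤ => ∑ i ∈ Finset.range n, φ (x i) :=
  Finset.measurable_sum _ fun i _ => (measurable_of_countable φ).comp (measurable_pi_apply i)

/-- A maximal inequality: a space-time supersolution `V` that is at least `1` on `A` dominates the
probability that the walk with increments `φ (x i)` started at `y` visits `A` within `n` steps. -/
theorem measure_exists_mem_le {φ : ℤ → ℝ} {A : Set ℝ} (hA : MeasurableSet A)
    {V : ℕ → ℝ → ℝ≥0∞} (h1 : ∀ n, ∀ y ∈ A, 1 ≤ V n y)
    (h2 : ∀ n y, ∫⁻ z, V n (y + φ z) ∂ρ ≤ V (n + 1) y) (n : ℕ) (y : ℝ) :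
    pathLaw ρ {x | ∃ k ≤ n, y + ∑ i ∈ Finset.range k, φ (x i) ∈ A} ≤ V n y := by
  -- A start inside `A` is covered by `h1`. From outside, a visit within `n + 1` steps is, after the
  -- first step, a visit within `n` steps from `y + φ z`, and `h2` closes the induction.
  induction n generalizing y with
  | zero =>
    by_cases hy : y ∈ A
    · exact prob_le_one.trans (h1 0 y hy)
    · have : {x : ℕ → ℤ | ∃ k ≤ 0, y + ∑ i ∈ Finset.range k, φ (x i) ∈ A} = ∅ := by
        ext x; simp [hy]
      rw [this]; simp
  | succ n ih =>
    by_cases hy : y ∈ A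
    · exact prob_le_one.trans (h1 _ y hy)
    · refine le_trans ?_ (h2 n y)
      rw [measure_pathLaw]
      · refine lintegral_mono fun z => le_trans (measure_mono ?_) (ih (y + φ z))
        rintro x ⟨k, hk, hx⟩
        cases k with
        | zero => simp [hy] at hx
        | succ k =>
          refine ⟨k, by omega, ?_⟩
          simpa [Finset.sum_range_succ', add_assoc, add_comm (φ z)] using hx
      · have : {x : ℕ → ℤ | ∃ k ≤ n + 1, y + ∑ i ∈ Finset.range k, φ (x i) ∈ A} =
            ⋃ k ∈ Set.Iic (n + 1), {x | y + ∑ i ∈ Finset.range k, φ (x i) ∈ A} := by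
          ext x; simp
        rw [this]
        exact MeasurableSet.biUnion (Set.to_countable _) fun k _ =>
          (measurable_const.add (measurable_stepSum φ k)) hA

theorem integral_quadratic {φ : ℤ → ℝ} (hφ : Integrable φ ρ) (h0 : ∫ z, φ z ∂ρ = 0)
    (hφ2 : Integrable (fun z => φ z ^ 2) ρ) (a b c : ℝ) :
    Integrable (fun z => a + b * φ z + c * φ z ^ 2) ρ ∧
      ∫ z, (a + b * φ z + c * φ z ^ 2) ∂ρ = a + c * ∫ z, φ z ^ 2 ∂ρ := by
  have i1 : Integrable (fun z => a + b * φ z) ρ := (integrable_const _).add (hφ.const_mul _)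
  have i2 : Integrable (fun z => c * φ z ^ 2) ρ := hφ2.const_mul _
  refine ⟨i1.add i2, ?_⟩
  rw [integral_add i1 i2, integral_add (integrable_const _) (hφ.const_mul _),
    integral_const_mul, integral_const_mul, h0]
  simp

/-- Kolmogorov's maximal inequality. -/
theorem kolmogorov_maximal {φ : ℤ → ℝ} {v : ℝ} (hφ : Integrable φ ρ) (h0 : ∫ z, φ z ∂ρ = 0)
    (hφ2 : Integrable (fun z => φ z ^ 2) ρ) (hv : ∫ z, φ z ^ 2 ∂ρ ≤ v)
    {r : ℝ} (hr : 0 < r) (n : ℕ) :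
    pathLaw ρ {x | ∃ k ≤ n, r ≤ |∑ i ∈ Finset.range k, φ (x i)|} ≤
      ENNReal.ofReal (n * v / r ^ 2) := by
  -- A centered step raises the mean of y² by at most `v`, which is exactly what the remaining-time
  -- term `n * v` gives up.
  have key := measure_exists_mem_le ρ (φ := φ) (A := {y | r ≤ |y|})
    (V := fun n y => ENNReal.ofReal ((y ^ 2 + n * v) / r ^ 2))
    (measurableSet_le measurable_const (by fun_prop)) ?_ ?_ n 0
  · simpa using key
  · have hv0 : 0 ≤ v := le_trans (integral_nonneg fun z => sq_nonneg _) hv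
    intro n y hy
    rw [ENNReal.one_le_ofReal, one_le_div (by positivity)]
    have : r ^ 2 ≤ |y| ^ 2 := pow_le_pow_left₀ hr.le hy 2
    rw [sq_abs] at this
    nlinarith [mul_nonneg (Nat.cast_nonneg (α := ℝ) n) hv0]
  · intro n y
    have hv0 : 0 ≤ v := le_trans (integral_nonneg fun z => sq_nonneg _) hv
    have hexp : ∀ z, ((y + φ z) ^ 2 + n * v) / r ^ 2 =
        ((y ^ 2 + n * v) + 2 * y * φ z + 1 * φ z ^ 2) / r ^ 2 := fun z => by ring
    obtain ⟨hi, he⟩ := integral_quadratic ρ hφ h0 hφ2 (y ^ 2 + n * v) (2 * y) 1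
    simp only [hexp]
    rw [← ofReal_integral_eq_lintegral_ofReal (hi.div_const _) (ae_of_all _ fun z => ?_)]
    · refine ENNReal.ofReal_le_ofReal ?_
      rw [integral_div]
      refine div_le_div_of_nonneg_right ?_ (by positivity)
      rw [he]
      push_cast
      linarith
    · simp only [Pi.zero_apply]
      rw [← hexp]
      positivity

theorem exp_le_one_add_add_sq {u : ℝ} (hu : |u| ≤ 1) : Real.exp u ≤ 1 + u + u ^ 2 := by
  have := Real.abs_exp_sub_one_sub_id_le hu
  linarith [abs_le.1 this]

/-- The supersolution is exp(h(y - r)) (1 + h²v)^n. As |hφ| ≤ 1, e^{hφ} ≤ 1 + hφ + h²φ², whose mean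
is at most 1 + h²v for a centered φ. -/
theorem exp_maximal_aux {φ : ℤ → ℝ} {v h : ℝ} (hh : 0 ≤ h) (hb : ∀ z, |h * φ z| ≤ 1)
    (hφ : Integrable φ ρ) (h0 : ∫ z, φ z ∂ρ = 0)
    (hφ2 : Integrable (fun z => φ z ^ 2) ρ) (hv : ∫ z, φ z ^ 2 ∂ρ ≤ v)
    (r : ℝ) (n : ℕ) :
    pathLaw ρ {x | ∃ k ≤ n, r ≤ ∑ i ∈ Finset.range k, φ (x i)} ≤
      ENNReal.ofReal (Real.exp (-(h * r)) * (1 + h ^ 2 * v) ^ n) := by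
  have hv0 : 0 ≤ v := le_trans (integral_nonneg fun z => sq_nonneg _) hv
  have key := measure_exists_mem_le ρ (φ := φ) (A := {y | r ≤ y})
    (V := fun n y => ENNReal.ofReal (Real.exp (h * (y - r)) * (1 + h ^ 2 * v) ^ n))
    (measurableSet_le measurable_const (by fun_prop)) ?_ ?_ n 0
  · simpa using key
  · intro n y hy
    rw [ENNReal.one_le_ofReal]
    have h1 : 1 ≤ Real.exp (h * (y - r)) :=
      Real.one_le_exp (mul_nonneg hh (sub_nonneg.2 hy))
    have h2 : 1 ≤ (1 + h ^ 2 * v) ^ n := one_le_pow₀ (by nlinarith [mul_nonneg (sq_nonneg h) hv0])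
    nlinarith
  · intro n y
    set c : ℝ := Real.exp (h * (y - r)) * (1 + h ^ 2 * v) ^ n with hc
    have hc0 : 0 ≤ c := by positivity
    obtain ⟨hi0, he⟩ := integral_quadratic ρ hφ h0 hφ2 1 h (h ^ 2)
    have hi : Integrable (fun z => c * (1 + h * φ z + (h * φ z) ^ 2)) ρ := by
      simp only [mul_pow]
      exact hi0.const_mul _
    calc ∫⁻ z, ENNReal.ofReal (Real.exp (h * (y + φ z - r)) * (1 + h ^ 2 * v) ^ n) ∂ρ
        ≤ ∫⁻ z, ENNReal.ofReal (c * (1 + h * φ z + (h * φ z) ^ 2)) ∂ρ := by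
          refine lintegral_mono fun z => ENNReal.ofReal_le_ofReal ?_
          have : h * (y + φ z - r) = h * (y - r) + h * φ z := by ring
          rw [this, Real.exp_add, hc]
          nlinarith [mul_le_mul_of_nonneg_left (exp_le_one_add_add_sq (hb z)) hc0]
      _ = ENNReal.ofReal (∫ z, c * (1 + h * φ z + (h * φ z) ^ 2) ∂ρ) := by
          rw [ofReal_integral_eq_lintegral_ofReal hi (ae_of_all _ fun z => ?_)]
          exact mul_nonneg hc0 ((Real.exp_pos _).le.trans (exp_le_one_add_add_sq (hb z)))
      _ ≤ _ := by
          refine ENNReal.ofReal_le_ofReal ?_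
          simp only [mul_pow]
          rw [integral_const_mul, he, pow_succ (1 + h ^ 2 * v) n, ← mul_assoc, ← hc]
          exact mul_le_mul_of_nonneg_left (by nlinarith [sq_nonneg h]) hc0

/-- An exponential maximal inequality for bounded centered steps. -/
theorem exp_maximal {φ : ℤ → ℝ} {v h : ℝ} (hh : 0 ≤ h) (hb : ∀ z, |h * φ z| ≤ 1)
    (hφ : Integrable φ ρ) (h0 : ∫ z, φ z ∂ρ = 0)
    (hφ2 : Integrable (fun z => φ z ^ 2) ρ) (hv : ∫ z, φ z ^ 2 ∂ρ ≤ v)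
    (r : ℝ) (n : ℕ) :
    pathLaw ρ {x | ∃ k ≤ n, r ≤ |∑ i ∈ Finset.range k, φ (x i)|} ≤
      2 * ENNReal.ofReal (Real.exp (-(h * r)) * (1 + h ^ 2 * v) ^ n) := by
  have e1 := exp_maximal_aux ρ hh hb hφ h0 hφ2 hv r n
  have e2 := exp_maximal_aux ρ (φ := fun z => - φ z) hh (by simpa using hb) hφ.neg
    (by rw [integral_neg, h0, neg_zero]) (by simpa using hφ2) (by simpa using hv) r n
  refine le_trans (measure_mono ?_) ((measure_union_le _ _).trans ((add_le_add e1 e2).trans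
    (two_mul _).ge))
  rintro x ⟨k, hk, hx⟩
  rcases le_abs.1 hx with h | h
  · exact Or.inl ⟨k, hk, h⟩
  · exact Or.inr ⟨k, hk, by simpa using h⟩

theorem lintegral_prod_pathLaw (g : ℤ → ℝ≥0∞) (n : ℕ) :
    ∫⁻ x, ∏ i ∈ Finset.range n, g (x i) ∂pathLaw ρ = (∫⁻ z, g z ∂ρ) ^ n := by
  have hm : ∀ n, Measurable fun x : ℕ → ℤ => ∏ i ∈ Finset.range n, g (x i) := fun n =>
    Finset.measurable_prod _ fun i _ => (measurable_of_countable g).comp (measurable_pi_apply i)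
  induction n with
  | zero => simp
  | succ n ih =>
    rw [lintegral_pathLaw ρ (hm _)]
    simp only [Finset.prod_range_succ', pathCons_succ, pathCons_zero]
    simp_rw [lintegral_mul_const _ (hm n), ih]
    rw [lintegral_const_mul _ (measurable_of_countable g), pow_succ]

theorem one_add_sum_le_prod_one_add {ι : Type*} (s : Finset ι) (b : ι → ℝ≥0∞) :
    1 + ∑ i ∈ s, b i ≤ ∏ i ∈ s, (1 + b i) := by
  classical
  induction s using Finset.induction_on with
  | empty => simp
  | insert i s hi ih =>
    rw [Finset.sum_insert hi, Finset.prod_insert hi]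
    calc 1 + (b i + ∑ j ∈ s, b j) ≤ (1 + ∑ j ∈ s, b j) + b i * (1 + ∑ j ∈ s, b j) := by
          rw [mul_add, mul_one, add_comm (b i), ← add_assoc, ← add_assoc]
          exact le_self_add
      _ = (1 + b i) * (1 + ∑ j ∈ s, b j) := by ring
      _ ≤ _ := by gcongr

/-- Moments of a sum of independent jumps, each of which is either `0` or at least `1`. -/
theorem lintegral_sum_rpow_le {b : ℤ → ℝ≥0∞} (hb : ∀ z, b z = 0 ∨ 1 ≤ b z) {q : ℝ} (hq : 1 ≤ q)
    (n : ℕ) :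
    ∫⁻ x, (∑ i ∈ Finset.range n, b (x i)) ^ q ∂pathLaw ρ + 1 ≤
      (1 + 2 ^ q * ∫⁻ z, b z ^ q ∂ρ) ^ n := by
  -- With s the sum, s^q + 1 ≤ (1 + s)^q ≤ ∏ (1 + b_i)^q, and the mean of the product factorises by
  -- independence.
  have h1 : ∫⁻ x, ((∑ i ∈ Finset.range n, b (x i)) ^ q + 1) ∂pathLaw ρ ≤
      ∫⁻ x, ∏ i ∈ Finset.range n, (1 + b (x i)) ^ q ∂pathLaw ρ := by
    refine lintegral_mono fun x => ?_
    dsimp only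
    rw [ENNReal.prod_rpow_of_nonneg (by linarith)]
    refine le_trans ?_ (ENNReal.rpow_le_rpow (one_add_sum_le_prod_one_add _ _) (by linarith))
    have := ENNReal.add_rpow_le_rpow_add (∑ i ∈ Finset.range n, b (x i)) 1 hq
    rwa [ENNReal.one_rpow, add_comm (∑ i ∈ Finset.range n, b (x i)) 1] at this
  rw [lintegral_add_right _ measurable_const] at h1
  simp only [lintegral_const, measure_univ, mul_one] at h1
  refine h1.trans ?_
  rw [lintegral_prod_pathLaw ρ (fun z => (1 + b z) ^ q)]
  refine pow_le_pow_left' ?_ n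
  calc ∫⁻ z, (1 + b z) ^ q ∂ρ ≤ ∫⁻ z, (1 + 2 ^ q * b z ^ q) ∂ρ := by
        refine lintegral_mono fun z => ?_
        -- The dichotomy is used here: where b ≥ 1 one has (1 + b)^q ≤ (2b)^q, and where b = 0
        -- nothing is lost.
        rcases hb z with h | h
        · simp [h]
        · rw [← ENNReal.mul_rpow_of_nonneg _ _ (by linarith : (0:ℝ) ≤ q)]
          refine le_trans (ENNReal.rpow_le_rpow ?_ (by linarith)) le_add_self
          rw [two_mul]; gcongr
    _ = _ := by
        rw [lintegral_add_left measurable_const, lintegral_const_mul _ (measurable_of_countable _)]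
        simp

end PathLaw

/-! ### Symmetric decreasing functions: convolution and layers. -/

/-- Symmetric functions on `ℤ` that decrease away from the origin. -/
structure SymmDecreasing (f : ℤ → ℝ) : Prop where
  symm : ∀ x, f (-x) = f x
  anti : ∀ x, 0 ≤ x → f (x + 1) ≤ f x

namespace SymmDecreasing

variable {f : ℤ → ℝ}

theorem le_of_nonneg (hf : SymmDecreasing f) {x y : ℤ} (hx : 0 ≤ x) (hxy : x ≤ y) : f y ≤ f x := by
  obtain ⟨n, rfl⟩ := Int.le.dest hxy
  induction n with
  | zero => simp
  | succ n ih =>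
    push_cast at *
    rw [← add_assoc]
    exact (hf.anti _ (by omega)).trans (ih (by omega))

theorem abs_eq (hf : SymmDecreasing f) (x : ℤ) : f |x| = f x := by
  rcases abs_choice x with h | h <;> rw [h]
  exact hf.symm x

theorem le_of_abs_le (hf : SymmDecreasing f) {x y : ℤ} (hxy : |x| ≤ |y|) : f y ≤ f x := by
  rw [← hf.abs_eq x, ← hf.abs_eq y]
  exact hf.le_of_nonneg (abs_nonneg x) hxy

theorem le_zero (hf : SymmDecreasing f) (x : ℤ) : f x ≤ f 0 :=
  hf.le_of_abs_le (by simp)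

/-- Discrete Wintner: convolution preserves symmetric decreasing functions. -/
theorem convolution {p : ℤ → ℝ} (hp : SymmDecreasing p) (hps : Summable p) (hp0 : ∀ x, 0 ≤ p x)
    (hf : SymmDecreasing f) (hf0 : ∀ x, 0 ≤ f x) :
    SymmDecreasing fun x => ∑' z, p z * f (x - z) := by
  have hs : ∀ x, Summable fun z => p z * f (x - z) := fun x =>
    Summable.of_nonneg_of_le (fun z => mul_nonneg (hp0 z) (hf0 _))
      (fun z => mul_le_mul_of_nonneg_left (hf.le_zero _) (hp0 z)) (hps.mul_right (f 0))
  refine ⟨fun x => ?_, fun x hx => ?_⟩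
  · rw [← (Equiv.neg ℤ).tsum_eq]
    refine tsum_congr fun z => ?_
    simp only [Equiv.neg_apply, hp.symm]
    rw [← hf.symm]
    congr 2
    ring
  -- The difference of the convolution at x and x + 1 is ∑ p(x - u) d(u). Since d changes sign under
  -- u ↦ -1 - u, it also equals -∑ p(x + 1 + u) d(u). Adding the two forms gives terms (p(x - u) -
  -- p(x + 1 + u)) d(u), each nonnegative because both factors change sign together at u = 0.
  · set d : ℤ → ℝ := fun u => f u - f (u + 1) with hd
    have hd1 : ∀ u, d (-1 - u) = - d u := fun u => by
      simp only [hd]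
      rw [← hf.symm (-1 - u), ← hf.symm (-1 - u + 1)]
      ring_nf
    have e1 : ∑' z, p z * f (x - z) - ∑' z, p z * f (x + 1 - z) = ∑' u, p (x - u) * d u := by
      rw [← (hs x).tsum_sub (hs (x + 1)), ← (Equiv.subLeft x).tsum_eq]
      refine tsum_congr fun u => ?_
      simp only [Equiv.subLeft_apply, hd]
      ring_nf
    have hsd : Summable fun u => p (x - u) * d u := by
      have := ((Equiv.subLeft x).summable_iff.2 ((hs x).sub (hs (x + 1))))
      refine this.congr fun u => ?_
      simp only [Equiv.subLeft_apply, hd, Function.comp]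
      ring_nf
    have e2 : ∑' u, p (x - u) * d u = ∑' u, -(p (x + 1 + u) * d u) := by
      rw [← (Equiv.subLeft (-1 : ℤ)).tsum_eq]
      refine tsum_congr fun u => ?_
      simp only [Equiv.subLeft_apply, hd1]
      ring_nf
    have hsd2 : Summable fun u => -(p (x + 1 + u) * d u) := by
      refine ((Equiv.subLeft (-1 : ℤ)).summable_iff.2 hsd).congr fun u => ?_
      simp only [Equiv.subLeft_apply, hd1, Function.comp]
      ring_nf
    have e3 : 0 ≤ ∑' u, (p (x - u) * d u + -(p (x + 1 + u) * d u)) := by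
      refine tsum_nonneg fun u => ?_
      have : p (x - u) * d u + -(p (x + 1 + u) * d u) = (p (x - u) - p (x + 1 + u)) * d u := by ring
      rw [this]
      rcases le_or_gt 0 u with hu | hu
      · refine mul_nonneg (sub_nonneg.2 (hp.le_of_abs_le ?_)) (sub_nonneg.2 (hf.anti u hu))
        rw [abs_le, abs_of_nonneg (by omega : 0 ≤ x + 1 + u)]
        omega
      · refine mul_nonneg_of_nonpos_of_nonpos (sub_nonpos.2 (hp.le_of_abs_le ?_)) ?_
        · rw [abs_le, abs_of_nonneg (by omega : 0 ≤ x - u)]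
          omega
        · simp only [hd]
          rw [sub_nonpos]
          exact hf.le_of_abs_le (by rw [abs_of_neg hu, abs_le]; omega)
    rw [hsd.tsum_add hsd2, ← e2, ← e1] at e3
    linarith

/-- Layer-cake formula: f is a nonnegative combination of indicators of the intervals [-N, N], and
the partial sums telescope. Summing against f therefore amounts to averaging over symmetric
intervals. -/
theorem hasSum_layers (hf : SymmDecreasing f) (h0 : Tendsto (fun n : ℕ => f n) atTop (𝓝 0))
    (x : ℤ) :
    HasSum (fun N : ℕ => if x ∈ Finset.Icc (-(N : ℤ)) N then f N - f (N + 1) else 0) (f x) := by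
  obtain ⟨m, hm⟩ : ∃ m : ℕ, |x| = m := ⟨x.natAbs, by simp⟩
  have hmem : ∀ N : ℕ, x ∈ Finset.Icc (-(N : ℤ)) N ↔ m ≤ N := fun N => by
    rw [Finset.mem_Icc, ← abs_le, hm]; exact Nat.cast_le
  rw [← hf.abs_eq, hm]
  have hps : ∀ n : ℕ, ∑ N ∈ Finset.range n,
      (if x ∈ Finset.Icc (-(N : ℤ)) N then f N - f (N + 1) else 0) =
        if m ≤ n then f m - f n else 0 := by
    intro n
    induction n with
    | zero => by_cases h : m ≤ 0 <;> simp_all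
    | succ n ih =>
      rw [Finset.sum_range_succ, ih]
      simp only [hmem]
      rcases lt_trichotomy m (n + 1) with h | h | h
      · simp [Nat.lt_succ_iff.1 h, h.le]
      · subst h; simp
      · simp [not_le.2 h, not_le.2 (by omega : n < m)]
  rw [hasSum_iff_tendsto_nat_of_nonneg]
  · simp only [hps]
    have : Tendsto (fun n : ℕ => f m - f n) atTop (𝓝 (f m - 0)) := tendsto_const_nhds.sub h0
    rw [sub_zero] at this
    refine this.congr' ?_
    filter_upwards [eventually_ge_atTop m] with n hn
    simp [hn]
  · intro N
    split_ifs
    · exact sub_nonneg.2 (hf.anti N (by omega))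
    · exact le_rfl

/-- Summation by parts against a symmetric decreasing function. -/
theorem tsum_mul_le (hf : SymmDecreasing f) (h0 : Tendsto (fun n : ℕ => f n) atTop (𝓝 0))
    {F : ℤ → ℝ≥0∞} {a B : ℝ≥0∞}
    (hF : ∀ N : ℕ, ∑ x ∈ Finset.Icc (-(N : ℤ)) N, F x ≤ a * (2 * N + 1) + B) :
    ∑' x, ENNReal.ofReal (f x) * F x ≤
      a * ∑' x, ENNReal.ofReal (f x) + B * ENNReal.ofReal (f 0) := by
  have hd : ∀ N : ℕ, 0 ≤ f N - f (N + 1) := fun N => sub_nonneg.2 (hf.anti N (by omega))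
  have hlay : ∀ x, ENNReal.ofReal (f x) = ∑' N : ℕ,
      if x ∈ Finset.Icc (-(N : ℤ)) N then ENNReal.ofReal (f N - f (N + 1)) else 0 := by
    intro x
    have h := hf.hasSum_layers h0 x
    rw [← h.tsum_eq, ENNReal.ofReal_tsum_of_nonneg _ h.summable]
    · refine tsum_congr fun N => ?_
      split_ifs <;> simp
    · intro N; split_ifs
      · exact hd N
      · exact le_rfl
  have hswap : ∀ G : ℤ → ℝ≥0∞, ∑' x, ENNReal.ofReal (f x) * G x =
      ∑' N : ℕ, ENNReal.ofReal (f N - f (N + 1)) * ∑ x ∈ Finset.Icc (-(N : ℤ)) N, G x := by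
    intro G
    simp only [hlay, ← ENNReal.tsum_mul_right]
    rw [ENNReal.tsum_comm]
    refine tsum_congr fun N => ?_
    rw [Finset.mul_sum, tsum_eq_sum (s := Finset.Icc (-(N : ℤ)) N)]
    · exact Finset.sum_congr rfl fun x hx => by simp only [hx, if_true]
    · intro x hx; simp only [hx, if_false, zero_mul]
  have h1 : ∑' x, ENNReal.ofReal (f x) =
      ∑' N : ℕ, ENNReal.ofReal (f N - f (N + 1)) * (2 * N + 1) := by
    have := hswap fun _ => 1
    simp only [mul_one] at this
    rw [this]
    refine tsum_congr fun N => ?_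
    congr 1
    simp only [Finset.sum_const, Int.card_Icc, nsmul_eq_mul, mul_one]
    have : ((N : ℤ) + 1 - -(N : ℤ)).toNat = 2 * N + 1 := by omega
    rw [this]; push_cast; rfl
  have h2 : ENNReal.ofReal (f 0) = ∑' N : ℕ, ENNReal.ofReal (f N - f (N + 1)) := by
    rw [hlay 0]
    exact tsum_congr fun N => by simp
  rw [hswap F, h1, h2, ← ENNReal.tsum_mul_left, ← ENNReal.tsum_mul_left, ← ENNReal.tsum_add]
  refine ENNReal.tsum_le_tsum fun N => ?_
  calc _ ≤ ENNReal.ofReal (f N - f (N + 1)) * (a * (2 * N + 1) + B) := by gcongr; exact hF N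
    _ = _ := by ring

end SymmDecreasing

/-! ### The heat kernel, a Nash inequality and a variance bound. -/

section HeatKernel

set_option linter.unusedSectionVars false

variable (ρ : Measure ℤ) [IsProbabilityMeasure ρ]

/-- The transition probabilities of the walk with step law `ρ`. -/
noncomputable def heatKernel (k : ℕ) (x : ℤ) : ℝ≥0∞ := pathLaw ρ {w | walk w k = x}

theorem measurableSet_walk_eq (k : ℕ) (x : ℤ) : MeasurableSet {w : ℕ → ℤ | walk w k = x} :=
  measurable_walk k (measurableSet_singleton x)

theorem heatKernel_le_one (k : ℕ) (x : ℤ) : heatKernel ρ k x ≤ 1 := prob_le_one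

theorem heatKernel_ne_top (k : ℕ) (x : ℤ) : heatKernel ρ k x ≠ ∞ := measure_ne_top _ _

theorem heatKernel_zero (x : ℤ) : heatKernel ρ 0 x = if x = 0 then 1 else 0 := by
  unfold heatKernel
  split_ifs with h
  · subst h; simp [walk]
  · simp [walk, Ne.symm h]

theorem heatKernel_succ (k : ℕ) (x : ℤ) :
    heatKernel ρ (k + 1) x = ∫⁻ z, heatKernel ρ k (x - z) ∂ρ := by
  unfold heatKernel
  rw [measure_pathLaw ρ (measurableSet_walk_eq _ _)]
  refine lintegral_congr fun z => ?_
  congr 1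
  ext w
  simp only [Set.mem_ofPred_eq, walk_pathCons]
  omega

theorem lintegral_walk (k : ℕ) (F : ℤ → ℝ≥0∞) :
    ∫⁻ w, F (walk w k) ∂pathLaw ρ = ∑' x, heatKernel ρ k x * F x := by
  rw [← lintegral_map (measurable_of_countable F) (measurable_walk k), lintegral_countable']
  refine tsum_congr fun x => ?_
  rw [Measure.map_apply (measurable_walk k) (measurableSet_singleton x), mul_comm]
  rfl

theorem tsum_heatKernel (k : ℕ) : ∑' x, heatKernel ρ k x = 1 := by
  simpa using (lintegral_walk ρ k fun _ => 1).symm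

theorem summable_toReal_heatKernel (k : ℕ) : Summable fun x => (heatKernel ρ k x).toReal :=
  ENNReal.summable_toReal (by rw [tsum_heatKernel]; simp)

theorem tsum_toReal_heatKernel (k : ℕ) : ∑' x, (heatKernel ρ k x).toReal = 1 := by
  rw [← ENNReal.tsum_toReal_eq (heatKernel_ne_top ρ k), tsum_heatKernel, ENNReal.toReal_one]

theorem tendsto_heatKernel_space (k : ℕ) :
    Tendsto (fun n : ℕ => (heatKernel ρ k n).toReal) atTop (𝓝 0) :=
  ((summable_toReal_heatKernel ρ k).comp_injective
    (Nat.cast_injective (R := ℤ))).tendsto_atTop_zero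

theorem summable_real_singleton : Summable fun z : ℤ => ρ.real {z} := by
  refine ENNReal.summable_toReal (f := fun z => ρ {z}) ?_
  have := lintegral_countable' (μ := ρ) (fun _ : ℤ => 1)
  simp only [lintegral_const, measure_univ, mul_one, one_mul] at this
  rw [← this]; simp

theorem toReal_heatKernel_succ (k : ℕ) (x : ℤ) :
    (heatKernel ρ (k + 1) x).toReal = ∑' z, ρ.real {z} * (heatKernel ρ k (x - z)).toReal := by
  rw [heatKernel_succ, lintegral_countable', ENNReal.tsum_toReal_eq]
  · refine tsum_congr fun z => ?_
    rw [ENNReal.toReal_mul, mul_comm]; rfl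
  · intro z
    exact ENNReal.mul_ne_top (heatKernel_ne_top ρ _ _) (measure_ne_top _ _)

variable {ρ}

theorem symmDecreasing_heatKernel (hρ : SymmDecreasing fun z => ρ.real {z}) (k : ℕ) :
    SymmDecreasing fun x => (heatKernel ρ k x).toReal := by
  induction k with
  | zero =>
    simp only [heatKernel_zero]
    refine ⟨fun x => by simp, fun x hx => ?_⟩
    rw [if_neg (by omega : x + 1 ≠ 0)]
    simp
  | succ k ih =>
    simp only [toReal_heatKernel_succ]
    exact hρ.convolution (summable_real_singleton ρ) (fun _ => measureReal_nonneg) ih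
      fun _ => ENNReal.toReal_nonneg

theorem heatKernel_le_zero (hρ : SymmDecreasing fun z => ρ.real {z}) (k : ℕ) (x : ℤ) :
    heatKernel ρ k x ≤ heatKernel ρ k 0 :=
  (ENNReal.toReal_le_toReal (heatKernel_ne_top ρ _ _) (heatKernel_ne_top ρ _ _)).1
    ((symmDecreasing_heatKernel hρ k).le_zero x)

/-- A discrete Nash inequality for symmetric decreasing functions. -/
theorem SymmDecreasing.pow_three_le {f : ℤ → ℝ} (hf : SymmDecreasing f) (hf0 : ∀ x, 0 ≤ f x)
    (hs : Summable f) (h1 : ∑' x, f x ≤ 1) {g : ℝ}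
    (hg : ∀ N : ℕ, ∑ x ∈ Finset.range N, (f ((x : ℕ) + 1) - f (x : ℕ)) ^ 2 ≤ g) :
    f 0 ^ 3 ≤ 4 * g := by
  have hsn : Summable fun n : ℕ => f n := hs.comp_injective (Nat.cast_injective (R := ℤ))
  have hlim : Tendsto (fun n : ℕ => f n) atTop (𝓝 0) := hsn.tendsto_atTop_zero
  have hsum : ∀ N : ℕ, ∑ x ∈ Finset.range N, f (x : ℕ) ≤ 1 := fun N => by
    refine le_trans (hsn.sum_le_tsum _ fun _ _ => hf0 _) (le_trans ?_ h1)
    exact tsum_comp_le_tsum_of_inj hs hf0 (Nat.cast_injective (R := ℤ))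
  have hsum' : ∀ N : ℕ, ∑ x ∈ Finset.range N, f ((x : ℕ) + 1) ≤ 1 := fun N =>
    (Finset.sum_le_sum fun x _ => hf.anti _ (Int.natCast_nonneg _)).trans (hsum N)
  -- Telescope f² and apply Cauchy–Schwarz. The differences carry the energy `g`; the squares of the
  -- sums are at most `2 * f 0` times the sums, whose total is at most 2 by the mass bound.
  have key : ∀ N : ℕ, (f 0 ^ 2 - f N ^ 2) ^ 2 ≤ 4 * f 0 * g := fun N => by
    have e : f 0 ^ 2 - f N ^ 2 =
        ∑ x ∈ Finset.range N, (f ((x : ℕ) + 1) - f (x : ℕ)) * -(f ((x : ℕ) + 1) + f (x : ℕ)) := by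
      have := Finset.sum_range_sub' (fun n : ℕ => f n ^ 2) N
      simp only [Nat.cast_zero, Nat.cast_add, Nat.cast_one] at this
      rw [← this]
      exact Finset.sum_congr rfl fun x _ => by ring
    rw [e]
    refine (Finset.sum_mul_sq_le_sq_mul_sq _ _ _).trans ?_
    have h2 : ∑ x ∈ Finset.range N, (-(f ((x : ℕ) + 1) + f (x : ℕ))) ^ 2 ≤ 4 * f 0 := by
      calc _ ≤ ∑ x ∈ Finset.range N, 2 * f 0 * (f ((x : ℕ) + 1) + f (x : ℕ)) := by
            refine Finset.sum_le_sum fun x _ => ?_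
            have a1 := hf.le_zero ((x : ℤ) + 1)
            have a2 := hf.le_zero (x : ℤ)
            have a3 := hf0 ((x : ℤ) + 1)
            have a4 := hf0 (x : ℤ)
            nlinarith
        _ ≤ 4 * f 0 := by
            rw [← Finset.mul_sum, Finset.sum_add_distrib]
            nlinarith [hsum N, hsum' N, hf0 0]
    calc _ ≤ g * (4 * f 0) := mul_le_mul (hg N) h2 (Finset.sum_nonneg fun _ _ => sq_nonneg _)
            (le_trans (Finset.sum_nonneg fun _ _ => sq_nonneg _) (hg N))
      _ = _ := by ring
  have hl : f 0 ^ 4 ≤ 4 * f 0 * g := by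
    have : Tendsto (fun N : ℕ => (f 0 ^ 2 - f N ^ 2) ^ 2) atTop (𝓝 ((f 0 ^ 2 - 0 ^ 2) ^ 2)) :=
      (tendsto_const_nhds.sub (hlim.pow 2)).pow 2
    have h := le_of_tendsto' this key
    nlinarith
  rcases (hf0 0).eq_or_lt with h | h
  · rw [← h]
    have : 0 ≤ g := by simpa using hg 0
    simpa using this
  · nlinarith

/-- The variance of a function dominates its squared difference at two atoms. -/
theorem sq_integral_add_le {g : ℤ → ℝ} {C : ℝ} (hg : ∀ z, |g z| ≤ C) {a b : ℤ} (hab : a ≠ b) :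
    (∫ z, g z ∂ρ) ^ 2 + ρ.real {a} * ρ.real {b} * (g a - g b) ^ 2 ≤ ∫ z, g z ^ 2 ∂ρ := by
  have hi : Integrable g ρ :=
    Integrable.of_bound (measurable_of_countable g).aestronglyMeasurable C (ae_of_all _ hg)
  have hi2 : Integrable (fun z => g z ^ 2) ρ :=
    Integrable.of_bound (measurable_of_countable _).aestronglyMeasurable (C ^ 2)
      (ae_of_all _ fun z => by
        rw [Real.norm_eq_abs, abs_pow]; exact pow_le_pow_left₀ (abs_nonneg _) (hg z) 2)
  set m := ∫ z, g z ∂ρ with hm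
  have hi3 : Integrable (fun z => (g z - m) ^ 2) ρ := by
    have : (fun z => (g z - m) ^ 2) = fun z => g z ^ 2 - 2 * m * g z + m ^ 2 := by
      ext z; ring
    rw [this]
    exact (hi2.sub (hi.const_mul _)).add (integrable_const _)
  have hvar : ∫ z, (g z - m) ^ 2 ∂ρ = ∫ z, g z ^ 2 ∂ρ - m ^ 2 := by
    have : (fun z => (g z - m) ^ 2) = fun z => g z ^ 2 - (2 * m * g z - m ^ 2) := by
      ext z; ring
    have hi4 : Integrable (fun z => 2 * m * g z - m ^ 2) ρ :=
      (hi.const_mul _).sub (integrable_const _)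
    rw [this, integral_sub hi2 hi4, integral_sub (hi.const_mul _) (integrable_const _), integral_const_mul, ← hm]
    simp; ring
  have hset : ∫ z in ({a, b} : Finset ℤ), (g z - m) ^ 2 ∂ρ ≤ ∫ z, (g z - m) ^ 2 ∂ρ :=
    setIntegral_le_integral hi3 (ae_of_all _ fun z => sq_nonneg _)
  rw [setIntegral_finset _ hi3.integrableOn, Finset.sum_pair hab, hvar] at hset
  simp only [smul_eq_mul] at hset
  have hab1 : ρ.real {a} + ρ.real {b} ≤ 1 := by
    rw [← measureReal_union (by simpa using hab) (measurableSet_singleton b)]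
    exact measureReal_le_one
  have ha : 0 ≤ ρ.real {a} := measureReal_nonneg
  have hb : 0 ≤ ρ.real {b} := measureReal_nonneg
  set u := g a - m
  set w := g b - m
  have huw : g a - g b = u - w := by simp [u, w]
  rw [huw]
  have : ρ.real {a} * ρ.real {b} * (u - w) ^ 2 ≤ ρ.real {a} * u ^ 2 + ρ.real {b} * w ^ 2 := by
    generalize ρ.real {a} = α at *
    generalize ρ.real {b} = β at *
    -- The two sides differ by (αu + βw)².
    have h1 : α * β * (u - w) ^ 2 ≤ (α + β) * (α * u ^ 2 + β * w ^ 2) := by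
      nlinarith [sq_nonneg (α * u + β * w)]
    have h2 : 0 ≤ α * u ^ 2 + β * w ^ 2 := by positivity
    nlinarith
  linarith

end HeatKernel

/-! ### Return probabilities and exponential moments of local times. -/

section ReturnProbabilities

variable {ρ : Measure ℤ} [IsProbabilityMeasure ρ]

/-- Energy method. One convolution step lowers the squared ℓ² norm of the kernel by at least c times
its gradient energy, c = ρ{0} ρ{1}, thanks to the atoms at 0 and 1. The norm starts at 1, so these
losses sum to at most 1, and the Nash inequality bounds each cube by 4/c times the loss. -/
theorem sum_pow_three_heatKernel_le (hρ : SymmDecreasing fun z => ρ.real {z})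
    (h1 : 0 < ρ.real {1}) (n : ℕ) :
    ∑ k ∈ Finset.range n, (heatKernel ρ k 0).toReal ^ 3 ≤ 4 / (ρ.real {0} * ρ.real {1}) := by
  have h0 : 0 < ρ.real {0} := h1.trans_le (hρ.le_zero 1)
  set c := ρ.real {0} * ρ.real {1} with hc
  have hc0 : 0 < c := by positivity
  set f : ℕ → ℤ → ℝ := fun k x => (heatKernel ρ k x).toReal with hf
  have hf0 : ∀ k x, 0 ≤ f k x := fun k x => ENNReal.toReal_nonneg
  have hf1 : ∀ k x, f k x ≤ 1 := fun k x =>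
    ENNReal.toReal_le_of_le_ofReal zero_le_one (by simpa using heatKernel_le_one ρ k x)
  set E : ℕ → ℝ≥0∞ := fun k => ∑' x, ENNReal.ofReal (f k x ^ 2) with hE
  set D : ℕ → ℝ≥0∞ := fun k => ∑' x, ENNReal.ofReal (c * (f k x - f k (x - 1)) ^ 2) with hD
  have hstep : ∀ k, E (k + 1) + D k ≤ E k := by
    intro k
    have hpt : ∀ x, ENNReal.ofReal (f (k + 1) x ^ 2) +
        ENNReal.ofReal (c * (f k x - f k (x - 1)) ^ 2) ≤
          ∫⁻ z, ENNReal.ofReal (f k (x - z) ^ 2) ∂ρ := by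
      intro x
      have hb : ∀ z, |f k (x - z)| ≤ 1 := fun z => by rw [abs_of_nonneg (hf0 _ _)]; exact hf1 _ _
      have h2 := sq_integral_add_le (ρ := ρ) hb (zero_ne_one (α := ℤ))
      have h3 : ∫ z, f k (x - z) ∂ρ = f (k + 1) x := by
        simp only [hf]
        rw [heatKernel_succ, integral_toReal (measurable_of_countable _).aemeasurable
          (ae_of_all _ fun z => (heatKernel_ne_top ρ _ _).lt_top)]
      rw [h3, sub_zero] at h2
      rw [← ENNReal.ofReal_add (by positivity) (by positivity),
        ← ofReal_integral_eq_lintegral_ofReal _ (ae_of_all _ fun z => sq_nonneg _)]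
      · exact ENNReal.ofReal_le_ofReal h2
      · exact Integrable.of_bound (measurable_of_countable _).aestronglyMeasurable 1
          (ae_of_all _ fun z => by
            rw [Real.norm_eq_abs, abs_pow]; exact pow_le_one₀ (abs_nonneg _) (hb z))
    calc E (k + 1) + D k ≤ ∑' x, ∫⁻ z, ENNReal.ofReal (f k (x - z) ^ 2) ∂ρ := by
          rw [hE, hD, ← ENNReal.tsum_add]
          exact ENNReal.tsum_le_tsum hpt
      _ = ∫⁻ z, ∑' x, ENNReal.ofReal (f k (x - z) ^ 2) ∂ρ :=
          (lintegral_tsum fun x => (measurable_of_countable _).aemeasurable).symm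
      _ = ∫⁻ _, E k ∂ρ := by
          refine lintegral_congr fun z => ?_
          exact (Equiv.subRight z).tsum_eq fun x => ENNReal.ofReal (f k x ^ 2)
      _ = E k := by simp
  have hE0 : E 0 = 1 := by
    simp only [hE, hf, heatKernel_zero]
    rw [tsum_eq_single 0]
    · simp
    · intro x hx; simp [hx]
  have hsum : ∀ n, E n + ∑ k ∈ Finset.range n, D k ≤ 1 := by
    intro n
    induction n with
    | zero => simp [hE0]
    | succ n ih =>
      refine le_trans ?_ ih
      rw [Finset.sum_range_succ, add_comm (∑ k ∈ Finset.range n, D k), ← add_assoc]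
      gcongr
      exact hstep n
  have hDle : ∀ n, ∑ k ∈ Finset.range n, D k ≤ 1 := fun n => le_add_self.trans (hsum n)
  have hDtop : ∀ k, D k ≠ ∞ := fun k => ne_top_of_le_ne_top ENNReal.one_ne_top
    ((Finset.single_le_sum (f := D) (fun _ _ => zero_le) (Finset.self_mem_range_succ k)).trans
      (hDle (k + 1)))
  have hcube : ∀ k, f k 0 ^ 3 ≤ 4 * ((D k).toReal / c) := by
    intro k
    refine (symmDecreasing_heatKernel hρ k).pow_three_le (hf0 k) (summable_toReal_heatKernel ρ k)
      (tsum_toReal_heatKernel ρ k).le fun N => ?_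
    rw [le_div_iff₀ hc0, Finset.sum_mul]
    have h4 : ENNReal.ofReal (∑ x ∈ Finset.range N, (f k ((x : ℕ) + 1) - f k (x : ℕ)) ^ 2 * c) ≤
        D k := by
      rw [ENNReal.ofReal_sum_of_nonneg fun x _ => by positivity]
      have hinj : Function.Injective fun n : ℕ => (n : ℤ) + 1 := fun a b h => by simpa using h
      refine le_trans ?_ (ENNReal.tsum_comp_le_tsum_of_injective hinj _)
      refine le_trans (Finset.sum_le_sum fun x _ => ?_) (ENNReal.sum_le_tsum (Finset.range N))
      simp only [add_sub_cancel_right]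
      rw [mul_comm]
    exact (ENNReal.ofReal_le_iff_le_toReal (hDtop k)).1 h4
  calc ∑ k ∈ Finset.range n, f k 0 ^ 3 ≤ ∑ k ∈ Finset.range n, 4 * ((D k).toReal / c) :=
        Finset.sum_le_sum fun k _ => hcube k
    _ = 4 / c * (∑ k ∈ Finset.range n, D k).toReal := by
        rw [ENNReal.toReal_sum fun k _ => hDtop k, Finset.mul_sum]
        exact Finset.sum_congr rfl fun k _ => by ring
    _ ≤ 4 / c * 1 := by
        gcongr
        exact ENNReal.toReal_le_of_le_ofReal zero_le_one (by simpa using hDle n)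
    _ = _ := by rw [mul_one]

theorem tendsto_heatKernel_time (hρ : SymmDecreasing fun z => ρ.real {z})
    (h1 : 0 < ρ.real {1}) :
    Tendsto (fun k => heatKernel ρ k 0) atTop (𝓝 0) := by
  have hs : Summable fun k => (heatKernel ρ k 0).toReal ^ 3 :=
    summable_of_sum_range_le (fun k => by positivity) (sum_pow_three_heatKernel_le hρ h1)
  have hc : Tendsto (fun k => (heatKernel ρ k 0).toReal) atTop (𝓝 0) := by
    rw [Metric.tendsto_atTop]
    intro ε hε
    obtain ⟨N, hN⟩ := Metric.tendsto_atTop.1 hs.tendsto_atTop_zero (ε ^ 3) (by positivity)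
    refine ⟨N, fun k hk => ?_⟩
    have := hN k hk
    rw [Real.dist_eq, sub_zero, abs_of_nonneg (by positivity)] at this
    rw [Real.dist_eq, sub_zero, abs_of_nonneg ENNReal.toReal_nonneg]
    exact lt_of_pow_lt_pow_left₀ 3 hε.le this
  have := ENNReal.tendsto_ofReal hc
  simpa [ENNReal.ofReal_toReal (heatKernel_ne_top ρ _ _)] using this

/-- The number of visits of the walk to `j` before time `n`. -/
def localTime (w : ℕ → ℤ) (n : ℕ) (j : ℤ) : ℕ :=
  ∑ k ∈ Finset.range n, if walk w k = j then 1 else 0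

theorem measurable_localTime (n : ℕ) (j : ℤ) : Measurable fun w => localTime w n j := by
  unfold localTime
  refine Finset.measurable_sum _ fun k _ => ?_
  exact Measurable.ite (measurableSet_walk_eq k j) measurable_const measurable_const

theorem localTime_pathCons (z : ℤ) (w : ℕ → ℤ) (n : ℕ) (j : ℤ) :
    localTime (pathCons z w) (n + 1) j = localTime w n (j - z) + if j = 0 then 1 else 0 := by
  unfold localTime
  rw [Finset.sum_range_succ']
  congr 1
  · refine Finset.sum_congr rfl fun k _ => ?_
    rw [walk_pathCons]
    exact if_congr (by omega) rfl rfl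
  · simp [walk, eq_comm]

/-- Condition on the first step. A visit at time 0 costs a factor 1 + θ, and (1 + s)(1 + θ) ≤ 1 + s
+ 2θ as long as s ≤ 1. The hypothesis `hθ` ensures s ≤ 1 at every site up to the horizon, because
the heat kernel is largest at the origin. -/
theorem lintegral_pow_localTime_le (hρ : SymmDecreasing fun z => ρ.real {z}) {θ : ℝ≥0∞} {N : ℕ}
    (hθ : 2 * θ * ∑ k ∈ Finset.range N, heatKernel ρ k 0 ≤ 1) {n : ℕ} (hn : n ≤ N) (j : ℤ) :
    ∫⁻ w, (1 + θ) ^ localTime w n j ∂pathLaw ρ ≤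
      1 + 2 * θ * ∑ k ∈ Finset.range n, heatKernel ρ k j := by
  induction n generalizing j with
  | zero => simp [localTime]
  | succ n ih =>
    have hm : ∀ n j, Measurable fun w => (1 + θ) ^ localTime w n j := fun n j =>
      (measurable_of_countable fun m : ℕ => (1 + θ) ^ m).comp (measurable_localTime n j)
    set s := 2 * θ * ∑ k ∈ Finset.range n, heatKernel ρ (k + 1) j with hs
    have hs1 : s ≤ 1 := by
      refine le_trans ?_ hθ
      rw [hs]
      gcongr
      calc ∑ k ∈ Finset.range n, heatKernel ρ (k + 1) j
          ≤ ∑ k ∈ Finset.range n, heatKernel ρ (k + 1) 0 :=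
            Finset.sum_le_sum fun k _ => heatKernel_le_zero hρ _ _
        _ ≤ ∑ k ∈ Finset.range (n + 1), heatKernel ρ k 0 := by
            rw [Finset.sum_range_succ']; exact le_self_add
        _ ≤ _ := Finset.sum_le_sum_of_subset (Finset.range_mono hn)
    have h1 : ∫⁻ z, ∫⁻ w, (1 + θ) ^ localTime w n (j - z) ∂pathLaw ρ ∂ρ ≤ 1 + s := by
      calc _ ≤ ∫⁻ z, (1 + 2 * θ * ∑ k ∈ Finset.range n, heatKernel ρ k (j - z)) ∂ρ :=
            lintegral_mono fun z => ih (by omega) _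
        _ = 1 + s := by
            rw [lintegral_add_left measurable_const,
              lintegral_const_mul _ (measurable_of_countable _),
              lintegral_finsetSum _ fun k _ => measurable_of_countable _]
            simp [hs, heatKernel_succ]
    rw [lintegral_pathLaw ρ (hm _ _)]
    simp only [localTime_pathCons, pow_add]
    simp_rw [lintegral_mul_const _ (hm n _)]
    rw [lintegral_mul_const _ (measurable_of_countable _), Finset.sum_range_succ', mul_add,
      heatKernel_zero, ← add_assoc, ← hs]
    refine (mul_le_mul_left h1 _).trans ?_
    split_ifs with hj
    · rw [pow_one, mul_one]
      calc (1 + s) * (1 + θ) = 1 + s + (θ + s * θ) := by ring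
        _ ≤ 1 + s + (θ + 1 * θ) := by gcongr
        _ = _ := by ring
    · simp

/-- Tail bound for the maximal local time. -/
theorem measure_exists_localTime_le (hρ : SymmDecreasing fun z => ρ.real {z}) {θ : ℝ≥0∞} {n : ℕ}
    (hθ : 2 * θ * ∑ k ∈ Finset.range n, heatKernel ρ k 0 ≤ 1) (m : ℕ) :
    ((1 + θ) ^ m - 1) * pathLaw ρ {w | ∃ j, m ≤ localTime w n j} ≤ 2 * θ * n := by
  have h1 : ∀ j, ((1 + θ) ^ m - 1) * pathLaw ρ {w | m ≤ localTime w n j} ≤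
      2 * θ * ∑ k ∈ Finset.range n, heatKernel ρ k j := by
    intro j
    have hms : MeasurableSet {w : ℕ → ℤ | m ≤ localTime w n j} :=
      measurableSet_le measurable_const (measurable_localTime n j)
    -- Keeping the 1 on both sides and cancelling it afterwards leaves a bound that is summable over
    -- `j`; plain Markov would not.
    have h2 : ∫⁻ w, (1 + {w | m ≤ localTime w n j}.indicator (fun _ => (1 + θ) ^ m - 1) w)
        ∂pathLaw ρ ≤ ∫⁻ w, (1 + θ) ^ localTime w n j ∂pathLaw ρ := by
      refine lintegral_mono fun w => ?_
      have h3 : (1 : ℝ≥0∞) ≤ (1 + θ) := le_self_add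
      by_cases hw : m ≤ localTime w n j
      · rw [Set.indicator_of_mem (show w ∈ {w | m ≤ localTime w n j} from hw),
          add_tsub_cancel_of_le (one_le_pow_of_one_le' h3 m)]
        exact pow_le_pow_right₀ h3 hw
      · rw [Set.indicator_of_notMem (show w ∉ {w | m ≤ localTime w n j} from hw), add_zero]
        exact one_le_pow_of_one_le' h3 _
    rw [lintegral_add_left measurable_const, lintegral_indicator_const hms] at h2
    have h4 := h2.trans (lintegral_pow_localTime_le hρ hθ le_rfl j)
    simp only [lintegral_const, measure_univ, mul_one] at h4
    exact (ENNReal.add_le_add_iff_left ENNReal.one_ne_top).1 h4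
  -- A union bound over all of ℤ is affordable: each heat kernel has total mass 1, so the bounds add
  -- up to a multiple of `n`.
  calc _ ≤ ((1 + θ) ^ m - 1) * ∑' j, pathLaw ρ {w | m ≤ localTime w n j} := by
        gcongr
        refine le_trans (measure_mono ?_) (measure_iUnion_le _)
        intro w hw
        simpa using hw
    _ = ∑' j, ((1 + θ) ^ m - 1) * pathLaw ρ {w | m ≤ localTime w n j} := ENNReal.tsum_mul_left.symm
    _ ≤ ∑' j, 2 * θ * ∑ k ∈ Finset.range n, heatKernel ρ k j := ENNReal.tsum_le_tsum h1
    _ = 2 * θ * n := by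
        rw [ENNReal.tsum_mul_left, Summable.tsum_finsetSum fun _ _ => ENNReal.summable]
        simp [tsum_heatKernel]

end ReturnProbabilities

/-! ### Rapidly decaying sequences. -/

/-- Sequences that eventually lie below every negative power of `n`. -/
def RapidlyDecaying (u : ℕ → ℝ≥0∞) : Prop :=
  ∀ K : ℕ, ∀ᶠ n : ℕ in atTop, u n ≤ ((n : ℝ≥0∞) ^ K)⁻¹

namespace RapidlyDecaying

theorem mono {u v : ℕ → ℝ≥0∞} (hv : RapidlyDecaying v) (h : ∀ᶠ n in atTop, u n ≤ v n) :
    RapidlyDecaying u := fun K => by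
  filter_upwards [hv K, h] with n h1 h2 using h2.trans h1

theorem add {u v : ℕ → ℝ≥0∞} (hu : RapidlyDecaying u) (hv : RapidlyDecaying v) :
    RapidlyDecaying fun n => u n + v n := fun K => by
  -- The extra power absorbs the factor 2 once n ≥ 2.
  filter_upwards [hu (K + 1), hv (K + 1), eventually_ge_atTop 2] with n h1 h2 hn
  refine (add_le_add h1 h2).trans ?_
  have hn' : (2 : ℝ≥0∞) ≤ n := by exact_mod_cast hn
  have hn0 : (n : ℝ≥0∞) ≠ 0 := by
    intro h; rw [h] at hn'; simp at hn'
  have hnt : (n : ℝ≥0∞) ≠ ∞ := ENNReal.natCast_ne_top n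
  rw [← two_mul, pow_succ, ENNReal.mul_inv (Or.inr hnt) (Or.inr hn0), mul_left_comm]
  calc _ ≤ ((n : ℝ≥0∞) ^ K)⁻¹ * ((n : ℝ≥0∞) * (n : ℝ≥0∞)⁻¹) := by gcongr
    _ = _ := by rw [ENNReal.mul_inv_cancel hn0 hnt, mul_one]

theorem tendsto_mul_pow {u : ℕ → ℝ≥0∞} (hu : RapidlyDecaying u) (K : ℕ) :
    Tendsto (fun n : ℕ => (n : ℝ≥0∞) ^ K * u n) atTop (𝓝 0) := by
  refine tendsto_of_tendsto_of_tendsto_of_le_of_le' tendsto_const_nhds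
    ENNReal.tendsto_inv_nat_nhds_zero (Eventually.of_forall fun n => zero_le) ?_
  filter_upwards [hu (K + 1), eventually_ge_atTop 1] with n h1 hn
  have hn0 : (n : ℝ≥0∞) ≠ 0 := by simp; omega
  have hnt : (n : ℝ≥0∞) ≠ ∞ := ENNReal.natCast_ne_top n
  calc _ ≤ (n : ℝ≥0∞) ^ K * ((n : ℝ≥0∞) ^ (K + 1))⁻¹ := by gcongr
    _ = _ := by
      rw [pow_succ, ENNReal.mul_inv (Or.inr hnt) (Or.inr hn0), ← mul_assoc,
        ENNReal.mul_inv_cancel (pow_ne_zero _ hn0) (ENNReal.pow_ne_top hnt), one_mul]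

theorem tendsto_zero {u : ℕ → ℝ≥0∞} (hu : RapidlyDecaying u) : Tendsto u atTop (𝓝 0) := by
  simpa using hu.tendsto_mul_pow 0

theorem exp_neg_rpow {c α : ℝ} (hc : 0 < c) (hα : 0 < α) (C A : ℝ) :
    RapidlyDecaying fun n : ℕ =>
      ENNReal.ofReal (C * (n : ℝ) ^ A * Real.exp (-(c * (n : ℝ) ^ α))) := by
  intro K
  have h1 : (fun x : ℝ => Real.exp (-c * x ^ α)) =o[atTop] fun x : ℝ =>
      (x ^ α) ^ (-(A + K) / α) :=
    (isLittleO_exp_neg_mul_rpow_atTop hc _).comp_tendsto (tendsto_rpow_atTop hα)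
  have h2 := (h1.comp_tendsto tendsto_natCast_atTop_atTop).bound
    (show (0 : ℝ) < 1 / (|C| + 1) by positivity)
  filter_upwards [h2, eventually_ge_atTop 1] with n hn hn1
  have hn0 : (0 : ℝ) < n := by exact_mod_cast hn1
  simp only [Function.comp, Real.norm_eq_abs, Real.abs_exp] at hn
  rw [← Real.rpow_mul hn0.le, mul_div_cancel₀ _ hα.ne', abs_of_pos (Real.rpow_pos_of_pos hn0 _)]
    at hn
  have h3 : ((n : ℝ≥0∞) ^ K)⁻¹ = ENNReal.ofReal (((n : ℝ) ^ K)⁻¹) := by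
    rw [ENNReal.ofReal_inv_of_pos (by positivity), ENNReal.ofReal_pow hn0.le, ENNReal.ofReal_natCast]
  rw [h3]
  refine ENNReal.ofReal_le_ofReal ?_
  have h4 : (n : ℝ) ^ A * (n : ℝ) ^ (-(A + K)) = ((n : ℝ) ^ K)⁻¹ := by
    rw [← Real.rpow_add hn0, ← Real.rpow_natCast, ← Real.rpow_neg hn0.le]
    ring_nf
  rw [← h4]
  rw [neg_mul] at hn
  have hA : 0 < (n : ℝ) ^ A := Real.rpow_pos_of_pos hn0 _
  have hAK : 0 < (n : ℝ) ^ (-(A + K)) := Real.rpow_pos_of_pos hn0 _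
  calc C * (n : ℝ) ^ A * Real.exp (-(c * (n : ℝ) ^ α))
      ≤ |C| * (n : ℝ) ^ A * (1 / (|C| + 1) * (n : ℝ) ^ (-(A + K))) := by
        gcongr
        exact le_abs_self C
    _ = (|C| / (|C| + 1)) * ((n : ℝ) ^ A * (n : ℝ) ^ (-(A + K))) := by ring
    _ ≤ 1 * ((n : ℝ) ^ A * (n : ℝ) ^ (-(A + K))) := by
        gcongr
        rw [div_le_one (by positivity)]
        linarith
    _ = _ := one_mul _

/-- Rapid decay in mean implies rapid decay almost everywhere. -/
theorem ae_of_lintegral {Ω : Type*} [MeasurableSpace Ω] {P : Measure Ω} {u : ℕ → Ω → ℝ≥0∞}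
    (hm : ∀ n, Measurable (u n)) (h : RapidlyDecaying fun n => ∫⁻ a, u n a ∂P) :
    ∀ᵐ a ∂P, RapidlyDecaying fun n => u n a := by
  refine ae_all_iff.2 fun K => ?_
  -- Two spare powers make n^K u_n summable in mean, hence almost everywhere, so its terms are
  -- eventually at most 1. The shift by `N + 1` below keeps the index positive.
  obtain ⟨N, hN⟩ := eventually_atTop.1 (h (K + 2))
  let f : ℕ → Ω → ℝ≥0∞ := fun n a => ((n + (N + 1) : ℕ) : ℝ≥0∞) ^ K * u (n + (N + 1)) a
  have hf : ∀ n, Measurable (f n) := fun n => (hm _).const_mul _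
  have hsum : ∑' n, ∫⁻ a, f n a ∂P ≠ ∞ := by
    have hs : ∑' n : ℕ, ENNReal.ofReal (1 / ((n + (N + 1) : ℕ) : ℝ) ^ 2) ≠ ∞ := by
      refine Summable.tsum_ofReal_ne_top ?_
      exact (summable_nat_add_iff (f := fun n : ℕ => 1 / (n : ℝ) ^ 2) (N + 1)).2
        (Real.summable_one_div_nat_pow.2 one_lt_two)
    refine ne_top_of_le_ne_top hs (ENNReal.tsum_le_tsum fun n => ?_)
    simp only [f]
    rw [lintegral_const_mul _ (hm _)]
    set m := n + (N + 1) with hmdef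
    have hm0 : (m : ℝ≥0∞) ≠ 0 := by simp [hmdef]
    have hmt : (m : ℝ≥0∞) ≠ ∞ := ENNReal.natCast_ne_top m
    have hmp : (0 : ℝ) < (m : ℝ) ^ 2 := by
      have : (0 : ℝ) < m := by exact_mod_cast (by omega : 0 < m)
      positivity
    calc _ ≤ (m : ℝ≥0∞) ^ K * ((m : ℝ≥0∞) ^ (K + 2))⁻¹ := by
          gcongr; exact hN m (by omega)
      _ = ((m : ℝ≥0∞) ^ 2)⁻¹ := by
          rw [pow_add, ENNReal.mul_inv (Or.inr (ENNReal.pow_ne_top hmt))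
            (Or.inr (pow_ne_zero _ hm0)), ← mul_assoc,
            ENNReal.mul_inv_cancel (pow_ne_zero _ hm0) (ENNReal.pow_ne_top hmt), one_mul]
      _ ≤ _ := by
          rw [one_div, ENNReal.ofReal_inv_of_pos hmp, ENNReal.ofReal_pow (by positivity),
            ENNReal.ofReal_natCast]
  rw [← lintegral_tsum fun n => (hf n).aemeasurable] at hsum
  filter_upwards [ae_lt_top (Measurable.tsum hf) hsum] with a ha
  have ht := ENNReal.tendsto_atTop_zero_of_tsum_ne_top ha.ne
  have h1 : ∀ᶠ n in atTop, f n a ≤ 1 := ht.eventually_le_const zero_lt_one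
  obtain ⟨n₁, hn₁⟩ := eventually_atTop.1 h1
  refine eventually_atTop.2 ⟨n₁ + (N + 1), fun n hn => ?_⟩
  have h2 := hn₁ (n - (N + 1)) (by omega)
  simp only [f, Nat.sub_add_cancel (by omega : N + 1 ≤ n)] at h2
  rwa [ENNReal.le_inv_iff_mul_le, mul_comm]

end RapidlyDecaying

theorem exp_half_le_one_add {θ : ℝ} (h0 : 0 ≤ θ) (h1 : θ ≤ 1) : Real.exp (θ / 2) ≤ 1 + θ := by
  have := exp_le_one_add_add_sq (u := θ / 2) (by rw [abs_of_nonneg (by positivity)]; linarith)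
  nlinarith

/-! ### The maximal local time. -/

section LocalTime

set_option linter.unusedSectionVars false

variable {ρ : Measure ℤ} [IsProbabilityMeasure ρ]

/-- Summable cubes and the power mean inequality bound the expected number of returns by C n^(2/3),
so θ of order n^(-2/3) is admissible in `measure_exists_localTime_le`. At level n^(5/6) the factor
(1 + θ)^m is then at least exp(n^(1/6)/(4C)). The 2/3 is not sharp; what matters later is that 5/6
is below 1. -/
theorem rapidlyDecaying_localTime (hρ : SymmDecreasing fun z => ρ.real {z})
    (h1 : 0 < ρ.real {1}) :
    RapidlyDecaying fun n => pathLaw ρ {w | ∃ j, (n : ℝ) ^ (5 / 6 : ℝ) ≤ localTime w n j} := by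
  have h0 : 0 < ρ.real {0} := h1.trans_le (hρ.le_zero 1)
  set C := 4 / (ρ.real {0} * ρ.real {1}) with hC
  -- Crude, but it yields both C ≤ C³ and θ ≤ 1/2.
  have hC4 : 4 ≤ C := by
    rw [hC, le_div_iff₀ (by positivity)]
    have := mul_le_one₀ (measureReal_le_one (μ := ρ) (s := {0})) h1.le
      (measureReal_le_one (μ := ρ) (s := {1}))
    linarith
  have hG : ∀ n : ℕ, ∑ k ∈ Finset.range n, (heatKernel ρ k 0).toReal ≤ C * (n : ℝ) ^ (2 / 3 : ℝ) := by
    intro n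
    rcases n.eq_zero_or_pos with rfl | hn
    · simp [Real.zero_rpow]
    have hn0 : (0 : ℝ) < n := by exact_mod_cast hn
    have h3 := pow_sum_div_card_le_sum_pow (s := Finset.range n)
      (f := fun k => (heatKernel ρ k 0).toReal) (fun _ _ => ENNReal.toReal_nonneg) 2
    rw [Finset.card_range, div_le_iff₀ (by positivity)] at h3
    refine le_of_pow_le_pow_left₀ (n := 3) (by norm_num) (by positivity) ?_
    have h4 : (C * (n : ℝ) ^ (2 / 3 : ℝ)) ^ 3 = C ^ 3 * (n : ℝ) ^ 2 := by
      rw [mul_pow, ← Real.rpow_natCast ((n : ℝ) ^ (2 / 3 : ℝ)), ← Real.rpow_mul hn0.le]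
      norm_num
    rw [h4]
    refine h3.trans (mul_le_mul_of_nonneg_right ?_ (by positivity))
    refine (sum_pow_three_heatKernel_le hρ h1 n).trans ?_
    rw [← hC]
    nlinarith [sq_nonneg C]
  have hrd := RapidlyDecaying.exp_neg_rpow (c := 1 / (4 * C)) (α := 1 / 6) (by positivity)
    (by norm_num) 2 1
  refine hrd.mono ?_
  have hT : Tendsto (fun n : ℕ => Real.exp (1 / (4 * C) * (n : ℝ) ^ (1 / 6 : ℝ))) atTop atTop :=
    Real.tendsto_exp_atTop.comp (Tendsto.const_mul_atTop (by positivity)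
      ((tendsto_rpow_atTop (by norm_num)).comp tendsto_natCast_atTop_atTop))
  filter_upwards [hT.eventually_ge_atTop 2, eventually_ge_atTop 1] with n hT2 hn
  have hn0 : (0 : ℝ) < n := by exact_mod_cast hn
  have hn1 : (1 : ℝ) ≤ n := by exact_mod_cast hn
  set T := Real.exp (1 / (4 * C) * (n : ℝ) ^ (1 / 6 : ℝ)) with hTdef
  set θ : ℝ := 1 / (2 * (C * (n : ℝ) ^ (2 / 3 : ℝ))) with hθ
  have hp1 : 1 ≤ (n : ℝ) ^ (2 / 3 : ℝ) := Real.one_le_rpow hn1 (by norm_num)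
  have hθ0 : 0 < θ := by positivity
  have hθ1 : θ ≤ 1 / 2 := by
    rw [hθ]
    apply one_div_le_one_div_of_le (by norm_num)
    nlinarith
  set m := ⌈(n : ℝ) ^ (5 / 6 : ℝ)⌉₊ with hm
  have hset : {w : ℕ → ℤ | ∃ j, (n : ℝ) ^ (5 / 6 : ℝ) ≤ localTime w n j} =
      {w | ∃ j, m ≤ localTime w n j} := by
    ext w; simp [hm, Nat.ceil_le]
  have hTm : T ≤ (1 + θ) ^ m := by
    calc T ≤ Real.exp (m * (θ / 2)) := by
          refine Real.exp_le_exp.2 ?_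
          have h5 : (n : ℝ) ^ (5 / 6 : ℝ) ≤ m := Nat.le_ceil _
          have h6 : (n : ℝ) ^ (5 / 6 : ℝ) = (n : ℝ) ^ (1 / 6 : ℝ) * (n : ℝ) ^ (2 / 3 : ℝ) := by
            rw [← Real.rpow_add hn0]; norm_num
          calc 1 / (4 * C) * (n : ℝ) ^ (1 / 6 : ℝ) = (n : ℝ) ^ (5 / 6 : ℝ) * (θ / 2) := by
                rw [h6, hθ]
                have : (n : ℝ) ^ (2 / 3 : ℝ) ≠ 0 := by positivity
                field_simp
                norm_num
            _ ≤ _ := by gcongr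
      _ = Real.exp (θ / 2) ^ m := by rw [← Real.exp_nat_mul]
      _ ≤ _ := by gcongr; exact exp_half_le_one_add hθ0.le (by linarith)
  have hkey := measure_exists_localTime_le hρ (θ := ENNReal.ofReal θ) (n := n) ?_ m
  · rw [← hset] at hkey
    set p := pathLaw ρ {w | ∃ j, (n : ℝ) ^ (5 / 6 : ℝ) ≤ localTime w n j} with hp
    have hTp : 0 < T / 2 := by linarith
    have e1 : ENNReal.ofReal (T / 2) ≤ (1 + ENNReal.ofReal θ) ^ m - 1 := by
      rw [← ENNReal.ofReal_one, ← ENNReal.ofReal_add zero_le_one hθ0.le,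
        ← ENNReal.ofReal_pow (by positivity), ← ENNReal.ofReal_sub _ zero_le_one]
      exact ENNReal.ofReal_le_ofReal (by linarith)
    have e2 : ENNReal.ofReal (T / 2) * p ≤ ENNReal.ofReal n := by
      refine (mul_le_mul_left e1 p).trans (hkey.trans ?_)
      rw [← ENNReal.ofReal_natCast, ← ENNReal.ofReal_ofNat 2, ← ENNReal.ofReal_mul (by norm_num),
        ← ENNReal.ofReal_mul (by positivity)]
      refine ENNReal.ofReal_le_ofReal ?_
      nlinarith
    calc p = ENNReal.ofReal (T / 2)⁻¹ * (ENNReal.ofReal (T / 2) * p) := by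
          rw [← mul_assoc, ← ENNReal.ofReal_mul (by positivity), inv_mul_cancel₀ hTp.ne']
          simp
      _ ≤ ENNReal.ofReal (T / 2)⁻¹ * ENNReal.ofReal n := by gcongr
      _ = _ := by
          rw [← ENNReal.ofReal_mul (by positivity), Real.rpow_one, Real.exp_neg, ← hTdef]
          congr 1
          field_simp
  · have h7 : ∑ k ∈ Finset.range n, heatKernel ρ k 0 =
        ENNReal.ofReal (∑ k ∈ Finset.range n, (heatKernel ρ k 0).toReal) := by
      rw [ENNReal.ofReal_sum_of_nonneg fun _ _ => ENNReal.toReal_nonneg]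
      exact Finset.sum_congr rfl fun k _ => (ENNReal.ofReal_toReal (heatKernel_ne_top ρ _ _)).symm
    rw [h7, ← ENNReal.ofReal_ofNat 2, ← ENNReal.ofReal_mul (by norm_num),
      ← ENNReal.ofReal_mul (by positivity), ← ENNReal.ofReal_one]
    refine ENNReal.ofReal_le_ofReal ?_
    calc _ ≤ 2 * θ * (C * (n : ℝ) ^ (2 / 3 : ℝ)) := by gcongr; exact hG n
      _ = 1 := by rw [hθ]; field_simp

end LocalTime

/-! ### Collision times as weighted sums of gaps, and their quenched concentration. -/

/-- Hoeffding's inequality for weighted sums of independent variables with values in `[0, M]`. -/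
theorem hoeffding_weighted {Ω : Type*} [MeasurableSpace Ω] {P : Measure Ω} [IsProbabilityMeasure P]
    {ι : Type*} {η : ι → Ω → ℝ} (hm : ∀ j, Measurable (η j)) (hi : iIndepFun η P) {M μ : ℝ}
    (hb : ∀ j, ∀ᵐ a ∂P, η j a ∈ Set.Icc 0 M) (hμ : ∀ j, ∫ a, η j a ∂P = μ)
    (J : Finset ι) (N : ι → ℝ) {V r : ℝ} (hV : ∑ j ∈ J, N j ^ 2 ≤ V) (hr : 0 ≤ r) :
    P {a | r ≤ |∑ j ∈ J, N j * (η j a - μ)|} ≤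
      2 * ENNReal.ofReal (Real.exp (-r ^ 2 / (2 * (V * (M / 2) ^ 2)))) := by
  have hV0 : 0 ≤ V := le_trans (Finset.sum_nonneg fun _ _ => sq_nonneg _) hV
  have hsub : ∀ j, HasSubgaussianMGF (fun a => N j * (η j a - μ))
      (N j ^ 2 * (M / 2) ^ 2).toNNReal P := fun j => by
    have := (hasSubgaussianMGF_of_mem_Icc (hm j).aemeasurable (hb j)).const_mul (N j)
    rw [hμ j] at this
    convert this using 1
    refine NNReal.eq ?_
    rw [Real.coe_toNNReal _ (by positivity)]
    change _ = N j ^ 2 * (‖M - 0‖ / 2) ^ 2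
    simp [div_pow]
  have hind : iIndepFun (fun j a => N j * (η j a - μ)) P :=
    hi.comp (fun j x => N j * (x - μ)) fun j => by fun_prop
  have hsum := HasSubgaussianMGF.sum_of_iIndepFun hind (s := J) fun j _ => hsub j
  have hc : ((∑ j ∈ J, (N j ^ 2 * (M / 2) ^ 2).toNNReal : ℝ≥0) : ℝ) ≤ V * (M / 2) ^ 2 := by
    rw [NNReal.coe_sum]
    simp_rw [Real.coe_toNNReal _ (show 0 ≤ N _ ^ 2 * (M / 2) ^ 2 by positivity)]
    rw [← Finset.sum_mul]
    gcongr
  have hsum' : HasSubgaussianMGF (fun a => ∑ j ∈ J, N j * (η j a - μ))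
      ⟨V * (M / 2) ^ 2, by positivity⟩ P := by
    refine ⟨hsum.integrable_exp_mul, fun t => (hsum.mgf_le t).trans (Real.exp_le_exp.2 ?_)⟩
    gcongr
    exact hc
  have h1 := hsum'.measure_ge_le hr
  have h2 := hsum'.neg.measure_ge_le hr
  have conv : ∀ {S : Set Ω} {y : ℝ}, P.real S ≤ y → P S ≤ ENNReal.ofReal y := fun {S y} h => by
    rw [← ENNReal.ofReal_toReal (measure_ne_top P S)]
    exact ENNReal.ofReal_le_ofReal h
  rw [two_mul]
  refine (measure_mono ?_).trans ((measure_union_le _ _).trans (add_le_add (conv h1) (conv h2)))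
  intro a ha
  rcases le_abs.1 (show r ≤ |∑ j ∈ J, N j * (η j a - μ)| from ha) with h | h
  · exact Or.inl h
  · exact Or.inr h

/-- The sum of the gaps lying between the targets `a` and `b`. -/
noncomputable def gapSum (z : ℤ → ℝ) (a b : ℤ) : ℝ := ∑ j ∈ Finset.Ioc (min a b) (max a b), z j

theorem environment_sub_of_le (z : ℤ → ℝ) {a b : ℤ} (hab : a ≤ b) :
    environment z b - environment z a = ∑ j ∈ Finset.Ioc a b, z j := by
  induction b, hab using Int.leInduction with
  | base => simp
  | succ b hab ih =>
    have h1 : Finset.Ioc a (b + 1) = insert (b + 1) (Finset.Ioc a b) := by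
      ext j; simp only [Finset.mem_Ioc, Finset.mem_insert]; omega
    rw [h1, Finset.sum_insert (by simp), ← ih, environment_rec z (b + 1)]
    simp only [add_sub_cancel_right]
    ring

theorem gapSum_nonneg {z : ℤ → ℝ} (hz : ∀ j, 0 ≤ z j) (a b : ℤ) : 0 ≤ gapSum z a b :=
  Finset.sum_nonneg fun j _ => hz j

theorem abs_environment_sub {z : ℤ → ℝ} (hz : ∀ j, 0 ≤ z j) (a b : ℤ) :
    |environment z b - environment z a| = gapSum z a b := by
  unfold gapSum
  rcases le_total a b with h | h
  · rw [environment_sub_of_le z h, min_eq_left h, max_eq_right h,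
      abs_of_nonneg (Finset.sum_nonneg fun _ _ => hz _)]
  · rw [abs_sub_comm, environment_sub_of_le z h, min_eq_right h, max_eq_left h,
      abs_of_nonneg (Finset.sum_nonneg fun _ _ => hz _)]

theorem collisionTime_environment {z : ℤ → ℝ} (hz : ∀ j, 0 ≤ z j) (w : ℕ → ℤ) (n : ℕ) :
    collisionTime (environment z) w n =
      ∑ i ∈ Finset.range n, gapSum z (walk w i) (walk w (i + 1)) :=
  Finset.sum_congr rfl fun _ _ => abs_environment_sub hz _ _

theorem gapSum_const (c : ℝ) (a b : ℤ) : gapSum (fun _ => c) a b = c * |(b : ℝ) - a| := by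
  unfold gapSum
  rw [Finset.sum_const, Int.card_Ioc, nsmul_eq_mul, mul_comm]
  congr 1
  have h1 : ((max a b - min a b).toNat : ℤ) = |b - a| := by
    rw [Int.toNat_of_nonneg (by simp), max_sub_min_eq_abs]
  have h2 : (((max a b - min a b).toNat : ℤ) : ℝ) = ((|b - a| : ℤ) : ℝ) := by rw [h1]
  push_cast at h2
  exact h2

theorem walk_succ (w : ℕ → ℤ) (i : ℕ) : walk w (i + 1) = walk w i + w i := by
  simp [walk, Finset.sum_range_succ]

theorem gapSum_const_walk (c : ℝ) (w : ℕ → ℤ) (i : ℕ) :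
    gapSum (fun _ => c) (walk w i) (walk w (i + 1)) = c * |(w i : ℝ)| := by
  rw [gapSum_const, walk_succ]; push_cast; ring_nf

theorem gapSum_add (z z' : ℤ → ℝ) (a b : ℤ) :
    gapSum (fun j => z j + z' j) a b = gapSum z a b + gapSum z' a b :=
  Finset.sum_add_distrib

/-- The time spent on jumps of size at most `R` among the first `n`. -/
noncomputable def truncTime (R : ℤ) (z : ℤ → ℝ) (w : ℕ → ℤ) (n : ℕ) : ℝ :=
  ∑ i ∈ Finset.range n, if |w i| ≤ R then gapSum z (walk w i) (walk w (i + 1)) else 0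

/-- The number of times the gap `j` is crossed by a jump of size at most `R`. -/
noncomputable def crossings (R : ℤ) (w : ℕ → ℤ) (n : ℕ) (j : ℤ) : ℝ :=
  ∑ i ∈ Finset.range n, if |w i| ≤ R ∧
    j ∈ Finset.Ioc (min (walk w i) (walk w (i + 1))) (max (walk w i) (walk w (i + 1))) then 1 else 0

theorem crossings_nonneg (R : ℤ) (w : ℕ → ℤ) (n : ℕ) (j : ℤ) : 0 ≤ crossings R w n j :=
  Finset.sum_nonneg fun _ _ => by split_ifs <;> simp

/-- Exchanging the two sums makes the truncated time linear in the gaps, with weights given by the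
walk alone. One index set serves all `z`, so the same formula covers the random gaps, their mean,
and unit gaps. -/
theorem exists_truncTime_eq (R : ℤ) (w : ℕ → ℤ) (n : ℕ) :
    ∃ J : Finset ℤ, ∀ z : ℤ → ℝ, truncTime R z w n = ∑ j ∈ J, crossings R w n j * z j := by
  classical
  refine ⟨(Finset.range n).biUnion fun i =>
    Finset.Ioc (min (walk w i) (walk w (i + 1))) (max (walk w i) (walk w (i + 1))), fun z => ?_⟩
  unfold truncTime crossings
  simp only [Finset.sum_mul]
  rw [Finset.sum_comm]
  refine Finset.sum_congr rfl fun i hi => ?_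
  unfold gapSum
  by_cases h : |w i| ≤ R
  · simp only [h, true_and, if_true, ite_mul, one_mul, zero_mul]
    rw [← Finset.sum_filter]
    refine Finset.sum_congr ?_ fun _ _ => rfl
    ext j
    simp only [Finset.mem_filter, Finset.mem_biUnion]
    exact ⟨fun hj => ⟨⟨i, hi, hj⟩, hj⟩, fun hj => hj.2⟩
  · simp [h]

/-- A jump of size at most `R` across the gap `j` starts within distance `R` of `j`, so crossings
are counted by visits to 2R + 1 sites. -/
theorem crossings_le {R : ℕ} {w : ℕ → ℤ} {n : ℕ} {L : ℝ} (hL : ∀ j, (localTime w n j : ℝ) ≤ L)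
    (j : ℤ) : crossings R w n j ≤ (2 * R + 1) * L := by
  have h1 : crossings R w n j ≤ ∑ d ∈ Finset.Icc (-(R : ℤ)) R, (localTime w n (j + d) : ℝ) := by
    unfold crossings localTime
    push_cast
    rw [Finset.sum_comm]
    refine Finset.sum_le_sum fun i _ => ?_
    split_ifs with h
    · obtain ⟨h2, h3⟩ := h
      rw [Finset.mem_Ioc, walk_succ, abs_le] at *
      have hd : walk w i - j ∈ Finset.Icc (-(R : ℤ)) R := by
        rw [Finset.mem_Icc]
        rcases le_total (walk w i) (walk w i + w i) with h4 | h4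
        · rw [min_eq_left h4, max_eq_right h4] at h3; omega
        · rw [min_eq_right h4, max_eq_left h4] at h3; omega
      refine le_trans ?_ (Finset.single_le_sum (fun d _ => ?_) hd)
      · rw [if_pos (by ring)]
      · split_ifs <;> simp
    · exact Finset.sum_nonneg fun d _ => by split_ifs <;> simp
  refine h1.trans ((Finset.sum_le_sum fun d _ => hL (j + d)).trans_eq ?_)
  rw [Finset.sum_const, Int.card_Icc, nsmul_eq_mul]
  have : ((R : ℤ) + 1 - -(R : ℤ)).toNat = 2 * R + 1 := by omega
  rw [this]; push_cast; ring

theorem truncTime_const (R : ℤ) (c : ℝ) (w : ℕ → ℤ) (n : ℕ) :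
    truncTime R (fun _ => c) w n =
      c * ∑ i ∈ Finset.range n, if |w i| ≤ R then |(w i : ℝ)| else 0 := by
  unfold truncTime
  rw [Finset.mul_sum]
  refine Finset.sum_congr rfl fun i _ => ?_
  rw [gapSum_const_walk]
  split_ifs <;> simp

theorem truncTime_one_le (R : ℕ) (w : ℕ → ℤ) (n : ℕ) :
    truncTime R (fun _ => 1) w n ≤ R * n := by
  rw [truncTime_const, one_mul]
  calc _ ≤ ∑ i ∈ Finset.range n, (R : ℝ) := by
        refine Finset.sum_le_sum fun i _ => ?_
        split_ifs with h
        · exact_mod_cast h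
        · positivity
    _ = _ := by simp [mul_comm]

theorem truncTime_sub_const (R : ℤ) (z : ℤ → ℝ) (c : ℝ) (w : ℕ → ℤ) (n : ℕ) :
    truncTime R (fun j => z j - c) w n = truncTime R z w n - truncTime R (fun _ => c) w n := by
  unfold truncTime
  rw [← Finset.sum_sub_distrib]
  refine Finset.sum_congr rfl fun i _ => ?_
  split_ifs
  · exact Finset.sum_sub_distrib _ _
  · simp

theorem measurable_gapSum {Ω : Type*} [MeasurableSpace Ω] {η : ℤ → Ω → ℝ}
    (hm : ∀ j, Measurable (η j)) :
    Measurable fun v : Ω × (ℤ × ℤ) => gapSum (fun j => η j v.1) v.2.1 v.2.2 :=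
  measurable_from_prod_countable_left fun v => by
    simp only [gapSum]
    exact Finset.measurable_sum _ fun j _ => hm j

theorem measurable_gapSum_walk {Ω : Type*} [MeasurableSpace Ω] {η : ℤ → Ω → ℝ}
    (hm : ∀ j, Measurable (η j)) (i k : ℕ) :
    Measurable fun u : Ω × (ℕ → ℤ) => gapSum (fun j => η j u.1) (walk u.2 i) (walk u.2 k) := by
  have h2 : Measurable fun u : Ω × (ℕ → ℤ) => (u.1, (walk u.2 i, walk u.2 k)) :=
    measurable_fst.prodMk
      (((measurable_walk i).comp measurable_snd).prodMk ((measurable_walk k).comp measurable_snd))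
  have h3 := (measurable_gapSum hm).comp h2
  simpa only [Function.comp_def] using h3

theorem measurable_truncTime {Ω : Type*} [MeasurableSpace Ω] {η : ℤ → Ω → ℝ}
    (hm : ∀ j, Measurable (η j)) (R : ℤ) (n : ℕ) :
    Measurable fun u : Ω × (ℕ → ℤ) => truncTime R (fun j => η j u.1) u.2 n := by
  refine Finset.measurable_sum _ fun i _ => Measurable.ite ?_ (measurable_gapSum_walk hm _ _)
    measurable_const
  have : Measurable fun u : Ω × (ℕ → ℤ) => |u.2 i| :=
    (measurable_of_countable fun k : ℤ => |k|).comp ((measurable_pi_apply i).comp measurable_snd)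
  exact this (Set.to_countable {k : ℤ | k ≤ R}).measurableSet

/-- Quenched concentration of the truncated collision time for bounded gaps. -/
theorem ae_rapidlyDecaying_truncTime {ρ : Measure ℤ} [IsProbabilityMeasure ρ]
    (hρ : SymmDecreasing fun z => ρ.real {z}) (h1 : 0 < ρ.real {1})
    {Ω : Type*} [MeasurableSpace Ω] {P : Measure Ω} [IsProbabilityMeasure P]
    {η : ℤ → Ω → ℝ} (hm : ∀ j, Measurable (η j)) (hi : iIndepFun η P) {M μ : ℝ} (hM : 0 < M)
    (hb : ∀ j, ∀ᵐ a ∂P, η j a ∈ Set.Icc 0 M) (hμ : ∀ j, ∫ a, η j a ∂P = μ)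
    (R : ℕ) {ε : ℝ} (hε : 0 < ε) :
    ∀ᵐ a ∂P, RapidlyDecaying fun n => pathLaw ρ {w | ε * n ≤
      |truncTime R (fun j => η j a) w n - truncTime R (fun _ => μ) w n|} := by
  set A : ℕ → Set (Ω × (ℕ → ℤ)) := fun n => {u | ε * n ≤
    |truncTime R (fun j => η j u.1) u.2 n - truncTime R (fun _ => μ) u.2 n|} with hA
  have hAm : ∀ n, MeasurableSet (A n) := fun n => by
    refine measurableSet_le measurable_const ?_
    exact continuous_abs.measurable.comp ((measurable_truncTime hm R n).sub
      (measurable_truncTime (η := fun _ _ => μ) (fun _ => measurable_const) R n))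
  refine RapidlyDecaying.ae_of_lintegral
    (u := fun n a => pathLaw ρ {w | (a, w) ∈ A n}) (fun n => measurable_measure_prodMk_left (hAm n)) ?_
  -- Hoeffding's exponent is (εn)² over twice the variance proxy, which has order n^(5/6) · n; this
  -- leaves c n^(1/6). Writing `R + 1` for `R` keeps the denominator nonzero at `R = 0`.
  set c : ℝ := ε ^ 2 / (2 * ((2 * R + 1) * (R + 1) * (M / 2) ^ 2)) with hc
  have hc0 : 0 < c := by positivity
  refine ((rapidlyDecaying_localTime hρ h1).add
    (RapidlyDecaying.exp_neg_rpow (c := c) (α := 1 / 6) hc0 (by norm_num) 2 0)).mono ?_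
  filter_upwards [eventually_ge_atTop 1] with n hn
  have hn0 : (0 : ℝ) < n := by exact_mod_cast hn
  -- Tonelli: the environment is integrated first, with the walk frozen, so that the weights are
  -- constants.
  have e1 : ∫⁻ a, pathLaw ρ {w | (a, w) ∈ A n} ∂P =
      ∫⁻ w, P {a | (a, w) ∈ A n} ∂pathLaw ρ := by
    exact (Measure.prod_apply (hAm n)).symm.trans (Measure.prod_apply_symm (hAm n))
  rw [e1]
  set bad : Set (ℕ → ℤ) := {w | ∃ j, (n : ℝ) ^ (5 / 6 : ℝ) ≤ localTime w n j}
  set t : ℝ≥0∞ := ENNReal.ofReal (2 * (n : ℝ) ^ (0 : ℝ) * Real.exp (-(c * (n : ℝ) ^ (1 / 6 : ℝ))))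
    with ht
  have hpt : ∀ w, P {a | (a, w) ∈ A n} ≤ bad.indicator (fun _ => 1) w + t := by
    intro w
    by_cases hw : w ∈ bad
    · rw [Set.indicator_of_mem hw]
      exact prob_le_one.trans le_self_add
    · have hL : ∀ j, (localTime w n j : ℝ) ≤ (n : ℝ) ^ (5 / 6 : ℝ) := fun j =>
        le_of_not_ge fun h => hw ⟨j, h⟩
      obtain ⟨J, hJ⟩ := exists_truncTime_eq R w n
      -- Largest weight times total weight; the total weight is the truncated time for unit gaps.
      have hV : ∑ j ∈ J, crossings R w n j ^ 2 ≤ (2 * R + 1) * (n : ℝ) ^ (5 / 6 : ℝ) * ((R + 1) * n) := by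
        calc ∑ j ∈ J, crossings R w n j ^ 2
            ≤ ∑ j ∈ J, (2 * R + 1) * (n : ℝ) ^ (5 / 6 : ℝ) * (crossings R w n j * 1) := by
              refine Finset.sum_le_sum fun j _ => ?_
              rw [sq, mul_one]
              exact mul_le_mul_of_nonneg_right (crossings_le hL j) (crossings_nonneg _ _ _ _)
          _ = (2 * R + 1) * (n : ℝ) ^ (5 / 6 : ℝ) * truncTime R (fun _ => 1) w n := by
              rw [hJ, Finset.mul_sum]
          _ ≤ _ := by
              gcongr
              refine (truncTime_one_le R w n).trans ?_
              gcongr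
              linarith
      have hh := hoeffding_weighted hm hi hb hμ J (crossings R w n) hV
        (show 0 ≤ ε * n by positivity)
      have hset : {a | (a, w) ∈ A n} =
          {a | ε * n ≤ |∑ j ∈ J, crossings R w n j * (η j a - μ)|} := by
        ext a
        simp only [hA, Set.mem_ofPred_eq]
        rw [← truncTime_sub_const, hJ]
      rw [hset]
      refine hh.trans (le_trans (le_of_eq ?_) le_add_self)
      rw [ht, Real.rpow_zero, mul_one, ENNReal.ofReal_mul (by norm_num), ENNReal.ofReal_ofNat]
      congr 3
      have h6 : (n : ℝ) ^ 2 = (n : ℝ) ^ (1 / 6 : ℝ) * ((n : ℝ) ^ (5 / 6 : ℝ) * n) := by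
        rw [← mul_assoc, ← Real.rpow_add hn0]; norm_num; ring
      have h7 : (n : ℝ) ^ (5 / 6 : ℝ) ≠ 0 := by positivity
      rw [hc, mul_pow, h6]
      field_simp
  calc _ ≤ ∫⁻ w, (bad.indicator (fun _ => 1) w + t) ∂pathLaw ρ := lintegral_mono hpt
    _ = ∫⁻ w, bad.indicator (fun _ => 1) w ∂pathLaw ρ + t := by
        rw [lintegral_add_right _ measurable_const]; simp
    _ ≤ _ := by
        gcongr
        simpa using lintegral_indicator_const_le bad (1 : ℝ≥0∞) (μ := pathLaw ρ)

/-! ### Mean time per jump and laws of large numbers for the steps. -/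

/-- Standing assumptions on the step law: symmetric, unimodal, nontrivial, square integrable. -/
structure JumpLaw (ρ : Measure ℤ) : Prop where
  symmDecreasing : SymmDecreasing fun z => ρ.real {z}
  one_pos : 0 < ρ.real {1}
  integrable_sq : Integrable (fun z : ℤ => (z : ℝ) ^ 2) ρ

/-- The mean absolute step. -/
noncomputable def meanAbs (ρ : Measure ℤ) : ℝ := ∫ z : ℤ, |(z : ℝ)| ∂ρ

section Steps

variable {ρ : Measure ℤ} [IsProbabilityMeasure ρ]

theorem lintegral_walk_step (n : ℕ) (F : ℤ → ℤ → ℝ≥0∞) :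
    ∫⁻ w, F (walk w n) (w n) ∂pathLaw ρ = ∫⁻ y, ∑' x, heatKernel ρ n x * F x y ∂ρ := by
  have hind : IndepFun (fun w : ℕ → ℤ => walk w n) (fun w => w n) (pathLaw ρ) := by
    have h := (iIndepFun_pathLaw ρ (fun z : ℤ => z)).indepFun_finsetSum_of_notMem
      (fun i => measurable_pi_apply i) (Finset.notMem_range_self (n := n))
    convert h using 1
    ext w
    simp [walk]
  have hmap := (indepFun_iff_map_prod_eq_prod_map_map (measurable_walk n).aemeasurable
    (measurable_pi_apply n).aemeasurable).1 hind
  rw [(measurePreserving_eval ρ n).map_eq] at hmap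
  have hF : Measurable fun u : ℤ × ℤ => F u.1 u.2 := measurable_of_countable _
  have e := lintegral_map (μ := pathLaw ρ) hF ((measurable_walk n).prodMk (measurable_pi_apply n))
  rw [← e, hmap, lintegral_prod_symm _ hF.aemeasurable]
  refine lintegral_congr fun y => ?_
  rw [lintegral_map (measurable_of_countable _) (measurable_walk n)]
  exact lintegral_walk ρ n fun x => F x y

theorem JumpLaw.integrable_abs (hρ : JumpLaw ρ) : Integrable (fun z : ℤ => |(z : ℝ)|) ρ := by
  refine Integrable.mono' (hρ.integrable_sq.add (integrable_const (1 : ℝ)))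
    (measurable_of_countable _).aestronglyMeasurable (ae_of_all _ fun z => ?_)
  simp only [Real.norm_eq_abs, abs_abs, Pi.add_apply]
  nlinarith [sq_abs (z : ℝ), sq_nonneg (|(z : ℝ)| - 1)]

theorem JumpLaw.meanAbs_pos (hρ : JumpLaw ρ) : 0 < meanAbs ρ := by
  have h : ∫ z in ({1} : Finset ℤ), |(z : ℝ)| ∂ρ ≤ ∫ z : ℤ, |(z : ℝ)| ∂ρ :=
    setIntegral_le_integral hρ.integrable_abs (ae_of_all _ fun z => abs_nonneg _)
  rw [setIntegral_finset _ hρ.integrable_abs.integrableOn] at h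
  simp only [Finset.sum_singleton, Int.cast_one, abs_one, smul_eq_mul, mul_one] at h
  exact hρ.one_pos.trans_le h

/-- The sum consists of |y| translates of the window [-N, N], each inside [-(N + |y|), N + |y|].
Enlarging the window produces the term quadratic in `y`, which is why the steps need a second
moment. -/
theorem sum_gapSum_shift_le {z : ℤ → ℝ} (hz : ∀ j, 0 ≤ z j) {a B : ℝ}
    (hB : ∀ N : ℕ, ∑ j ∈ Finset.Icc (-(N : ℤ)) N, z j ≤ a * (2 * N + 1) + B) (y : ℤ) (N : ℕ) :
    ∑ x ∈ Finset.Icc (-(N : ℤ)) N, gapSum z x (x + y) ≤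
      (a * |(y : ℝ)|) * (2 * N + 1) + (2 * a * (y : ℝ) ^ 2 + B * |(y : ℝ)|) := by
  have h1 : ∀ x, gapSum z x (x + y) = ∑ d ∈ Finset.Ioc (min 0 y) (max 0 y), z (x + d) := by
    intro x
    unfold gapSum
    rw [Finset.sum_image (s := Finset.Ioc (min 0 y) (max 0 y)) (f := z) (g := fun d => x + d)
      (fun a _ b _ h => by simpa using h) |>.symm]
    congr 1
    have := Finset.image_add_left_Ioc (min 0 y) (max 0 y) x
    rw [this, ← min_add_add_left, ← max_add_add_left, add_zero]
  have hcard : ((Finset.Ioc (min 0 y) (max 0 y)).card : ℝ) = |(y : ℝ)| := by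
    have := gapSum_const 1 0 y
    simpa [gapSum] using this
  set Y := y.natAbs with hY
  have hYr : (Y : ℝ) = |(y : ℝ)| := by rw [hY, Nat.cast_natAbs]; simp
  simp only [h1]
  rw [Finset.sum_comm]
  have h2 : ∀ d ∈ Finset.Ioc (min 0 y) (max 0 y),
      ∑ x ∈ Finset.Icc (-(N : ℤ)) N, z (x + d) ≤ a * (2 * ((N + Y : ℕ) : ℝ) + 1) + B := by
    intro d hd
    refine le_trans ?_ (hB (N + Y))
    rw [Finset.sum_image (s := Finset.Icc (-(N : ℤ)) N) (f := z) (g := fun x => x + d)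
      (fun a _ b _ h => by simpa using h) |>.symm]
    refine Finset.sum_le_sum_of_subset_of_nonneg ?_ fun j _ _ => hz j
    intro j hj
    simp only [Finset.mem_image, Finset.mem_Icc, Finset.mem_Ioc] at *
    obtain ⟨x, hx, rfl⟩ := hj
    push_cast
    rcases le_total 0 y with h | h
    · rw [min_eq_left h, max_eq_right h] at hd; omega
    · rw [min_eq_right h, max_eq_left h] at hd; omega
  refine (Finset.sum_le_sum h2).trans_eq ?_
  rw [Finset.sum_const, nsmul_eq_mul, hcard]
  push_cast
  rw [hYr]
  have : (y : ℝ) ^ 2 = |(y : ℝ)| * |(y : ℝ)| := by rw [← sq, sq_abs]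
  rw [this]
  ring

/-- The mean time spent on the `n`-th jump is asymptotically at most `a` times the mean absolute
step when the gap averages around the origin are at most `a`. -/
theorem lintegral_gapSum_walk_le (hρ : JumpLaw ρ) {z : ℤ → ℝ} (hz : ∀ j, 0 ≤ z j) {a B : ℝ}
    (ha : 0 ≤ a) (hB0 : 0 ≤ B)
    (hB : ∀ N : ℕ, ∑ j ∈ Finset.Icc (-(N : ℤ)) N, z j ≤ a * (2 * N + 1) + B) (n : ℕ) :
    ∫⁻ w, ENNReal.ofReal (gapSum z (walk w n) (walk w (n + 1))) ∂pathLaw ρ ≤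
      ENNReal.ofReal (a * meanAbs ρ + (2 * a * (∫ y : ℤ, (y : ℝ) ^ 2 ∂ρ) + B * meanAbs ρ) *
        (heatKernel ρ n 0).toReal) := by
  set u := (heatKernel ρ n 0).toReal with hu
  have hu0 : 0 ≤ u := ENNReal.toReal_nonneg
  have h1 := lintegral_walk_step (ρ := ρ) n fun x y => ENNReal.ofReal (gapSum z x (x + y))
  simp only [← walk_succ] at h1
  rw [h1]
  have h2 : ∀ y : ℤ, ∑' x, heatKernel ρ n x * ENNReal.ofReal (gapSum z x (x + y)) ≤
      ENNReal.ofReal (a * |(y : ℝ)| + (2 * a * (y : ℝ) ^ 2 + B * |(y : ℝ)|) * u) := by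
    intro y
    -- For a fixed step `y` the law of the position is symmetric decreasing, so only interval
    -- averages of the gaps enter; the boundary terms come with the return probability as a factor.
    have h3 := (symmDecreasing_heatKernel hρ.symmDecreasing n).tsum_mul_le
      (tendsto_heatKernel_space ρ n) (F := fun x => ENNReal.ofReal (gapSum z x (x + y)))
      (a := ENNReal.ofReal (a * |(y : ℝ)|))
      (B := ENNReal.ofReal (2 * a * (y : ℝ) ^ 2 + B * |(y : ℝ)|)) ?_
    · simp only [ENNReal.ofReal_toReal (heatKernel_ne_top ρ _ _), tsum_heatKernel, mul_one] at h3
      refine h3.trans_eq ?_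
      rw [← ENNReal.ofReal_toReal (heatKernel_ne_top ρ n 0), ← hu,
        ← ENNReal.ofReal_mul (by positivity), ← ENNReal.ofReal_add (by positivity) (by positivity)]
    · intro N
      rw [← ENNReal.ofReal_sum_of_nonneg fun x _ => gapSum_nonneg hz _ _]
      refine (ENNReal.ofReal_le_ofReal (sum_gapSum_shift_le hz hB y N)).trans_eq ?_
      rw [ENNReal.ofReal_add (by positivity) (by positivity), ENNReal.ofReal_mul (by positivity)]
      congr 2
      rw [ENNReal.ofReal_add (by positivity) zero_le_one, ENNReal.ofReal_mul (by norm_num)]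
      simp
  refine (lintegral_mono h2).trans ?_
  have i1 := hρ.integrable_abs
  have i2 := hρ.integrable_sq
  have i3 : Integrable (fun y : ℤ => 2 * a * (y : ℝ) ^ 2 + B * |(y : ℝ)|) ρ :=
    (i2.const_mul _).add (i1.const_mul _)
  have i4 : Integrable (fun y : ℤ => a * |(y : ℝ)| +
      (2 * a * (y : ℝ) ^ 2 + B * |(y : ℝ)|) * u) ρ := (i1.const_mul a).add (i3.mul_const u)
  rw [← ofReal_integral_eq_lintegral_ofReal i4
    (ae_of_all _ fun y => by positivity)]
  refine ENNReal.ofReal_le_ofReal (le_of_eq ?_)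
  rw [integral_add (i1.const_mul a) (i3.mul_const u), integral_const_mul, integral_mul_const,
    integral_add (i2.const_mul _) (i1.const_mul _), integral_const_mul, integral_const_mul]
  rfl

theorem measurable_walk_pair {β : Type*} [MeasurableSpace β] (f : ℤ → ℤ → β) (i k : ℕ) :
    Measurable fun w : ℕ → ℤ => f (walk w i) (walk w k) := by
  have h1 : Measurable fun v : ℤ × ℤ => f v.1 v.2 := measurable_of_countable _
  have h2 := h1.comp ((measurable_walk i).prodMk (measurable_walk k))
  simpa only [Function.comp_def] using h2

/-- The errors in `lintegral_gapSum_walk_le` are multiples of return probabilities; these tend to 0,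
hence so do their Cesàro means. -/
theorem eventually_lintegral_sum_gapSum_le (hρ : JumpLaw ρ) {z : ℤ → ℝ} (hz : ∀ j, 0 ≤ z j)
    {a B : ℝ} (ha : 0 ≤ a) (hB0 : 0 ≤ B)
    (hB : ∀ N : ℕ, ∑ j ∈ Finset.Icc (-(N : ℤ)) N, z j ≤ a * (2 * N + 1) + B)
    {δ : ℝ} (hδ : 0 < δ) :
    ∀ᶠ n : ℕ in atTop, ∫⁻ w, ENNReal.ofReal
      (∑ i ∈ Finset.range n, gapSum z (walk w i) (walk w (i + 1))) ∂pathLaw ρ ≤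
        ENNReal.ofReal ((a * meanAbs ρ + δ) * n) := by
  set D := 2 * a * (∫ y : ℤ, (y : ℝ) ^ 2 ∂ρ) + B * meanAbs ρ with hD
  have hm0 : 0 ≤ meanAbs ρ := hρ.meanAbs_pos.le
  have hD0 : 0 ≤ D := by
    have : 0 ≤ ∫ y : ℤ, (y : ℝ) ^ 2 ∂ρ := integral_nonneg fun y => sq_nonneg _
    positivity
  have hlim : Tendsto (fun k => (heatKernel ρ k 0).toReal) atTop (𝓝 0) := by
    have := (ENNReal.tendsto_toReal ENNReal.zero_ne_top).comp
      (tendsto_heatKernel_time hρ.symmDecreasing hρ.one_pos)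
    simpa [Function.comp_def] using this
  have hces := hlim.cesaro
  have hev := hces.eventually_le_const (show (0 : ℝ) < δ / (D + 1) by positivity)
  filter_upwards [hev, eventually_ge_atTop 1] with n hn hn1
  have hn0 : (0 : ℝ) < n := by exact_mod_cast hn1
  have hmeas := measurable_walk_pair (gapSum z)
  simp_rw [ENNReal.ofReal_sum_of_nonneg fun i _ => gapSum_nonneg hz _ _]
  rw [lintegral_finsetSum _ fun i _ => (hmeas i (i + 1)).ennreal_ofReal]
  refine (Finset.sum_le_sum fun i _ => lintegral_gapSum_walk_le hρ hz ha hB0 hB i).trans ?_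
  rw [← ENNReal.ofReal_sum_of_nonneg fun i _ => by
    have : 0 ≤ (heatKernel ρ i 0).toReal := ENNReal.toReal_nonneg
    positivity]
  refine ENNReal.ofReal_le_ofReal ?_
  rw [Finset.sum_add_distrib, Finset.sum_const, Finset.card_range, nsmul_eq_mul, ← Finset.mul_sum,
    ← hD]
  have h5 : ∑ i ∈ Finset.range n, (heatKernel ρ i 0).toReal ≤ δ / (D + 1) * n := by
    rw [inv_mul_le_iff₀ hn0] at hn
    linarith
  have h6 : D * (δ / (D + 1)) ≤ δ := by
    rw [mul_div_assoc', div_le_iff₀ (by positivity)]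
    nlinarith
  have h7 := mul_le_mul_of_nonneg_left h5 hD0
  nlinarith

/-- The weak law of large numbers for the absolute steps. -/
theorem tendsto_measure_sum_abs (hρ : JumpLaw ρ) {ε : ℝ} (hε : 0 < ε) :
    Tendsto (fun n : ℕ => pathLaw ρ
      {w | ε * n ≤ |∑ i ∈ Finset.range n, |(w i : ℝ)| - meanAbs ρ * n|}) atTop (𝓝 0) := by
  have hmp := measurePreserving_eval ρ
  have hma : Measurable fun z : ℤ => |(z : ℝ)| := measurable_of_countable _
  have hident : ∀ i, IdentDistrib (fun w : ℕ → ℤ => |(w i : ℝ)|) (fun w => |(w 0 : ℝ)|)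
      (pathLaw ρ) (pathLaw ρ) := fun i => by
    have h1 : IdentDistrib (fun w : ℕ → ℤ => w i) (fun w => w 0) (pathLaw ρ) (pathLaw ρ) :=
      ⟨(measurable_pi_apply i).aemeasurable, (measurable_pi_apply 0).aemeasurable,
        by rw [(hmp i).map_eq, (hmp 0).map_eq]⟩
    exact h1.comp hma
  have hint : Integrable (fun w : ℕ → ℤ => |(w 0 : ℝ)|) (pathLaw ρ) :=
    (hmp 0).integrable_comp_of_integrable hρ.integrable_abs
  have hmean : ∫ w, |(w 0 : ℝ)| ∂pathLaw ρ = meanAbs ρ := by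
    have := integral_map (μ := pathLaw ρ) (measurable_pi_apply 0).aemeasurable
      (hma.aestronglyMeasurable (μ := Measure.map (fun w : ℕ → ℤ => w 0) (pathLaw ρ)))
    rw [(hmp 0).map_eq] at this
    exact this.symm
  have hslln := strong_law_ae_real (fun i (w : ℕ → ℤ) => |(w i : ℝ)|) hint
    (fun i j hij => (iIndepFun_pathLaw ρ fun z : ℤ => |(z : ℝ)|).indepFun hij) hident
  rw [hmean] at hslln
  have hmeas : ∀ n, Measurable fun w : ℕ → ℤ => (∑ i ∈ Finset.range n, |(w i : ℝ)|) / n :=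
    fun n => (measurable_stepSum (fun z : ℤ => |(z : ℝ)|) n).div_const _
  have h := tendstoInMeasure_of_tendsto_ae (fun n => (hmeas n).aestronglyMeasurable) hslln
  rw [tendstoInMeasure_iff_norm] at h
  refine (h ε hε).congr' ?_
  filter_upwards [eventually_ge_atTop 1] with n hn
  have hn0 : (0 : ℝ) < n := by exact_mod_cast hn
  congr 1
  ext w
  simp only [Set.mem_ofPred_eq, Real.norm_eq_abs]
  rw [div_sub' hn0.ne', abs_div, abs_of_pos hn0, le_div_iff₀ hn0, mul_comm (n : ℝ) (meanAbs ρ)]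

theorem lintegral_stepSum (g : ℤ → ℝ≥0∞) (n : ℕ) :
    ∫⁻ w, ∑ i ∈ Finset.range n, g (w i) ∂pathLaw ρ = n * ∫⁻ z, g z ∂ρ := by
  have hm : ∀ i ∈ Finset.range n, Measurable fun w : ℕ → ℤ => g (w i) := fun i _ =>
    (measurable_of_countable g).comp (measurable_pi_apply i)
  rw [lintegral_finsetSum _ hm]
  simp_rw [(measurePreserving_eval ρ _).lintegral_comp (measurable_of_countable g)]
  simp

/-- The number of unit steps among the first `n` is at least linear in `n`, up to a rapidly
decaying probability. -/
theorem rapidlyDecaying_unit_steps (hρ : JumpLaw ρ) :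
    RapidlyDecaying fun n => pathLaw ρ
      {w | ∑ i ∈ Finset.range n, (if |w i| ≤ (1 : ℤ) then |(w i : ℝ)| else 0) ≤
        ρ.real {1} / 2 * n} := by
  set g : ℤ → ℝ := fun z => if |z| ≤ (1 : ℤ) then |(z : ℝ)| else 0 with hg
  have hg01 : ∀ z, g z ∈ Set.Icc (0 : ℝ) 1 := fun z => by
    simp only [hg]
    split_ifs with h
    · exact ⟨abs_nonneg _, by exact_mod_cast h⟩
    · simp
  have hgm : Measurable g := measurable_of_countable g
  have hgi : Integrable g ρ := Integrable.of_mem_Icc 0 1 hgm.aemeasurable (ae_of_all _ hg01)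
  set μ := ∫ z, g z ∂ρ with hμ
  have hμ1 : ρ.real {1} ≤ μ := by
    have h : ∫ z in ({1} : Finset ℤ), g z ∂ρ ≤ ∫ z : ℤ, g z ∂ρ :=
      setIntegral_le_integral hgi (ae_of_all _ fun z => (hg01 z).1)
    rw [setIntegral_finset _ hgi.integrableOn] at h
    simpa [hg] using h
  have hp := hρ.one_pos
  -- Hoeffding for [0, 1]-valued variables at deviation ρ{1}n/2: the mean is at least ρ{1}, and half
  -- of it is given away.
  set c : ℝ := 2 * (ρ.real {1} / 2) ^ 2
  have hmean : ∀ i, ∫ w, g (w i) ∂pathLaw ρ = μ := fun i => by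
    have := integral_map (μ := pathLaw ρ) (measurable_pi_apply i).aemeasurable
      (hgm.aestronglyMeasurable (μ := Measure.map (fun w : ℕ → ℤ => w i) (pathLaw ρ)))
    rw [(measurePreserving_eval ρ i).map_eq] at this
    exact this.symm
  refine (RapidlyDecaying.exp_neg_rpow (c := c) (α := 1) (by positivity) one_pos 2 0).mono ?_
  filter_upwards [eventually_ge_atTop 1] with n hn
  have hn0 : (0 : ℝ) < n := by exact_mod_cast hn
  have hh := hoeffding_weighted (P := pathLaw ρ) (η := fun i (w : ℕ → ℤ) => g (w i))
    (fun i => hgm.comp (measurable_pi_apply i)) (iIndepFun_pathLaw ρ g)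
    (fun i => ae_of_all _ fun w => hg01 (w i)) hmean (Finset.range n) (fun _ => 1) (V := n)
    (by simp) (show 0 ≤ ρ.real {1} / 2 * n by positivity)
  refine (measure_mono ?_).trans (hh.trans_eq ?_)
  · intro w hw
    simp only [Set.mem_ofPred_eq, one_mul, Finset.sum_sub_distrib, Finset.sum_const,
      Finset.card_range, nsmul_eq_mul] at hw ⊢
    rw [abs_sub_comm]
    refine le_trans ?_ (le_abs_self _)
    nlinarith
  · rw [Real.rpow_zero, mul_one, ENNReal.ofReal_mul (by norm_num), ENNReal.ofReal_ofNat,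
      Real.rpow_one]
    congr 3
    simp only [c]
    field_simp

end Steps

/-! ### Regular environments and linear asymptotics of the targets. -/

/-- The properties of a typical environment with mean gap `μ` that drive the quenched limits. -/
structure RegularEnvironment (ρ : Measure ℤ) [IsProbabilityMeasure ρ] (μ : ℝ) (z : ℤ → ℝ) :
    Prop where
  asymptotics : ∀ ε > 0, ∃ B, 0 ≤ B ∧ ∀ k : ℤ, |environment z k - μ * k| ≤ ε * |(k : ℝ)| + B
  time_lln : ∀ ε > 0, Tendsto (fun n : ℕ => pathLaw ρ
    {w | ε * n ≤ |collisionTime (environment z) w n - μ * meanAbs ρ * n|}) atTop (𝓝 0)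
  time_lower : ∃ c > 0, RapidlyDecaying fun n : ℕ => pathLaw ρ
    {w | collisionTime (environment z) w n ≤ c * n}

theorem exists_bound_of_tendsto_div {s : ℕ → ℝ} {e : ℝ}
    (h : Tendsto (fun n : ℕ => s n / n) atTop (𝓝 e)) {ε : ℝ} (hε : 0 < ε) :
    ∃ B, 0 ≤ B ∧ ∀ n : ℕ, |s n - e * n| ≤ ε * n + B := by
  obtain ⟨N, hN⟩ := Metric.tendsto_atTop.1 h ε hε
  refine ⟨∑ n ∈ Finset.range (N + 1), |s n - e * n|, Finset.sum_nonneg fun _ _ => abs_nonneg _,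
    fun n => ?_⟩
  rcases lt_or_ge n (N + 1) with hn | hn
  · have := Finset.single_le_sum (f := fun n : ℕ => |s n - e * n|) (fun _ _ => abs_nonneg _)
      (Finset.mem_range.2 hn)
    have h2 : 0 ≤ ε * n := by positivity
    linarith
  · have hn0 : (0 : ℝ) < n := by exact_mod_cast (by omega : 0 < n)
    have h1 := hN n (by omega)
    rw [Real.dist_eq, div_sub' hn0.ne', abs_div, abs_of_pos hn0, div_lt_iff₀ hn0,
      mul_comm (n : ℝ) e] at h1
    have : 0 ≤ ∑ n ∈ Finset.range (N + 1), |s n - e * n| :=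
      Finset.sum_nonneg fun _ _ => abs_nonneg _
    linarith

theorem environment_natCast (z : ℤ → ℝ) (n : ℕ) :
    environment z n = ∑ i ∈ Finset.range n, z (i + 1) := by
  induction n with
  | zero => simp [environment_zero]
  | succ n ih =>
    rw [Finset.sum_range_succ, ← ih, environment_rec]
    push_cast
    rw [add_sub_cancel_right]

theorem environment_neg_natCast (z : ℤ → ℝ) (n : ℕ) :
    environment z (-n) = - ∑ i ∈ Finset.range n, z (-i) := by
  induction n with
  | zero => simp [environment_zero]
  | succ n ih =>
    have h := environment_rec z (-n)
    rw [Finset.sum_range_succ, neg_add, ← ih, h]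
    push_cast
    rw [neg_add, ← sub_eq_add_neg (-(n : ℤ)) 1]
    ring

section Random

set_option linter.unusedSectionVars false

variable {Ω : Type*} [MeasurableSpace Ω] {P : Measure Ω} [IsProbabilityMeasure P]

/-- The strong law on each half-line, along the indices i + 1 and -i. The constant `B` absorbs the
finitely many k at which the limit has not yet taken hold. -/
theorem ae_environment_bound {η : ℤ → Ω → ℝ} (hi : iIndepFun η P)
    (hid : ∀ j, IdentDistrib (η j) (η 0) P P) (hint : Integrable (η 0) P) :
    ∀ᵐ a ∂P, ∀ ε > 0, ∃ B, 0 ≤ B ∧ ∀ k : ℤ,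
      |environment (fun j => η j a) k - (∫ a, η 0 a ∂P) * k| ≤ ε * |(k : ℝ)| + B := by
  have slln : ∀ f : ℕ → ℤ, Function.Injective f → ∀ᵐ a ∂P,
      Tendsto (fun n : ℕ => (∑ i ∈ Finset.range n, η (f i) a) / n) atTop (𝓝 (∫ a, η 0 a ∂P)) := by
    intro f hf
    have := strong_law_ae_real (fun i => η (f i)) ((hid _).integrable_iff.2 hint)
      (fun i j hij => hi.indepFun (hf.ne hij)) fun i => (hid _).trans (hid _).symm
    rwa [(hid (f 0)).integral_eq] at this
  filter_upwards [slln (fun i => (i : ℤ) + 1) fun a b h => by simpa using h,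
    slln (fun i => -(i : ℤ)) fun a b h => by simpa using h] with a h1 h2 ε hε
  obtain ⟨B1, hB1, hb1⟩ := exists_bound_of_tendsto_div h1 hε
  obtain ⟨B2, hB2, hb2⟩ := exists_bound_of_tendsto_div h2 hε
  refine ⟨B1 + B2, by positivity, fun k => ?_⟩
  rcases Int.eq_nat_or_neg k with ⟨n, rfl | rfl⟩
  · rw [environment_natCast]
    have := hb1 n
    push_cast
    rw [abs_of_nonneg (Nat.cast_nonneg (α := ℝ) n)]
    linarith
  · rw [environment_neg_natCast]
    have := hb2 n
    push_cast
    rw [abs_neg, abs_of_nonneg (Nat.cast_nonneg (α := ℝ) n), mul_neg, sub_neg_eq_add, neg_add_eq_sub,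
      abs_sub_comm]
    linarith

theorem sum_Icc_le_of_environment_bound {z : ℤ → ℝ} {e ε B : ℝ}
    (h : ∀ k : ℤ, |environment z k - e * k| ≤ ε * |(k : ℝ)| + B) (N : ℕ) :
    ∑ j ∈ Finset.Icc (-(N : ℤ)) N, z j ≤ (e + ε) * (2 * N + 1) + 2 * B := by
  have h1 : Finset.Icc (-(N : ℤ)) N = Finset.Ioc (-(N : ℤ) - 1) N := by
    ext j; simp only [Finset.mem_Icc, Finset.mem_Ioc]; omega
  rw [h1, ← environment_sub_of_le z (by omega)]
  have h2 := (abs_le.1 (h N)).2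
  have h3 := (abs_le.1 (h (-(N : ℤ) - 1))).1
  push_cast at h2 h3
  have h4 : |-(N : ℝ) - 1| = N + 1 := by
    rw [abs_of_nonpos (by linarith [Nat.cast_nonneg (α := ℝ) N])]; ring
  rw [abs_of_nonneg (Nat.cast_nonneg (α := ℝ) N)] at h2
  rw [h4] at h3
  linarith

end Random

/-! ### Law of large numbers and lower bound for collision times. -/

section Time

variable {ρ : Measure ℤ} [IsProbabilityMeasure ρ]

theorem tendsto_integral_abs_gt (hρ : JumpLaw ρ) :
    Tendsto (fun R : ℕ => ∫ z : ℤ, (if |z| ≤ (R : ℤ) then 0 else |(z : ℝ)|) ∂ρ) atTop (𝓝 0) := by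
  have h := tendsto_integral_of_dominated_convergence (μ := ρ)
    (F := fun (R : ℕ) (z : ℤ) => (if |z| ≤ (R : ℤ) then 0 else |(z : ℝ)|)) (f := fun _ => 0)
    (fun z : ℤ => |(z : ℝ)|) (fun R => (measurable_of_countable _).aestronglyMeasurable)
    hρ.integrable_abs (fun R => ae_of_all _ fun z => ?_) (ae_of_all _ fun z => ?_)
  · simpa using h
  · split_ifs <;> simp
  · refine tendsto_const_nhds.congr' ?_
    filter_upwards [eventually_ge_atTop z.natAbs] with R hR
    rw [if_pos (by rw [Int.abs_eq_natAbs]; exact_mod_cast hR)]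

theorem truncTime_le_collisionTime {z z' : ℤ → ℝ} (hz' : ∀ j, 0 ≤ z' j) (hzz : ∀ j, z' j ≤ z j)
    (R : ℤ) (w : ℕ → ℤ) (n : ℕ) :
    truncTime R z' w n ≤ collisionTime (environment z) w n := by
  rw [collisionTime_environment fun j => (hz' j).trans (hzz j)]
  refine Finset.sum_le_sum fun i _ => ?_
  have : gapSum z' (walk w i) (walk w (i + 1)) ≤ gapSum z (walk w i) (walk w (i + 1)) :=
    Finset.sum_le_sum fun j _ => hzz j
  split_ifs
  · exact this
  · exact (gapSum_nonneg hz' _ _).trans this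

/-- Capping gaps and keeping only unit steps can only shorten the time, and the unit steps alone
already contribute linearly. -/
theorem time_lower_of_concentration (hρ : JumpLaw ρ) {z z' : ℤ → ℝ} (hz' : ∀ j, 0 ≤ z' j)
    (hzz : ∀ j, z' j ≤ z j) {m : ℝ} (hm : 0 < m)
    (hC : ∀ k : ℕ, RapidlyDecaying fun n => pathLaw ρ {w | 1 / ((k : ℝ) + 1) * n ≤
      |truncTime (1 : ℕ) z' w n - truncTime (1 : ℕ) (fun _ => m) w n|}) :
    ∃ c > 0, RapidlyDecaying fun n : ℕ => pathLaw ρ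
      {w | collisionTime (environment z) w n ≤ c * n} := by
  have hp := hρ.one_pos
  -- A quarter of the rate m ρ{1}/2 given by the unit steps, so that both c n and a concentration
  -- error of c n fit below it.
  set c := m * ρ.real {1} / 8 with hc
  have hc0 : 0 < c := by positivity
  obtain ⟨k, hk⟩ := exists_nat_one_div_lt hc0
  refine ⟨c, hc0, ((hC k).add (rapidlyDecaying_unit_steps hρ)).mono (Eventually.of_forall ?_)⟩
  intro n
  refine (measure_mono ?_).trans (measure_union_le _ _)
  intro w hw
  have hw' : collisionTime (environment z) w n ≤ c * n := hw
  by_contra hcon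
  simp only [Set.mem_union, Set.mem_ofPred_eq, not_or, not_le] at hcon
  obtain ⟨h1, h2⟩ := hcon
  have h3 := truncTime_le_collisionTime hz' hzz (1 : ℕ) w n
  rw [truncTime_const] at h1
  push_cast at h1 h3 h2
  have h4 := (abs_lt.1 h1).1
  have hn0 : (0 : ℝ) ≤ n := Nat.cast_nonneg n
  have h5 : 1 / ((k : ℝ) + 1) * n ≤ c * n := by gcongr
  have h6 := mul_lt_mul_of_pos_left h2 hm
  have h7 : m * (ρ.real {1} / 2 * n) = 4 * (c * n) := by rw [hc]; ring
  have h8 : 0 ≤ c * n := by positivity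
  linarith

/-- For each walk, τ(n) = T + U + D: short jumps over capped gaps, long jumps over capped gaps, and
the excess of the gaps over their caps. The bound isolates the part of T that concentrates, a
remainder with small mean, and the fluctuation of the total step length. -/
theorem abs_collisionTime_sub_le {z z' : ℤ → ℝ} (hz' : ∀ j, 0 ≤ z' j) (hzz : ∀ j, z' j ≤ z j)
    {M m μ : ℝ} (hzM : ∀ j, z' j ≤ M) (hm0 : 0 ≤ m) (hmM : m ≤ M) (hmμ : m ≤ μ) (mb : ℝ)
    (R : ℕ) (w : ℕ → ℤ) (n : ℕ) :
    |collisionTime (environment z) w n - μ * mb * n| ≤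
      |truncTime R z' w n - truncTime R (fun _ => m) w n| +
      (2 * M * ∑ i ∈ Finset.range n, (if |w i| ≤ (R : ℤ) then 0 else |(w i : ℝ)|) +
        ∑ i ∈ Finset.range n, gapSum (fun j => z j - z' j) (walk w i) (walk w (i + 1)) +
        (μ - m) * ∑ i ∈ Finset.range n, |(w i : ℝ)|) +
      μ * |∑ i ∈ Finset.range n, |(w i : ℝ)| - mb * n| := by
  set T := truncTime R z' w n with hT
  set L := ∑ i ∈ Finset.range n, (if |w i| ≤ (R : ℤ) then 0 else |(w i : ℝ)|) with hL
  set D := ∑ i ∈ Finset.range n, gapSum (fun j => z j - z' j) (walk w i) (walk w (i + 1)) with hD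
  set A := ∑ i ∈ Finset.range n, |(w i : ℝ)| with hA
  set U := ∑ i ∈ Finset.range n,
    (if |w i| ≤ (R : ℤ) then 0 else gapSum z' (walk w i) (walk w (i + 1))) with hU
  have e1 : collisionTime (environment z) w n = T + U + D := by
    rw [collisionTime_environment fun j => (hz' j).trans (hzz j), hT, hU, hD, truncTime,
      ← Finset.sum_add_distrib, ← Finset.sum_add_distrib]
    refine Finset.sum_congr rfl fun i _ => ?_
    have := gapSum_add z' (fun j => z j - z' j) (walk w i) (walk w (i + 1))
    simp only [add_sub_cancel] at this
    rw [this]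
    split_ifs <;> ring
  have e2 : truncTime R (fun _ => m) w n = m * (A - L) := by
    rw [truncTime_const, hA, hL, ← Finset.sum_sub_distrib]
    congr 1
    refine Finset.sum_congr rfl fun i _ => ?_
    split_ifs <;> ring
  have hU0 : 0 ≤ U := Finset.sum_nonneg fun i _ => by
    split_ifs
    · exact le_rfl
    · exact gapSum_nonneg hz' _ _
  have hUL : U ≤ M * L := by
    rw [hU, hL, Finset.mul_sum]
    refine Finset.sum_le_sum fun i _ => ?_
    split_ifs
    · simp
    · rw [← gapSum_const_walk]
      exact Finset.sum_le_sum fun j _ => hzM j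
  have hL0 : 0 ≤ L := Finset.sum_nonneg fun i _ => by split_ifs <;> simp
  have hA0 : 0 ≤ A := Finset.sum_nonneg fun i _ => abs_nonneg _
  have hD0 : 0 ≤ D := Finset.sum_nonneg fun i _ => gapSum_nonneg (fun j => sub_nonneg.2 (hzz j)) _ _
  have hμ0 : 0 ≤ μ := hm0.trans hmμ
  rw [e1, e2]
  have e3 : T + U + D - μ * mb * n =
      (T - m * (A - L)) + (U + D - m * L - (μ - m) * A) + μ * (A - mb * n) := by ring
  rw [e3]
  refine (abs_add_three _ _ _).trans ?_
  rw [abs_mul, abs_of_nonneg hμ0]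
  gcongr
  have h1 := mul_nonneg hm0 hL0
  have h2 := mul_le_mul_of_nonneg_right hmM hL0
  have h3 := mul_nonneg (sub_nonneg.2 hmμ) hA0
  rw [abs_le]
  constructor <;> linarith

theorem exists_pos_ofReal_le {η : ℝ≥0∞} (hη : 0 < η) : ∃ r : ℝ, 0 < r ∧ ENNReal.ofReal r ≤ η := by
  rcases eq_or_ne η ∞ with rfl | h
  · exact ⟨1, one_pos, le_top⟩
  · exact ⟨η.toReal, ENNReal.toReal_pos hη.ne' h, ENNReal.ofReal_toReal_le⟩

/-- In `abs_collisionTime_sub_le` the first term is handled by `hC` and the last by the weak law for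
|w_i|. The middle one has mean at most κn once the cap and the jump cutoff are large, so Markov's
inequality suffices; no concentration is needed for unbounded gaps. -/
theorem time_lln_of_concentration (hρ : JumpLaw ρ) {z : ℤ → ℝ} (hz : ∀ j, 0 ≤ z j) {μ : ℝ}
    {m : ℕ → ℝ} (hm0 : ∀ M, 0 ≤ m M) (hmM : ∀ M : ℕ, m M ≤ M + 1) (hmμ : ∀ M, m M ≤ μ)
    (hlim : Tendsto m atTop (𝓝 μ))
    (hC : ∀ M R k : ℕ, RapidlyDecaying fun n => pathLaw ρ {w | 1 / ((k : ℝ) + 1) * n ≤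
      |truncTime R (fun j => min (z j) (M + 1)) w n - truncTime R (fun _ => m M) w n|})
    (hT : ∀ M : ℕ, ∀ ε > 0, ∃ B, 0 ≤ B ∧ ∀ N : ℕ, ∑ j ∈ Finset.Icc (-(N : ℤ)) N,
      (z j - min (z j) (M + 1)) ≤ (μ - m M + ε) * (2 * N + 1) + B)
    {ε : ℝ} (hε : 0 < ε) :
    Tendsto (fun n : ℕ => pathLaw ρ
      {w | ε * n ≤ |collisionTime (environment z) w n - μ * meanAbs ρ * n|}) atTop (𝓝 0) := by
  have hμ0 : 0 ≤ μ := (hm0 0).trans (hmμ 0)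
  have hb := hρ.meanAbs_pos
  set mb := meanAbs ρ with hmb
  rw [ENNReal.tendsto_nhds_zero]
  intro η hη
  obtain ⟨r, hr0, hrη⟩ := exists_pos_ofReal_le hη
  -- Markov at threshold εn/3 turns a mean of κn into probability r/3, a third of the tolerated
  -- amount.
  set κ := r * ε / 9 with hκ
  have hκ0 : 0 < κ := by positivity
  -- The cutoffs divide κ as follows: κ/4 for long jumps, κ/8 + κ/4 + κ/4 for the excess of the
  -- gaps, κ/8 for the lowered mean.
  obtain ⟨M, hM⟩ := (hlim.eventually_const_le
    (show μ - κ / (8 * (mb + 1)) < μ by linarith [show 0 < κ / (8 * (mb + 1)) by positivity])).exists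
  obtain ⟨R, hR⟩ := ((tendsto_integral_abs_gt hρ).eventually_le_const
    (show (0 : ℝ) < κ / (8 * ((M : ℝ) + 1)) by positivity)).exists
  obtain ⟨B, hB0, hB⟩ := hT M (κ / (4 * (mb + 1))) (by positivity)
  obtain ⟨k, hk⟩ := exists_nat_one_div_lt (show 0 < ε / 3 by positivity)
  set z' : ℤ → ℝ := fun j => min (z j) (M + 1) with hz'
  have hz'0 : ∀ j, 0 ≤ z' j := fun j => le_min (hz j) (by positivity)
  have hzz : ∀ j, z' j ≤ z j := fun j => min_le_left _ _
  have hd0 : ∀ j, 0 ≤ z j - z' j := fun j => sub_nonneg.2 (hzz j)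
  have ha0 : 0 ≤ μ - m M + κ / (4 * (mb + 1)) :=
    add_nonneg (sub_nonneg.2 (hmμ M)) (by positivity)
  have hev := eventually_lintegral_sum_gapSum_le hρ hd0 ha0 hB0 hB (show 0 < κ / 4 by positivity)
  set L : (ℕ → ℤ) → ℕ → ℝ := fun w n =>
    ∑ i ∈ Finset.range n, (if |w i| ≤ (R : ℤ) then 0 else |(w i : ℝ)|) with hL
  set D : (ℕ → ℤ) → ℕ → ℝ := fun w n =>
    ∑ i ∈ Finset.range n, gapSum (fun j => z j - z' j) (walk w i) (walk w (i + 1)) with hD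
  set A : (ℕ → ℤ) → ℕ → ℝ := fun w n => ∑ i ∈ Finset.range n, |(w i : ℝ)| with hA
  set Y : (ℕ → ℤ) → ℕ → ℝ := fun w n => 2 * (M + 1) * L w n + D w n + (μ - m M) * A w n with hY
  have h3 := (tendsto_measure_sum_abs hρ (show 0 < ε / (3 * (μ + 1)) by positivity)).eventually_le_const
    (show (0 : ℝ≥0∞) < ENNReal.ofReal (r / 3) by simpa using hr0)
  have h1 := (hC M R k).tendsto_zero.eventually_le_const
    (show (0 : ℝ≥0∞) < ENNReal.ofReal (r / 3) by simpa using hr0)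
  filter_upwards [h1, h3, hev, eventually_ge_atTop 1] with n h1 h3 h2 hn
  have hn0 : (0 : ℝ) < n := by exact_mod_cast hn
  have hL0 : ∀ w, 0 ≤ L w n := fun w => Finset.sum_nonneg fun i _ => by split_ifs <;> simp
  have hA0 : ∀ w, 0 ≤ A w n := fun w => Finset.sum_nonneg fun i _ => abs_nonneg _
  have hD0 : ∀ w, 0 ≤ D w n := fun w => Finset.sum_nonneg fun i _ => gapSum_nonneg hd0 _ _
  have hY2 : pathLaw ρ {w | ε / 3 * n ≤ Y w n} ≤ ENNReal.ofReal (r / 3) := by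
    have hLm : Measurable fun w => L w n :=
      measurable_stepSum (fun z : ℤ => if |z| ≤ (R : ℤ) then 0 else |(z : ℝ)|) n
    have hAm : Measurable fun w => A w n := measurable_stepSum (fun z : ℤ => |(z : ℝ)|) n
    have hDm : Measurable fun w => D w n := Finset.measurable_sum _ fun i _ =>
      measurable_walk_pair (gapSum fun j => z j - z' j) i (i + 1)
    have hstep : ∀ g : ℤ → ℝ, (∀ z, 0 ≤ g z) → Integrable g ρ →
        ∫⁻ w, ENNReal.ofReal (∑ i ∈ Finset.range n, g (w i)) ∂pathLaw ρ =
          ENNReal.ofReal (n * ∫ z, g z ∂ρ) := by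
      intro g hg hgi
      simp_rw [ENNReal.ofReal_sum_of_nonneg fun i _ => hg _]
      rw [lintegral_stepSum (fun z => ENNReal.ofReal (g z)), ENNReal.ofReal_mul hn0.le,
        ENNReal.ofReal_natCast, ofReal_integral_eq_lintegral_ofReal hgi (ae_of_all _ hg)]
    have hLi : ∫⁻ w, ENNReal.ofReal (L w n) ∂pathLaw ρ ≤
        ENNReal.ofReal (n * (κ / (8 * ((M : ℝ) + 1)))) := by
      rw [hstep (fun z => if |z| ≤ (R : ℤ) then 0 else |(z : ℝ)|)
        (fun z => by split_ifs <;> simp)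
        (hρ.integrable_abs.mono' (measurable_of_countable _).aestronglyMeasurable
          (ae_of_all _ fun z => by split_ifs <;> simp))]
      exact ENNReal.ofReal_le_ofReal (by gcongr)
    have hAi : ∫⁻ w, ENNReal.ofReal (A w n) ∂pathLaw ρ = ENNReal.ofReal (n * mb) :=
      hstep _ (fun z => abs_nonneg _) hρ.integrable_abs
    have hYi : ∫⁻ w, ENNReal.ofReal (Y w n) ∂pathLaw ρ ≤ ENNReal.ofReal (κ * n) := by
      have hpt : ∀ w, ENNReal.ofReal (Y w n) = ENNReal.ofReal (2 * (M + 1)) * ENNReal.ofReal (L w n) +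
          ENNReal.ofReal (D w n) + ENNReal.ofReal (μ - m M) * ENNReal.ofReal (A w n) := by
        intro w
        have e0 : 0 ≤ μ - m M := sub_nonneg.2 (hmμ M)
        rw [hY, ENNReal.ofReal_add (add_nonneg (mul_nonneg (by positivity) (hL0 w)) (hD0 w))
          (mul_nonneg e0 (hA0 w)), ENNReal.ofReal_add (mul_nonneg (by positivity) (hL0 w)) (hD0 w),
          ENNReal.ofReal_mul (by positivity), ENNReal.ofReal_mul e0]
      simp_rw [hpt]
      rw [lintegral_add_right _ (hAm.ennreal_ofReal.const_mul _),
        lintegral_add_right _ hDm.ennreal_ofReal, lintegral_const_mul _ hLm.ennreal_ofReal,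
        lintegral_const_mul _ hAm.ennreal_ofReal, hAi]
      have e0 : 0 ≤ μ - m M := sub_nonneg.2 (hmμ M)
      calc _ ≤ ENNReal.ofReal (2 * (M + 1)) * ENNReal.ofReal (n * (κ / (8 * ((M : ℝ) + 1)))) +
            ENNReal.ofReal (((μ - m M + κ / (4 * (mb + 1))) * mb + κ / 4) * n) +
            ENNReal.ofReal (μ - m M) * ENNReal.ofReal (n * mb) := by gcongr
        _ = ENNReal.ofReal (2 * (M + 1) * (n * (κ / (8 * ((M : ℝ) + 1)))) +
            ((μ - m M + κ / (4 * (mb + 1))) * mb + κ / 4) * n + (μ - m M) * (n * mb)) := by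
            rw [← ENNReal.ofReal_mul (by positivity), ← ENNReal.ofReal_mul e0,
              ← ENNReal.ofReal_add (by positivity) (by positivity),
              ← ENNReal.ofReal_add (by positivity) (by positivity)]
        _ ≤ _ := by
            refine ENNReal.ofReal_le_ofReal ?_
            have f1 : 2 * ((M : ℝ) + 1) * (n * (κ / (8 * ((M : ℝ) + 1)))) = κ / 4 * n := by
              field_simp; ring
            have f2 : κ / (4 * (mb + 1)) * mb ≤ κ / 4 := by
              rw [div_mul_eq_mul_div, div_le_div_iff₀ (by positivity) (by positivity)]
              nlinarith
            have f3 : (μ - m M) * mb ≤ κ / 8 := by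
              have : μ - m M ≤ κ / (8 * (mb + 1)) := by linarith
              refine (mul_le_mul_of_nonneg_right this hb.le).trans ?_
              rw [div_mul_eq_mul_div, div_le_div_iff₀ (by positivity) (by positivity)]
              nlinarith
            rw [f1]
            nlinarith
    have hmk := mul_meas_ge_le_lintegral (μ := pathLaw ρ)
      (((hLm.const_mul _).add hDm).add (hAm.const_mul _)).ennreal_ofReal (ENNReal.ofReal (ε / 3 * n))
      (f := fun w => ENNReal.ofReal (Y w n))
    have hmk2 := hmk.trans hYi
    have hs : {w | ε / 3 * n ≤ Y w n} ⊆
        {w | ENNReal.ofReal (ε / 3 * n) ≤ ENNReal.ofReal (Y w n)} :=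
      fun w hw => ENNReal.ofReal_le_ofReal hw
    have hpos : 0 < ε / 3 * n := by positivity
    have hne : ENNReal.ofReal (ε / 3 * n) ≠ 0 := by simpa using hpos
    have h4 := (mul_le_mul_right (measure_mono hs) _).trans hmk2
    have h5 : ENNReal.ofReal (κ * n) = ENNReal.ofReal (ε / 3 * n) * ENNReal.ofReal (r / 3) := by
      rw [← ENNReal.ofReal_mul hpos.le]; congr 1; rw [hκ]; ring
    rw [h5] at h4
    exact (ENNReal.mul_le_mul_iff_right hne ENNReal.ofReal_ne_top).1 h4
  have hsub : {w | ε * n ≤ |collisionTime (environment z) w n - μ * mb * n|} ⊆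
      {w | 1 / ((k : ℝ) + 1) * n ≤ |truncTime R z' w n - truncTime R (fun _ => m M) w n|} ∪
      {w | ε / 3 * n ≤ Y w n} ∪
      {w | ε / (3 * (μ + 1)) * n ≤ |∑ i ∈ Finset.range n, |(w i : ℝ)| - mb * n|} := by
    intro w hw
    have hw' : ε * n ≤ |collisionTime (environment z) w n - μ * mb * n| := hw
    by_contra hcon
    simp only [Set.mem_union, Set.mem_ofPred_eq, not_or, not_le] at hcon
    obtain ⟨⟨g1, g2⟩, g3⟩ := hcon
    have hkey := abs_collisionTime_sub_le hz'0 hzz (fun j => min_le_right (z j) _) (hm0 M) (hmM M)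
      (hmμ M) mb R w n
    have g4 : 1 / ((k : ℝ) + 1) * n ≤ ε / 3 * n := by gcongr
    have g5 : μ * |∑ i ∈ Finset.range n, |(w i : ℝ)| - mb * n| ≤ ε / 3 * n := by
      have : (μ + 1) * (ε / (3 * (μ + 1)) * n) = ε / 3 * n := by field_simp
      rw [← this]
      exact mul_le_mul (by linarith) g3.le (abs_nonneg _) (by linarith)
    simp only [hY, hL, hD, hA] at g2
    linarith
  calc _ ≤ ENNReal.ofReal (r / 3) + ENNReal.ofReal (r / 3) + ENNReal.ofReal (r / 3) := by
        refine (measure_mono hsub).trans ((measure_union_le _ _).trans ?_)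
        gcongr
        exact (measure_union_le _ _).trans (add_le_add h1 hY2)
    _ = ENNReal.ofReal r := by
        rw [← ENNReal.ofReal_add (by positivity) (by positivity),
          ← ENNReal.ofReal_add (by positivity) (by positivity)]
        congr 1; ring
    _ ≤ η := hrη

/-- Almost every environment is regular. -/
theorem ae_regularEnvironment (hρ : JumpLaw ρ)
    {Ω : Type*} [MeasurableSpace Ω] {P : Measure Ω} [IsProbabilityMeasure P]
    {ζ : ℤ → Ω → ℝ} (hm : ∀ j, Measurable (ζ j)) (hi : iIndepFun ζ P)
    (hid : ∀ j, IdentDistrib (ζ j) (ζ 0) P P) (hpos : ∀ j, ∀ᵐ a ∂P, 0 < ζ j a)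
    (hint : Integrable (ζ 0) P) :
    ∀ᵐ a ∂P, RegularEnvironment ρ (∫ a, ζ 0 a ∂P) fun j => ζ j a := by
  set μ := ∫ a, ζ 0 a ∂P with hμ
  have hposall : ∀ᵐ a ∂P, ∀ j, 0 < ζ j a := ae_all_iff.2 hpos
  -- A cap of `M + 1` is positive already at `M = 0`; that case supplies the positive mean for the
  -- lower bound on the time.
  set η : ℕ → ℤ → Ω → ℝ := fun M j a => min (ζ j a) (M + 1) with hη
  have hηm : ∀ M j, Measurable (η M j) := fun M j => (hm j).min measurable_const
  have hηb : ∀ (M : ℕ) j, ∀ᵐ a ∂P, η M j a ∈ Set.Icc (0 : ℝ) (M + 1) := fun M j => by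
    filter_upwards [hpos j] with a ha
    exact ⟨le_min ha.le (by positivity), min_le_right _ _⟩
  have hηi : ∀ M, iIndepFun (η M) P := fun M =>
    hi.comp (fun _ x => min x (M + 1)) fun _ => measurable_id.min measurable_const
  have hηid : ∀ M j, IdentDistrib (η M j) (η M 0) P P := fun M j =>
    (hid j).comp (measurable_id.min measurable_const)
  have hηint : ∀ M j, Integrable (η M j) P := fun (M : ℕ) j =>
    Integrable.of_mem_Icc 0 (M + 1) (hηm M j).aemeasurable (hηb M j)
  set m : ℕ → ℝ := fun M => ∫ a, η M 0 a ∂P with hmdef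
  have hmean : ∀ M j, ∫ a, η M j a ∂P = m M := fun M j => (hηid M j).integral_eq
  have hm0 : ∀ M, 0 ≤ m M := fun M => integral_nonneg_of_ae ((hηb M 0).mono fun a ha => ha.1)
  have hmM : ∀ M : ℕ, m M ≤ M + 1 := fun (M : ℕ) => by
    have := integral_mono_ae (hηint M 0) (integrable_const ((M : ℝ) + 1))
      ((hηb M 0).mono fun a ha => ha.2)
    simpa using this
  have hmμ : ∀ M, m M ≤ μ := fun M =>
    integral_mono_ae (hηint M 0) hint (ae_of_all _ fun a => min_le_left _ _)
  have hlim : Tendsto m atTop (𝓝 μ) := by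
    refine tendsto_integral_of_dominated_convergence (fun a => |ζ 0 a|)
      (fun M => (hηm M 0).aestronglyMeasurable) hint.abs (fun M => ?_) (ae_of_all _ fun a => ?_)
    · filter_upwards [hηb M 0] with a ha
      rw [Real.norm_eq_abs, abs_of_nonneg ha.1]
      exact (min_le_left _ _).trans (le_abs_self _)
    · refine tendsto_const_nhds.congr' ?_
      obtain ⟨N, hN⟩ := exists_nat_ge (ζ 0 a)
      filter_upwards [eventually_ge_atTop N] with M hM
      have : (N : ℝ) ≤ M := by exact_mod_cast hM
      exact (min_eq_left (by linarith)).symm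
  have hm1 : 0 < m 0 := by
    refine (integral_pos_iff_support_of_nonneg_ae ((hηb 0 0).mono fun a ha => ha.1)
      (hηint 0 0)).2 ?_
    have : ∀ᵐ a ∂P, a ∈ Function.support (η 0 0) := by
      filter_upwards [hpos 0] with a ha
      exact (lt_min ha (by positivity)).ne'
    refine pos_iff_ne_zero.2 fun h0 => ?_
    obtain ⟨a, ha, ha'⟩ := (this.and (measure_eq_zero_iff_ae_notMem.1 h0)).exists
    exact ha' ha
  -- Tolerances are restricted to 1/(k + 1) so that only countably many null sets are discarded.
  have hconc : ∀ᵐ a ∂P, ∀ M R k : ℕ, RapidlyDecaying fun n => pathLaw ρ {w | 1 / ((k : ℝ) + 1) * n ≤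
      |truncTime R (fun j => η M j a) w n - truncTime R (fun _ => m M) w n|} := by
    refine ae_all_iff.2 fun M => ae_all_iff.2 fun R => ae_all_iff.2 fun k => ?_
    exact ae_rapidlyDecaying_truncTime hρ.symmDecreasing hρ.one_pos (hηm M) (hηi M)
      (show (0 : ℝ) < M + 1 by positivity) (hηb M) (hmean M) R
      (show (0 : ℝ) < 1 / ((k : ℝ) + 1) by positivity)
  have htail : ∀ᵐ a ∂P, ∀ M : ℕ, ∀ ε > 0, ∃ B, 0 ≤ B ∧ ∀ k : ℤ,
      |environment (fun j => ζ j a - η M j a) k - (μ - m M) * k| ≤ ε * |(k : ℝ)| + B := by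
    refine ae_all_iff.2 fun M => ?_
    have h := ae_environment_bound (P := P) (η := fun j a => ζ j a - η M j a)
      (hi.comp (fun _ x => x - min x (M + 1)) fun _ =>
        measurable_id.sub (measurable_id.min measurable_const))
      (fun j => (hid j).comp (u := fun x => x - min x ((M : ℝ) + 1))
        (measurable_id.sub (measurable_id.min measurable_const)))
      (hint.sub (hηint M 0))
    rwa [integral_sub hint (hηint M 0)] at h
  filter_upwards [hposall, hconc, htail, ae_environment_bound hi hid hint] with a h1 h2 h3 h4
  refine ⟨h4, fun ε hε => ?_, ?_⟩
  · refine time_lln_of_concentration hρ (fun j => (h1 j).le) hm0 hmM hmμ hlim h2 ?_ hε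
    intro M ε hε
    obtain ⟨B, hB0, hB⟩ := h3 M ε hε
    exact ⟨2 * B, by linarith, fun N => sum_Icc_le_of_environment_bound hB N⟩
  · exact time_lower_of_concentration hρ (z' := fun j => η 0 j a)
      (fun j => le_min (h1 j).le (by positivity)) (fun j => min_le_left _ _) hm1 (h2 0 1)

end Time

/-! ### Uniform integrability and convergence of moments. -/

section UniformIntegrability

variable {Ξ : Type*} [MeasurableSpace Ξ] {ν : Measure Ξ}

/-- Uniform integrability of the `q`-th moments of a family of real random variables. -/
def MomentUI {ι : Type*} (ν : Measure Ξ) (l : Filter ι) (q : ℝ) (Z : ι → Ξ → ℝ) : Prop :=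
  ∀ ε : ℝ, 0 < ε → ∃ M : ℝ, ∀ᶠ i in l,
    ∫⁻ x, {x | M < |Z i x|}.indicator (fun x => ENNReal.ofReal (|Z i x| ^ q)) x ∂ν ≤
      ENNReal.ofReal ε

/-- If U dominates, then M ≤ Z ≤ 2U, and the factor 2U/M ≥ 1 buys one more power of U at the price
1/M. If B dominates, its q-th power is kept as it is. -/
theorem indicator_rpow_le {q : ℝ} (hq : 0 ≤ q) {M : ℝ≥0∞} (hM0 : M ≠ 0) (hMt : M ≠ ∞)
    {Z U B : ℝ≥0∞} (hZ : Z ≤ U + B) (hMZ : M ≤ Z) :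
    Z ^ q ≤ 2 ^ q * (2 / M * U ^ (q + 1) + B ^ q) := by
  rcases le_total B U with h | h
  · have h1 : Z ≤ 2 * U := hZ.trans (by rw [two_mul]; gcongr)
    have h2 : 1 ≤ 2 / M * U := by
      have h3 : 2 / M * U = 2 * U / M := by simp only [div_eq_mul_inv]; ring
      rw [h3, ENNReal.le_div_iff_mul_le (Or.inl hM0) (Or.inl hMt), one_mul]
      exact hMZ.trans h1
    calc Z ^ q ≤ (2 * U) ^ q := ENNReal.rpow_le_rpow h1 hq
      _ = 2 ^ q * U ^ q * 1 := by rw [ENNReal.mul_rpow_of_nonneg _ _ hq, mul_one]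
      _ ≤ 2 ^ q * U ^ q * (2 / M * U) := by gcongr
      _ = 2 ^ q * (2 / M * U ^ (q + 1)) := by
          rw [ENNReal.rpow_add_of_nonneg _ _ hq zero_le_one, ENNReal.rpow_one]; ring
      _ ≤ _ := by gcongr; exact le_self_add
  · have h1 : Z ≤ 2 * B := hZ.trans (by rw [two_mul]; gcongr)
    calc Z ^ q ≤ (2 * B) ^ q := ENNReal.rpow_le_rpow h1 hq
      _ = 2 ^ q * B ^ q := ENNReal.mul_rpow_of_nonneg _ _ hq
      _ ≤ _ := by gcongr; exact le_add_self

/-- A family dominated by variables with bounded higher moments plus variables with vanishing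
`q`-th moments is uniformly integrable for every exponent up to `q`. -/
theorem momentUI_of_le_add {ι : Type*} {l : Filter ι} {q q' : ℝ} (hq0 : 0 ≤ q) (hq' : q' ≤ q)
    {Z : ι → Ξ → ℝ} {U B : ι → Ξ → ℝ≥0∞} (hU : ∀ i, Measurable (U i))
    {K : ℝ≥0∞} (hK : K ≠ ∞)
    (hle : ∀ᶠ i in l, ∀ x, ENNReal.ofReal |Z i x| ≤ U i x + B i x)
    (hUK : ∀ᶠ i in l, ∫⁻ x, U i x ^ (q + 1) ∂ν ≤ K)
    (hBt : Tendsto (fun i => ∫⁻ x, B i x ^ q ∂ν) l (𝓝 0)) :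
    MomentUI ν l q' Z := by
  intro ε hε
  have h2q : (2 : ℝ≥0∞) ^ q ≠ ∞ := ENNReal.rpow_ne_top_of_nonneg hq0 ENNReal.ofNat_ne_top
  set A : ℝ := (2 ^ q * (2 * K)).toReal with hA
  have hAt : (2 : ℝ≥0∞) ^ q * (2 * K) = ENNReal.ofReal A :=
    (ENNReal.ofReal_toReal (ENNReal.mul_ne_top h2q (ENNReal.mul_ne_top ENNReal.ofNat_ne_top hK))).symm
  have hA0 : 0 ≤ A := ENNReal.toReal_nonneg
  -- Large enough for A/M ≤ ε/2, and at least 1 so that on the tail event the exponent may be raised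
  -- from q' to q.
  set M : ℝ := 1 + 2 * A / ε with hM
  have hM1 : 1 ≤ M := by
    rw [hM]
    have : 0 ≤ 2 * A / ε := by positivity
    linarith
  have hM0 : ENNReal.ofReal M ≠ 0 := by
    simp only [ne_eq, ENNReal.ofReal_eq_zero, not_le]; linarith
  have hBt' : Tendsto (fun i => 2 ^ q * ∫⁻ x, B i x ^ q ∂ν) l (𝓝 0) := by
    have := ENNReal.Tendsto.const_mul hBt (Or.inr h2q)
    rwa [mul_zero] at this
  refine ⟨M, ?_⟩
  filter_upwards [hle, hUK, hBt'.eventually_le_const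
    (show (0 : ℝ≥0∞) < ENNReal.ofReal (ε / 2) by simpa using hε)] with i h1 h2 h3
  have hpt : ∀ x, {x | M < |Z i x|}.indicator (fun x => ENNReal.ofReal (|Z i x| ^ q')) x ≤
      2 ^ q * (2 / ENNReal.ofReal M * U i x ^ (q + 1)) + 2 ^ q * B i x ^ q := by
    intro x
    by_cases hx : x ∈ {x | M < |Z i x|}
    · rw [Set.indicator_of_mem hx, ← mul_add]
      have hx' : M < |Z i x| := hx
      refine le_trans ?_ (indicator_rpow_le hq0 hM0 ENNReal.ofReal_ne_top (h1 x)
        (ENNReal.ofReal_le_ofReal hx'.le))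
      rw [ENNReal.ofReal_rpow_of_nonneg (abs_nonneg _) hq0]
      exact ENNReal.ofReal_le_ofReal (Real.rpow_le_rpow_of_exponent_le (by linarith) hq')
    · rw [Set.indicator_of_notMem hx]; exact zero_le
  have hUm : Measurable fun x => U i x ^ (q + 1) := (hU i).pow_const _
  calc _ ≤ ∫⁻ x, (2 ^ q * (2 / ENNReal.ofReal M * U i x ^ (q + 1)) + 2 ^ q * B i x ^ q) ∂ν :=
        lintegral_mono hpt
    _ = 2 ^ q * (2 / ENNReal.ofReal M * ∫⁻ x, U i x ^ (q + 1) ∂ν) + 2 ^ q * ∫⁻ x, B i x ^ q ∂ν := by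
        rw [lintegral_add_left ((hUm.const_mul _).const_mul _),
          lintegral_const_mul _ (hUm.const_mul _), lintegral_const_mul _ hUm,
          lintegral_const_mul' _ _ h2q]
    _ ≤ 2 ^ q * (2 / ENNReal.ofReal M * K) + ENNReal.ofReal (ε / 2) := by gcongr
    _ = ENNReal.ofReal (A / M) + ENNReal.ofReal (ε / 2) := by
        congr 1
        rw [ENNReal.ofReal_div_of_pos (by linarith), ← hAt]
        simp only [div_eq_mul_inv]
        ring
    _ ≤ ENNReal.ofReal (ε / 2) + ENNReal.ofReal (ε / 2) := by
        refine add_le_add (ENNReal.ofReal_le_ofReal ?_) le_rfl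
        rw [div_le_iff₀ (by linarith), hM]
        have : ε / 2 * (1 + 2 * A / ε) = ε / 2 + A := by field_simp
        linarith
    _ = ENNReal.ofReal ε := by
        rw [← ENNReal.ofReal_add (by positivity) (by positivity)]; congr 1; ring

theorem abs_sub_clamp_le {q : ℝ} (hq : 0 ≤ q) {g : ℝ → ℝ} (hgq : ∀ x, |g x| ≤ |x| ^ q) {M : ℝ}
    (hM : 0 ≤ M) (x : ℝ) : |g x - g (max (-M) (min M x))| ≤
      2 * {x | M < |x|}.indicator (fun x => |x| ^ q) x := by
  by_cases hx : x ∈ {x : ℝ | M < |x|}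
  · rw [Set.indicator_of_mem hx]
    have hx' : M < |x| := hx
    have hy : |max (-M) (min M x)| ≤ |x| := by
      refine le_trans ?_ hx'.le
      rw [abs_le]
      exact ⟨le_max_left _ _, max_le (by linarith) (min_le_left _ _)⟩
    have h1 := hgq (max (-M) (min M x))
    have h2 : |max (-M) (min M x)| ^ q ≤ |x| ^ q := Real.rpow_le_rpow (abs_nonneg _) hy hq
    have h3 := abs_sub (g x) (g (max (-M) (min M x)))
    linarith [hgq x]
  · rw [Set.indicator_of_notMem hx]
    have hx' : |x| ≤ M := not_lt.1 hx
    rw [abs_le] at hx'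
    rw [min_eq_right hx'.2, max_eq_right hx'.1]
    simp

theorem abs_integral_sub_integral_clamp_le {α : Type*} [MeasurableSpace α] (κ : Measure α)
    [IsProbabilityMeasure κ] {q : ℝ} (hq : 0 ≤ q) {g : ℝ → ℝ} (hg : Continuous g)
    (hgq : ∀ x, |g x| ≤ |x| ^ q) {W : α → ℝ} (hW : Measurable W)
    (hWi : Integrable (fun x => |W x| ^ q) κ) {M δ : ℝ} (hM : 0 ≤ M)
    (hδ : ∫ x, {x | M < |W x|}.indicator (fun x => |W x| ^ q) x ∂κ ≤ δ) :
    |∫ x, g (W x) ∂κ - ∫ x, g (max (-M) (min M (W x))) ∂κ| ≤ 2 * δ := by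
  have hset : MeasurableSet {x | M < |W x|} :=
    measurableSet_lt measurable_const (continuous_abs.measurable.comp hW)
  have hgc : Continuous fun x => g (max (-M) (min M x)) :=
    hg.comp (continuous_const.max (continuous_const.min continuous_id))
  have i1 : Integrable (fun x => g (W x)) κ :=
    hWi.mono' (hg.measurable.comp hW).aestronglyMeasurable (ae_of_all _ fun x => hgq _)
  have i2 : Integrable (fun x => g (max (-M) (min M (W x)))) κ := by
    refine Integrable.of_bound (hgc.measurable.comp hW).aestronglyMeasurable (M ^ q)
      (ae_of_all _ fun x => (hgq _).trans (Real.rpow_le_rpow (abs_nonneg _) ?_ hq))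
    rw [abs_le]
    exact ⟨le_max_left _ _, max_le (by linarith) (min_le_left _ _)⟩
  rw [← integral_sub i1 i2]
  refine (abs_integral_le_integral_abs).trans ?_
  have i3 : Integrable (fun x => 2 * {x | M < |W x|}.indicator (fun x => |W x| ^ q) x) κ :=
    (hWi.indicator hset).const_mul 2
  refine (integral_mono (i1.sub i2).abs i3 fun x => ?_).trans ?_
  · refine (abs_sub_clamp_le hq hgq hM (W x)).trans_eq ?_
    simp only [Set.indicator, Set.mem_ofPred_eq]
  · rw [integral_const_mul]
    linarith

/-- Convergence in distribution together with uniform integrability of the `q`-th moments gives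
convergence of the expectation of continuous functions of growth at most `|x| ^ q`. -/
theorem tendsto_integral_of_momentUI [IsProbabilityMeasure ν] {ι : Type*} {l : Filter ι}
    {γ : Measure ℝ} [IsProbabilityMeasure γ] {Z : ι → Ξ → ℝ} (hZm : ∀ i, Measurable (Z i))
    (hZ : TendstoInDistribution Z l id (fun _ => ν) γ) {q : ℝ} (hq : 0 ≤ q)
    (hui : MomentUI ν l q Z) (hγ : Integrable (fun y => |y| ^ q) γ)
    (hint : ∀ᶠ i in l, Integrable (fun x => |Z i x| ^ q) ν)
    {g : ℝ → ℝ} (hg : Continuous g) (hgq : ∀ x, |g x| ≤ |x| ^ q) :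
    Tendsto (fun i => ∫ x, g (Z i x) ∂ν) l (𝓝 (∫ y, g y ∂γ)) := by
  rw [Metric.tendsto_nhds]
  intro ε hε
  obtain ⟨M₁, hM₁⟩ := hui (ε / 8) (by positivity)
  have hγlim : Tendsto (fun n : ℕ => ∫ y, {y : ℝ | (n : ℝ) < |y|}.indicator (fun y => |y| ^ q) y ∂γ)
      atTop (𝓝 0) := by
    have h := tendsto_integral_of_dominated_convergence (μ := γ)
      (F := fun (n : ℕ) y => {y : ℝ | (n : ℝ) < |y|}.indicator (fun y => |y| ^ q) y)
      (f := fun _ => 0) (fun y => |y| ^ q)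
      (fun n => hγ.aestronglyMeasurable.indicator
        (measurableSet_lt measurable_const continuous_abs.measurable)) hγ
      (fun n => ae_of_all _ fun y => ?_) (ae_of_all _ fun y => ?_)
    · simpa using h
    · rw [Real.norm_eq_abs, abs_of_nonneg (Set.indicator_nonneg (fun y _ => by positivity) _)]
      exact Set.indicator_le_self' (fun y _ => by positivity) y
    · refine tendsto_const_nhds.congr' ?_
      obtain ⟨N, hN⟩ := exists_nat_ge |y|
      filter_upwards [eventually_ge_atTop N] with n hn
      have : (N : ℝ) ≤ n := by exact_mod_cast hn
      rw [Set.indicator_of_notMem]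
      simp only [Set.mem_ofPred_eq, not_lt]
      linarith
  obtain ⟨N₁, hN₁⟩ := exists_nat_ge M₁
  obtain ⟨N, hN, hNM⟩ := ((hγlim.eventually_le_const (show (0 : ℝ) < ε / 8 by positivity)).and
    (eventually_ge_atTop N₁)).exists
  have hNM' : M₁ ≤ N := hN₁.trans (by exact_mod_cast hNM)
  have hN0 : (0 : ℝ) ≤ N := Nat.cast_nonneg N
  -- Clamping the argument of g to [-N, N] gives an admissible test function. Clamping costs ε/4 for
  -- each of the two laws and weak convergence another ε/4.
  let f : BoundedContinuousFunction ℝ ℝ := BoundedContinuousFunction.ofNormedAddCommGroup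
    (fun x => g (max (-(N : ℝ)) (min N x)))
    (hg.comp (continuous_const.max (continuous_const.min continuous_id))) ((N : ℝ) ^ q)
    (fun x => (hgq _).trans (Real.rpow_le_rpow (abs_nonneg _)
      (abs_le.2 ⟨le_max_left _ _, max_le (by linarith) (min_le_left _ _)⟩) hq))
  have hweak := (ProbabilityMeasure.tendsto_iff_forall_integral_tendsto.1 hZ.tendsto) f
  simp only [ProbabilityMeasure.coe_mk, Measure.map_id] at hweak
  have e1 : ∀ i, ∫ y, f y ∂(Measure.map (Z i) ν) = ∫ x, g (max (-(N : ℝ)) (min N (Z i x))) ∂ν :=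
    fun i => integral_map (hZm i).aemeasurable f.continuous.aestronglyMeasurable
  simp only [e1] at hweak
  have hγN := abs_integral_sub_integral_clamp_le γ hq hg hgq (W := fun y => y) measurable_id hγ hN0 hN
  filter_upwards [hM₁, hint, Metric.tendsto_nhds.1 hweak (ε / 4) (by positivity)] with i h1 h2 h3
  have hset : ∀ M : ℝ, MeasurableSet {x | M < |Z i x|} := fun M =>
    measurableSet_lt measurable_const (continuous_abs.measurable.comp (hZm i))
  have hZN : ∫ x, {x | (N : ℝ) < |Z i x|}.indicator (fun x => |Z i x| ^ q) x ∂ν ≤ ε / 8 := by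
    rw [integral_eq_lintegral_of_nonneg_ae
      (ae_of_all _ fun x => Set.indicator_nonneg (fun y _ => by positivity) _)
      (h2.indicator (hset N)).aestronglyMeasurable]
    refine ENNReal.toReal_le_of_le_ofReal (by positivity) (le_trans ?_ h1)
    refine lintegral_mono fun x => ?_
    by_cases hx : x ∈ {x | (N : ℝ) < |Z i x|}
    · have hx2 : x ∈ {x | M₁ < |Z i x|} := lt_of_le_of_lt hNM' hx
      rw [Set.indicator_of_mem hx, Set.indicator_of_mem hx2]
    · rw [Set.indicator_of_notMem hx]; simp
  have h4 := abs_integral_sub_integral_clamp_le ν hq hg hgq (hZm i) h2 hN0 hZN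
  rw [Real.dist_eq] at h3 ⊢
  have h5 : ∫ y, f y ∂γ = ∫ y, g (max (-(N : ℝ)) (min N y)) ∂γ := rfl
  rw [h5] at h3
  rw [abs_lt] at h3 ⊢
  rw [abs_le] at h4 hγN
  constructor <;> linarith

end UniformIntegrability

/-! ### Moments of the walk: small steps and large jumps. -/

section WalkMoments

variable {ρ : Measure ℤ} [IsProbabilityMeasure ρ]

theorem JumpLaw.map_neg (hρ : JumpLaw ρ) : ρ.map (fun z => -z) = ρ := by
  refine Measure.ext_of_singleton fun z => ?_
  rw [Measure.map_apply (measurable_of_countable _) (measurableSet_singleton z)]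
  have h1 : (fun z : ℤ => -z) ⁻¹' {z} = {-z} := by
    ext y; simp only [Set.mem_preimage, Set.mem_singleton_iff]; omega
  have h2 := hρ.symmDecreasing.symm z
  rw [h1]
  exact (measureReal_eq_measureReal_iff).1 h2

theorem JumpLaw.integral_eq_zero_of_odd (hρ : JumpLaw ρ) {φ : ℤ → ℝ} (h : ∀ z, φ (-z) = -φ z) :
    ∫ z, φ z ∂ρ = 0 := by
  have h1 : ∫ z, φ z ∂ρ = ∫ z, φ (-z) ∂ρ := by
    conv_lhs => rw [← hρ.map_neg]
    exact integral_map (measurable_of_countable _).aemeasurable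
      (measurable_of_countable φ).aestronglyMeasurable
  simp only [h, integral_neg] at h1
  linarith

theorem JumpLaw.integrable_cast (hρ : JumpLaw ρ) : Integrable (fun z : ℤ => (z : ℝ)) ρ :=
  hρ.integrable_abs.mono' (measurable_of_countable _).aestronglyMeasurable
    (ae_of_all _ fun _ => le_rfl)

/-- The step of the walk, discarded if it is larger than `√m`. -/
noncomputable def smallStep (m : ℕ) (z : ℤ) : ℝ := if |(z : ℝ)| ≤ √m then z else 0

theorem abs_smallStep_le (m : ℕ) (z : ℤ) : |smallStep m z| ≤ √m := by
  unfold smallStep; split_ifs with h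
  · exact h
  · simp

theorem abs_smallStep_le_abs (m : ℕ) (z : ℤ) : |smallStep m z| ≤ |(z : ℝ)| := by
  unfold smallStep; split_ifs with h
  · exact le_rfl
  · simp

/-- The running maximum up to time `m` of the walk with small steps only, in diffusive units. -/
noncomputable def maxSmall (m : ℕ) (w : ℕ → ℤ) : ℝ :=
  (Finset.range (m + 1)).sup' Finset.nonempty_range_add_one
    fun k => |∑ i ∈ Finset.range k, smallStep m (w i)| / √m

theorem le_maxSmall {m k : ℕ} (hk : k ≤ m) (w : ℕ → ℤ) :
    |∑ i ∈ Finset.range k, smallStep m (w i)| / √m ≤ maxSmall m w :=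
  Finset.le_sup' (fun k => |∑ i ∈ Finset.range k, smallStep m (w i)| / √m)
    (Finset.mem_range.2 (by omega))

theorem maxSmall_nonneg (m : ℕ) (w : ℕ → ℤ) : 0 ≤ maxSmall m w :=
  le_trans (by positivity) (le_maxSmall (Nat.zero_le m) w)

theorem measurable_maxSmall (m : ℕ) : Measurable (maxSmall m) := by
  unfold maxSmall
  exact Finset.measurable_range_sup'' fun k _ =>
    (continuous_abs.measurable.comp (measurable_stepSum (smallStep m) k)).div_const _

/-- Take h = 1/√m in `exp_maximal`: the cut at √m gives |hφ| ≤ 1, symmetry keeps the cut steps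
centered, and (1 + v/m)^m ≤ e^v. The tail is exponential uniformly in m, so all moments are bounded.
-/
theorem measure_le_maxSmall (hρ : JumpLaw ρ) {m : ℕ} (hm : 1 ≤ m) (r : ℝ) :
    pathLaw ρ {w | r ≤ maxSmall m w} ≤
      2 * ENNReal.ofReal (Real.exp (∫ z : ℤ, (z : ℝ) ^ 2 ∂ρ) * Real.exp (-r)) := by
  set v := ∫ z : ℤ, (z : ℝ) ^ 2 ∂ρ with hv
  have hm0 : (0 : ℝ) < m := by exact_mod_cast hm
  have hs : 0 < √(m : ℝ) := Real.sqrt_pos.2 hm0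
  have hv0 : 0 ≤ v := integral_nonneg fun z => sq_nonneg _
  have hi : Integrable (smallStep m) ρ :=
    hρ.integrable_abs.mono' (measurable_of_countable _).aestronglyMeasurable
      (ae_of_all _ fun z => abs_smallStep_le_abs m z)
  have hsq : ∀ z, smallStep m z ^ 2 ≤ (z : ℝ) ^ 2 := fun z => sq_le_sq.2 (abs_smallStep_le_abs m z)
  have hi2 : Integrable (fun z => smallStep m z ^ 2) ρ :=
    hρ.integrable_sq.mono' (measurable_of_countable _).aestronglyMeasurable
      (ae_of_all _ fun z => by
        rw [Real.norm_eq_abs, abs_of_nonneg (sq_nonneg _)]; exact hsq z)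
  have h := exp_maximal ρ (φ := smallStep m) (v := v) (h := 1 / √m) (by positivity)
    (fun z => by
      rw [abs_mul, abs_of_pos (by positivity), one_div, inv_mul_le_iff₀ hs, mul_one]
      exact abs_smallStep_le m z) hi
    (hρ.integral_eq_zero_of_odd fun z => by
      unfold smallStep; push_cast; rw [abs_neg]; split_ifs <;> simp) hi2
    (integral_mono hi2 hρ.integrable_sq hsq) (r * √m) m
  refine le_trans (measure_mono fun w hw => ?_) (h.trans ?_)
  · obtain ⟨k, hk, hke⟩ := Finset.exists_mem_eq_sup' (s := Finset.range (m + 1))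
      Finset.nonempty_range_add_one fun k => |∑ i ∈ Finset.range k, smallStep m (w i)| / √m
    refine ⟨k, by simpa [Nat.lt_succ_iff] using hk, ?_⟩
    have hw' : r ≤ maxSmall m w := hw
    rw [maxSmall, hke, le_div_iff₀ hs] at hw'
    exact hw'
  · gcongr 2 * ENNReal.ofReal ?_
    have e1 : 1 / √(m : ℝ) * (r * √m) = r := by field_simp
    have e2 : (1 / √(m : ℝ)) ^ 2 * v = v / m := by
      rw [div_pow, Real.sq_sqrt hm0.le]; ring
    rw [e1, e2, mul_comm]
    gcongr
    calc (1 + v / m) ^ m ≤ Real.exp (v / m) ^ m := by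
          gcongr; linarith [Real.add_one_le_exp (v / m)]
      _ = Real.exp v := by rw [← Real.exp_nat_mul]; congr 1; field_simp

theorem lintegral_one_add_rpow_le_tsum {Ξ : Type*} [MeasurableSpace Ξ] {ν : Measure Ξ} {V : Ξ → ℝ}
    (hV : Measurable V) (h0 : ∀ x, 0 ≤ V x) {s : ℝ} (hs : 0 ≤ s) :
    ∫⁻ x, ENNReal.ofReal (1 + V x) ^ s ∂ν ≤
      ∑' j : ℕ, ENNReal.ofReal (j + 2) ^ s * ν {x | (j : ℝ) ≤ V x} := by
  have hset : ∀ j : ℕ, MeasurableSet {x | (j : ℝ) ≤ V x} := fun j =>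
    measurableSet_le measurable_const hV
  have e : ∀ j : ℕ, ENNReal.ofReal (j + 2) ^ s * ν {x | (j : ℝ) ≤ V x} =
      ∫⁻ x, {x | (j : ℝ) ≤ V x}.indicator (fun _ => ENNReal.ofReal (j + 2) ^ s) x ∂ν := fun j => by
    rw [lintegral_indicator_const (hset j)]
  simp only [e]
  rw [← lintegral_tsum fun j => (measurable_const.indicator (hset j)).aemeasurable]
  refine lintegral_mono fun x => ?_
  refine le_trans ?_ (ENNReal.le_tsum ⌊V x⌋₊)
  have hx : x ∈ {y | ((⌊V x⌋₊ : ℕ) : ℝ) ≤ V y} := Nat.floor_le (h0 x)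
  rw [Set.indicator_of_mem hx]
  refine ENNReal.rpow_le_rpow (ENNReal.ofReal_le_ofReal ?_) hs
  linarith [Nat.lt_floor_add_one (V x)]

theorem exists_lintegral_maxSmall_le (hρ : JumpLaw ρ) {s : ℝ} (hs : 0 ≤ s) :
    ∃ K : ℝ≥0∞, K ≠ ∞ ∧ ∀ m : ℕ, 1 ≤ m →
      ∫⁻ w, ENNReal.ofReal (1 + maxSmall m w) ^ s ∂pathLaw ρ ≤ K := by
  set v := ∫ z : ℤ, (z : ℝ) ^ 2 ∂ρ with hv
  obtain ⟨N, hN⟩ := exists_nat_ge s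
  have hsum : Summable fun j : ℕ => ((j : ℝ) + 2) ^ N * (Real.exp v * Real.exp (-j)) := by
    have h := (summable_nat_add_iff 2).2 (Real.summable_pow_mul_exp_neg_nat_mul N (r := 1) one_pos)
    refine (h.mul_left (Real.exp v * Real.exp 2)).congr fun j => ?_
    push_cast
    rw [show -1 * ((j : ℝ) + 2) = -j + -2 by ring, Real.exp_add]
    have : Real.exp 2 * Real.exp (-2) = 1 := by rw [← Real.exp_add]; simp
    linear_combination ((j : ℝ) + 2) ^ N * Real.exp v * Real.exp (-j) * this
  refine ⟨2 * ENNReal.ofReal (∑' j : ℕ, ((j : ℝ) + 2) ^ N * (Real.exp v * Real.exp (-j))),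
    by finiteness, fun m hm => ?_⟩
  refine (lintegral_one_add_rpow_le_tsum (measurable_maxSmall m) (maxSmall_nonneg m) hs).trans ?_
  rw [ENNReal.ofReal_tsum_of_nonneg (fun j => by positivity) hsum, ← ENNReal.tsum_mul_left]
  refine ENNReal.tsum_le_tsum fun j => ?_
  calc _ ≤ ENNReal.ofReal (j + 2) ^ s * (2 * ENNReal.ofReal (Real.exp v * Real.exp (-j))) := by
        gcongr; exact measure_le_maxSmall hρ hm j
    _ ≤ ENNReal.ofReal ((j + 2) ^ N) * (2 * ENNReal.ofReal (Real.exp v * Real.exp (-j))) := by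
        gcongr
        rw [ENNReal.ofReal_rpow_of_nonneg (by positivity) hs]
        refine ENNReal.ofReal_le_ofReal ?_
        rw [← Real.rpow_natCast]
        exact Real.rpow_le_rpow_of_exponent_le (by linarith [(Nat.cast_nonneg j : (0:ℝ) ≤ j)]) hN
    _ = _ := by
        rw [ENNReal.ofReal_mul (p := ((j : ℝ) + 2) ^ N) (by positivity)]; ring

/-- The step of the walk, capped at `T`, in diffusive units, if it is larger than `√m`. -/
noncomputable def bigJump (m : ℕ) (T : ℝ≥0∞) (z : ℤ) : ℝ≥0∞ :=
  if √m < |(z : ℝ)| then min (ENNReal.ofReal |(z : ℝ)|) T / ENNReal.ofReal √m else 0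

/-- The dichotomy demanded by `lintegral_sum_rpow_le`; a cap below √m would destroy it. -/
theorem bigJump_eq_zero_or {m : ℕ} (hm : 1 ≤ m) {T : ℝ≥0∞} (hT : ENNReal.ofReal √m ≤ T) (z : ℤ) :
    bigJump m T z = 0 ∨ 1 ≤ bigJump m T z := by
  have hm0 : (0 : ℝ) < m := by exact_mod_cast hm
  have hs : 0 < √(m : ℝ) := Real.sqrt_pos.2 hm0
  unfold bigJump
  split_ifs with h
  · right
    rw [ENNReal.le_div_iff_mul_le (Or.inl (by simpa using hs)) (Or.inl ENNReal.ofReal_ne_top), one_mul]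
    exact le_min (ENNReal.ofReal_le_ofReal h.le) hT
  · exact Or.inl rfl

theorem min_sum_le {ι : Type*} (s : Finset ι) (f : ι → ℝ≥0∞) (T : ℝ≥0∞) :
    min (∑ i ∈ s, f i) T ≤ ∑ i ∈ s, min (f i) T := by
  classical
  induction s using Finset.induction_on with
  | empty => simp
  | insert i s hi ih =>
    rw [Finset.sum_insert hi, Finset.sum_insert hi]
    refine le_trans ?_ (add_le_add_right ih _)
    rcases le_total (f i) T with h1 | h1
    · rw [min_eq_left h1, ← min_add_add_left]
      exact min_le_min le_rfl le_add_self
    · rw [min_eq_right h1]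
      exact (min_le_right _ _).trans le_self_add

/-- Split every step at √m. Capping is subadditive, so the cap passes to the individual large jumps
while the small-step part stays uncapped. The right side does not depend on k, as is needed for a
random number of collisions. -/
theorem min_abs_walk_le {m k : ℕ} (hm : 1 ≤ m) (hk : k ≤ m) (T : ℝ≥0∞) (w : ℕ → ℤ) :
    min (ENNReal.ofReal |(walk w k : ℝ)|) T ≤ ENNReal.ofReal √m *
      (ENNReal.ofReal (maxSmall m w) + ∑ i ∈ Finset.range m, bigJump m T (w i)) := by
  have hm0 : (0 : ℝ) < m := by exact_mod_cast hm
  have hs : 0 < √(m : ℝ) := Real.sqrt_pos.2 hm0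
  have hbig : ∀ z : ℤ, min (ENNReal.ofReal |(z : ℝ) - smallStep m z|) T ≤
      ENNReal.ofReal √m * bigJump m T z := by
    intro z
    unfold bigJump smallStep
    rcases le_or_gt |(z : ℝ)| √m with h | h
    · simp [h]
    · rw [if_neg (not_le.2 h), if_pos h, sub_zero,
        ENNReal.mul_div_cancel (by simpa using hs) ENNReal.ofReal_ne_top]
  have hsplit : |(walk w k : ℝ)| ≤ |∑ i ∈ Finset.range k, smallStep m (w i)| +
      ∑ i ∈ Finset.range k, |(w i : ℝ) - smallStep m (w i)| := by
    have e : (walk w k : ℝ) = ∑ i ∈ Finset.range k, smallStep m (w i) +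
        ∑ i ∈ Finset.range k, ((w i : ℝ) - smallStep m (w i)) := by
      rw [← Finset.sum_add_distrib, walk]; push_cast
      exact Finset.sum_congr rfl fun i _ => by ring
    rw [e]
    exact (abs_add_le _ _).trans (add_le_add_right (Finset.abs_sum_le_sum_abs _ _) _)
  calc min (ENNReal.ofReal |(walk w k : ℝ)|) T
      ≤ min (ENNReal.ofReal |∑ i ∈ Finset.range k, smallStep m (w i)| +
          ∑ i ∈ Finset.range k, ENNReal.ofReal |(w i : ℝ) - smallStep m (w i)|) T := by
        refine min_le_min ?_ le_rfl
        rw [← ENNReal.ofReal_sum_of_nonneg fun i _ => abs_nonneg _,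
          ← ENNReal.ofReal_add (abs_nonneg _) (Finset.sum_nonneg fun i _ => abs_nonneg _)]
        exact ENNReal.ofReal_le_ofReal hsplit
    _ ≤ ENNReal.ofReal |∑ i ∈ Finset.range k, smallStep m (w i)| +
          min (∑ i ∈ Finset.range k, ENNReal.ofReal |(w i : ℝ) - smallStep m (w i)|) T := by
        rw [← min_add_add_left]
        exact min_le_min le_rfl le_add_self
    _ ≤ ENNReal.ofReal √m * ENNReal.ofReal (maxSmall m w) +
          ENNReal.ofReal √m * ∑ i ∈ Finset.range m, bigJump m T (w i) := by
        refine add_le_add ?_ ?_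
        · rw [← ENNReal.ofReal_mul hs.le]
          refine ENNReal.ofReal_le_ofReal ?_
          have := le_maxSmall hk w
          rwa [div_le_iff₀' hs] at this
        · refine (min_sum_le _ _ _).trans ?_
          rw [Finset.mul_sum]
          refine (Finset.sum_le_sum fun i _ => hbig (w i)).trans ?_
          exact Finset.sum_le_sum_of_subset (Finset.range_subset_range.2 hk)
    _ = _ := by rw [mul_add]

theorem one_add_pow_le_ofReal_exp {a : ℝ≥0∞} {m : ℕ} (h : m * a ≠ ∞) :
    (1 + a) ^ m ≤ ENNReal.ofReal (Real.exp (m * a).toReal) := by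
  rcases Nat.eq_zero_or_pos m with rfl | hm
  · simp
  have ha : a ≠ ∞ := by
    rintro rfl
    exact h (ENNReal.mul_top (by exact_mod_cast hm.ne'))
  lift a to ℝ≥0 using ha
  have e : (1 + (a : ℝ≥0∞)) = ENNReal.ofReal (1 + a) := by
    rw [ENNReal.ofReal_add zero_le_one a.coe_nonneg]; simp
  rw [e, ← ENNReal.ofReal_pow (by positivity)]
  refine ENNReal.ofReal_le_ofReal ?_
  have e2 : (m * (a : ℝ≥0∞)).toReal = m * (a : ℝ) := by simp
  rw [e2, Real.exp_nat_mul]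
  gcongr
  linarith [Real.add_one_le_exp (a : ℝ)]

/-- By `lintegral_sum_rpow_le` the q-th moment of the sum is at most exp(2^q m E[b^q]) - 1, which
vanishes together with its exponent. -/
theorem tendsto_lintegral_sum_rpow {ι : Type*} {l : Filter ι} {b : ι → ℤ → ℝ≥0∞} {m : ι → ℕ}
    (hb : ∀ᶠ i in l, ∀ z, b i z = 0 ∨ 1 ≤ b i z) {q : ℝ} (hq : 1 ≤ q)
    (h : Tendsto (fun i => m i * ∫⁻ z, b i z ^ q ∂ρ) l (𝓝 0)) :
    Tendsto (fun i => ∫⁻ w, (∑ j ∈ Finset.range (m i), b i (w j)) ^ q ∂pathLaw ρ) l (𝓝 0) := by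
  have h2q : (2 : ℝ≥0∞) ^ q ≠ ∞ := ENNReal.rpow_ne_top_of_nonneg (by linarith) ENNReal.ofNat_ne_top
  have h1 : Tendsto (fun i => m i * (2 ^ q * ∫⁻ z, b i z ^ q ∂ρ)) l (𝓝 0) := by
    have := ENNReal.Tendsto.const_mul h (Or.inr h2q)
    rw [mul_zero] at this
    refine this.congr fun i => by ring
  have h2 : Tendsto (fun i => ENNReal.ofReal
      (Real.exp (m i * (2 ^ q * ∫⁻ z, b i z ^ q ∂ρ)).toReal - 1)) l (𝓝 0) := by
    have := (ENNReal.tendsto_toReal ENNReal.zero_ne_top).comp h1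
    have h3 := ((Real.continuous_exp.sub (continuous_const (y := (1 : ℝ)))).tendsto _).comp this
    have h4 := ENNReal.tendsto_ofReal h3
    simpa [Function.comp_def] using h4
  refine tendsto_of_tendsto_of_tendsto_of_le_of_le' tendsto_const_nhds h2
    (Eventually.of_forall fun i => zero_le) ?_
  filter_upwards [hb, h1.eventually_lt_const ENNReal.zero_lt_top] with i hi hlt
  have h5 := (lintegral_sum_rpow_le ρ hi hq (m i)).trans (one_add_pow_le_ofReal_exp hlt.ne)
  rw [ENNReal.ofReal_sub _ zero_le_one, ENNReal.ofReal_one]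
  exact ENNReal.le_sub_of_add_le_right ENNReal.one_ne_top h5

/-- For q ≥ 2 one has m ≤ (√m)^q, so the normalisation cancels the number of steps and the tail of a
convergent q-th moment remains. -/
theorem tendsto_natCast_mul_lintegral_bigJump {q : ℝ} (hq : 2 ≤ q)
    (hfin : ∫⁻ z : ℤ, ENNReal.ofReal |(z : ℝ)| ^ q ∂ρ ≠ ∞) (T : ℕ → ℝ≥0∞) :
    Tendsto (fun m : ℕ => m * ∫⁻ z, bigJump m (T m) z ^ q ∂ρ) atTop (𝓝 0) := by
  have hlim : Tendsto (fun m : ℕ => ∫⁻ z : ℤ,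
      {z : ℤ | √m < |(z : ℝ)|}.indicator (fun z : ℤ => ENNReal.ofReal |(z : ℝ)| ^ q) z ∂ρ)
      atTop (𝓝 0) := by
    have h := tendsto_lintegral_of_dominated_convergence (μ := ρ)
      (F := fun (m : ℕ) (z : ℤ) => {z : ℤ | √m < |(z : ℝ)|}.indicator
        (fun z : ℤ => ENNReal.ofReal |(z : ℝ)| ^ q) z)
      (f := fun _ => 0) (fun z : ℤ => ENNReal.ofReal |(z : ℝ)| ^ q)
      (fun m => measurable_of_countable _)
      (fun m => ae_of_all _ fun z => Set.indicator_le_self _ _ _) hfin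
      (ae_of_all _ fun z => ?_)
    · simpa using h
    · refine tendsto_const_nhds.congr' ?_
      obtain ⟨N, hN⟩ := exists_nat_ge (|(z : ℝ)| ^ 2)
      filter_upwards [eventually_ge_atTop N] with m hm
      rw [Set.indicator_of_notMem]
      simp only [Set.mem_ofPred_eq, not_lt]
      exact Real.le_sqrt_of_sq_le (hN.trans (by exact_mod_cast hm))
  refine tendsto_of_tendsto_of_tendsto_of_le_of_le' tendsto_const_nhds hlim
    (Eventually.of_forall fun i => zero_le) ?_
  filter_upwards [eventually_ge_atTop 1] with m hm
  rw [← lintegral_const_mul _ (measurable_of_countable _)]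
  refine lintegral_mono fun z => ?_
  have hm1 : (1 : ℝ) ≤ m := by exact_mod_cast hm
  have hs : 0 < √(m : ℝ) := Real.sqrt_pos.2 (by linarith)
  unfold bigJump
  rcases le_or_gt |(z : ℝ)| √m with h | h
  · rw [if_neg (not_lt.2 h), ENNReal.zero_rpow_of_pos (by linarith), mul_zero]
    exact zero_le
  · have hz : z ∈ {z : ℤ | √m < |(z : ℝ)|} := h
    rw [if_pos h, Set.indicator_of_mem hz]
    have hb : (m : ℝ≥0∞) ≤ ENNReal.ofReal √m ^ q := by
      rw [ENNReal.ofReal_rpow_of_nonneg hs.le (by linarith), ← ENNReal.ofReal_natCast]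
      refine ENNReal.ofReal_le_ofReal ?_
      calc (m : ℝ) = √m ^ (2 : ℝ) := by
            rw [Real.rpow_two, Real.sq_sqrt (by linarith)]
        _ ≤ √m ^ q := Real.rpow_le_rpow_of_exponent_le (Real.one_le_sqrt.2 hm1) hq
    calc (m : ℝ≥0∞) * (min (ENNReal.ofReal |(z : ℝ)|) (T m) / ENNReal.ofReal √m) ^ q
        ≤ ENNReal.ofReal √m ^ q * (ENNReal.ofReal |(z : ℝ)| / ENNReal.ofReal √m) ^ q := by
          gcongr
          exact min_le_left _ _
      _ = ENNReal.ofReal |(z : ℝ)| ^ q := by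
          rw [← ENNReal.mul_rpow_of_nonneg _ _ (by linarith),
            ENNReal.mul_div_cancel (by simpa using hs) ENNReal.ofReal_ne_top]

/-- The cap trades moments for powers of m: min(|z|, Dm)^q ≤ |z|^r (Dm)^(q - r). In all, m enters
with exponent 1 + (q - r) - q/2, negative exactly when r > 1 + q/2. -/
theorem tendsto_natCast_mul_lintegral_bigJump_of_lt {κ : Measure ℤ} {q r D : ℝ} (hD : 1 ≤ D) (hr : 1 + q / 2 < r)
    (hrq : r < q) (hfin : ∫⁻ z : ℤ, ENNReal.ofReal |(z : ℝ)| ^ r ∂κ ≠ ∞) :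
    Tendsto (fun m : ℕ => m * ∫⁻ z, bigJump m (ENNReal.ofReal (D * m)) z ^ q ∂κ) atTop (𝓝 0) := by
  have hq : 0 < q := by linarith
  have hlim : Tendsto (fun m : ℕ => ENNReal.ofReal (D ^ (q - r) * (m : ℝ) ^ (-(r - 1 - q / 2))) *
      ∫⁻ z : ℤ, ENNReal.ofReal |(z : ℝ)| ^ r ∂κ) atTop (𝓝 0) := by
    have h1 : Tendsto (fun m : ℕ => D ^ (q - r) * (m : ℝ) ^ (-(r - 1 - q / 2))) atTop (𝓝 0) := by
      have := ((tendsto_rpow_neg_atTop (y := r - 1 - q / 2) (by linarith)).comp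
        tendsto_natCast_atTop_atTop).const_mul (D ^ (q - r))
      rwa [mul_zero] at this
    have h2 := ENNReal.Tendsto.mul_const (ENNReal.tendsto_ofReal h1) (Or.inr hfin)
    simpa using h2
  refine tendsto_of_tendsto_of_tendsto_of_le_of_le' tendsto_const_nhds hlim
    (Eventually.of_forall fun i => zero_le) ?_
  filter_upwards [eventually_ge_atTop 1] with m hm
  rw [← lintegral_const_mul _ (measurable_of_countable _),
    ← lintegral_const_mul _ (measurable_of_countable _)]
  refine lintegral_mono fun z => ?_
  have hm1 : (1 : ℝ) ≤ m := by exact_mod_cast hm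
  have hm0 : (0 : ℝ) < m := by linarith
  have hs : 0 < √(m : ℝ) := Real.sqrt_pos.2 (by linarith)
  unfold bigJump
  rcases le_or_gt |(z : ℝ)| √m with h | h
  · rw [if_neg (not_lt.2 h), ENNReal.zero_rpow_of_pos hq, mul_zero]
    exact zero_le
  · rw [if_pos h]
    have hz : 0 < |(z : ℝ)| := hs.trans h
    set y := min |(z : ℝ)| (D * m) with hy
    have hy0 : 0 < y := lt_min hz (by positivity)
    have e1 : min (ENNReal.ofReal |(z : ℝ)|) (ENNReal.ofReal (D * m)) = ENNReal.ofReal y := by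
      rw [hy, ENNReal.ofReal_min]
    rw [e1, ← ENNReal.ofReal_div_of_pos hs, ENNReal.ofReal_rpow_of_nonneg (by positivity) hq.le,
      ENNReal.ofReal_rpow_of_nonneg hz.le (by linarith), ← ENNReal.ofReal_natCast,
      ← ENNReal.ofReal_mul (by positivity), ← ENNReal.ofReal_mul (by positivity)]
    refine ENNReal.ofReal_le_ofReal ?_
    have e2 : (y / √m) ^ q = y ^ q * (m : ℝ) ^ (-(q / 2)) := by
      rw [Real.div_rpow hy0.le hs.le, Real.sqrt_eq_rpow, ← Real.rpow_mul hm0.le, Real.rpow_neg hm0.le,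
        div_eq_mul_inv]
      congr 3; ring
    have e3 : y ^ q ≤ |(z : ℝ)| ^ r * (D ^ (q - r) * (m : ℝ) ^ (q - r)) := by
      rw [← Real.mul_rpow (by linarith) hm0.le]
      calc y ^ q = y ^ r * y ^ (q - r) := by rw [← Real.rpow_add hy0]; congr 1; ring
        _ ≤ _ := by
          have h1 : y ^ r ≤ |(z : ℝ)| ^ r :=
            Real.rpow_le_rpow hy0.le (min_le_left _ _) (by linarith)
          have h2 : y ^ (q - r) ≤ (D * m) ^ (q - r) :=
            Real.rpow_le_rpow hy0.le (min_le_right _ _) (by linarith)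
          gcongr
    have e4 : (m : ℝ) * ((m : ℝ) ^ (q - r) * (m : ℝ) ^ (-(q / 2))) =
        (m : ℝ) ^ (-(r - 1 - q / 2)) := by
      nth_rewrite 1 [← Real.rpow_one (m : ℝ)]
      rw [← Real.rpow_add hm0, ← Real.rpow_add hm0]; congr 1; ring
    calc (m : ℝ) * (y / √m) ^ q ≤
          m * ((|(z : ℝ)| ^ r * (D ^ (q - r) * (m : ℝ) ^ (q - r))) * (m : ℝ) ^ (-(q / 2))) := by
          rw [e2]; gcongr
      _ = D ^ (q - r) * (m * ((m : ℝ) ^ (q - r) * (m : ℝ) ^ (-(q / 2)))) * |(z : ℝ)| ^ r := by ring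
      _ = _ := by rw [e4]

/-- The jumps have a finite moment of order `q`, or of order less than but close to `q`. -/
def NearMoment (ρ : Measure ℤ) (q : ℝ) : Prop :=
  ∫⁻ z : ℤ, ENNReal.ofReal |(z : ℝ)| ^ q ∂ρ ≠ ∞ ∨
    ∃ r, 1 + q / 2 < r ∧ r < q ∧ ∫⁻ z : ℤ, ENNReal.ofReal |(z : ℝ)| ^ r ∂ρ ≠ ∞

theorem NearMoment.tendsto {q D : ℝ} (h : NearMoment ρ q) (hq : 2 ≤ q) (hD : 1 ≤ D) :
    Tendsto (fun m : ℕ => m * ∫⁻ z, bigJump m (ENNReal.ofReal (D * m)) z ^ q ∂ρ) atTop (𝓝 0) := by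
  rcases h with h | ⟨r, hr, hrq, h⟩
  · exact tendsto_natCast_mul_lintegral_bigJump hq h _
  · exact tendsto_natCast_mul_lintegral_bigJump_of_lt hD hr hrq h

theorem momentUI_walk (hρ : JumpLaw ρ) {q q' : ℝ} (hq : 2 ≤ q) (hq' : q' ≤ q)
    (hfin : ∫⁻ z : ℤ, ENNReal.ofReal |(z : ℝ)| ^ q ∂ρ ≠ ∞) :
    MomentUI (pathLaw ρ) atTop q' fun (n : ℕ) w => (√n)⁻¹ * (walk w n : ℝ) := by
  obtain ⟨K, hK, hKm⟩ := exists_lintegral_maxSmall_le hρ (s := q + 1) (by linarith)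
  refine momentUI_of_le_add (by linarith) hq'
    (U := fun n w => ENNReal.ofReal (1 + maxSmall n w))
    (B := fun n w => ∑ i ∈ Finset.range n, bigJump n ∞ (w i))
    (fun n => (measurable_const.add (measurable_maxSmall n)).ennreal_ofReal) hK ?_
    ((eventually_ge_atTop 1).mono hKm) ?_
  · filter_upwards [eventually_ge_atTop 1] with n hn w
    have hm0 : (0 : ℝ) < n := by exact_mod_cast hn
    have hs : 0 < √(n : ℝ) := Real.sqrt_pos.2 hm0
    have h := min_abs_walk_le hn le_rfl ∞ w
    rw [min_eq_left le_top] at h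
    rw [abs_mul, abs_of_pos (by positivity), ENNReal.ofReal_mul (by positivity),
      ENNReal.ofReal_inv_of_pos hs]
    calc _ ≤ (ENNReal.ofReal √n)⁻¹ * (ENNReal.ofReal √n *
          (ENNReal.ofReal (maxSmall n w) + ∑ i ∈ Finset.range n, bigJump n ∞ (w i))) := by gcongr
      _ = ENNReal.ofReal (maxSmall n w) + ∑ i ∈ Finset.range n, bigJump n ∞ (w i) := by
        rw [← mul_assoc, ENNReal.inv_mul_cancel (by simpa using hs) ENNReal.ofReal_ne_top, one_mul]
      _ ≤ _ := by
        gcongr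
        linarith
  · exact tendsto_lintegral_sum_rpow
      ((eventually_ge_atTop 1).mono fun n hn => bigJump_eq_zero_or hn le_top) (by linarith)
      (tendsto_natCast_mul_lintegral_bigJump hq hfin fun _ => ∞)

end WalkMoments

/-! ### Pathwise bounds and measurability of the process. -/

section ProcessBounds

theorem collisionTime_zero (e : ℤ → ℝ) (w : ℕ → ℤ) : collisionTime e w 0 = 0 := by
  simp [collisionTime]

theorem collisionTime_succ (e : ℤ → ℝ) (w : ℕ → ℤ) (n : ℕ) :
    collisionTime e w (n + 1) = collisionTime e w n + |e (walk w (n + 1)) - e (walk w n)| := by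
  simp [collisionTime, Finset.sum_range_succ]

theorem walk_zero (w : ℕ → ℤ) : walk w 0 = 0 := by simp [walk]

theorem abs_walk_le_collisionTime {e : ℤ → ℝ} (he : e 0 = 0) (w : ℕ → ℤ) (n : ℕ) :
    |e (walk w n)| ≤ collisionTime e w n := by
  induction n with
  | zero => simp [walk_zero, he, collisionTime_zero]
  | succ n ih =>
    rw [collisionTime_succ]
    have h : e (walk w (n + 1)) = e (walk w n) + (e (walk w (n + 1)) - e (walk w n)) := by ring
    calc |e (walk w (n + 1))| ≤ |e (walk w n)| + |e (walk w (n + 1)) - e (walk w n)| := by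
          conv_lhs => rw [h]
          exact abs_add_le _ _
      _ ≤ _ := by gcongr

theorem collisionTime_collisionNumber_le (e : ℤ → ℝ) (w : ℕ → ℤ) {t : ℝ} (ht : 0 ≤ t) :
    collisionTime e w (collisionNumber e w t) ≤ t := by
  have h0 : (0 : ℕ) ∈ {m : ℕ | collisionTime e w m ≤ t} := by
    simpa [collisionTime_zero] using ht
  by_cases hb : BddAbove {m : ℕ | collisionTime e w m ≤ t}
  · exact Nat.sSup_mem ⟨0, h0⟩ hb
  -- The supremum of an unbounded set in ℕ is 0 by convention, and τ(0) = 0 ≤ t.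
  · rw [collisionNumber, Nat.sSup_of_not_bddAbove hb]
    exact h0

theorem bddAbove_of_lt_collisionTime {e : ℤ → ℝ} {w : ℕ → ℤ} {t : ℝ} {m : ℕ}
    (h : t < collisionTime e w m) : m ∈ upperBounds {m : ℕ | collisionTime e w m ≤ t} := by
  intro k hk
  by_contra hlt
  exact absurd (h.trans_le (collisionTime_mono e w (not_le.1 hlt).le)) (not_lt.2 hk)

theorem lt_collisionTime_collisionNumber_add_one {e : ℤ → ℝ} {w : ℕ → ℤ} {t : ℝ} {m : ℕ}
    (h : t < collisionTime e w m) :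
    t < collisionTime e w (collisionNumber e w t + 1) := by
  by_contra hlt
  have : collisionNumber e w t + 1 ≤ collisionNumber e w t :=
    le_csSup ⟨m, bddAbove_of_lt_collisionTime h⟩ (not_lt.1 hlt)
  omega

theorem collisionNumber_lt {e : ℤ → ℝ} {w : ℕ → ℤ} {t : ℝ} {m : ℕ} (ht : 0 ≤ t)
    (h : t < collisionTime e w m) : collisionNumber e w t < m := by
  by_contra hlt
  exact absurd (h.trans_le (collisionTime_mono e w (not_lt.1 hlt)))
    (not_lt.2 (collisionTime_collisionNumber_le e w ht))

theorem abs_sign_le_one (k : ℤ) : |(k.sign : ℝ)| ≤ 1 := by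
  rcases lt_trichotomy k 0 with h | h | h
  · simp [Int.sign_eq_neg_one_of_neg h]
  · simp [h]
  · simp [Int.sign_eq_one_of_pos h]

theorem abs_process_sub_le (e : ℤ → ℝ) (w : ℕ → ℤ) {t : ℝ} (ht : 0 ≤ t) :
    |process e w t - e (walk w (collisionNumber e w t))| ≤
      t - collisionTime e w (collisionNumber e w t) := by
  have h1 := collisionTime_collisionNumber_le e w ht
  rw [process, add_sub_cancel_left, abs_mul, abs_of_nonneg (sub_nonneg.2 h1)]
  exact mul_le_of_le_one_left (sub_nonneg.2 h1) (abs_sign_le_one _)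

/-- Unit speed. This deterministic bound gives integrability at every time, controls the exceptional
events, and justifies capping the jumps at order t. -/
theorem abs_process_le {e : ℤ → ℝ} (he : e 0 = 0) (w : ℕ → ℤ) {t : ℝ} (ht : 0 ≤ t) :
    |process e w t| ≤ t := by
  have h1 := abs_process_sub_le e w ht
  have h2 := abs_walk_le_collisionTime he w (collisionNumber e w t)
  rw [abs_le] at *
  constructor <;> linarith

/-- A collision time beyond t makes the supremum defining the collision number genuine, so the time
since the last collision is at most the length of the current jump. -/
theorem abs_process_sub_le_of_lt {e : ℤ → ℝ} {w : ℕ → ℤ} {t : ℝ} {m : ℕ} (ht : 0 ≤ t)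
    (h : t < collisionTime e w m) :
    |process e w t - e (walk w (collisionNumber e w t))| ≤
      |e (walk w (collisionNumber e w t + 1)) - e (walk w (collisionNumber e w t))| := by
  have h1 := abs_process_sub_le e w ht
  have h2 := lt_collisionTime_collisionNumber_add_one h
  rw [collisionTime_succ] at h2
  linarith

theorem exists_abs_process_le {e : ℤ → ℝ} {C : ℝ} (hC : ∀ k : ℤ, |e k| ≤ C * (1 + |(k : ℝ)|))
    {w : ℕ → ℤ} {t : ℝ} {m : ℕ} (ht : 0 ≤ t) (h : t < collisionTime e w m) :
    ∃ k ≤ m, |process e w t| ≤ 3 * C * (1 + |(walk w k : ℝ)|) := by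
  have hC0 : 0 ≤ C := by
    have := (abs_nonneg _).trans (hC 0)
    simpa using this
  set N := collisionNumber e w t with hN
  have hNm : N < m := collisionNumber_lt ht h
  have h1 := abs_process_sub_le_of_lt ht h
  rw [← hN] at h1
  have h2 : |process e w t| ≤ 2 * |e (walk w N)| + |e (walk w (N + 1))| := by
    have h3 := abs_sub (e (walk w (N + 1))) (e (walk w N))
    have h4 := abs_sub_abs_le_abs_sub (process e w t) (e (walk w N))
    linarith
  have h3 := hC (walk w N)
  have h4 := hC (walk w (N + 1))
  rcases le_total |(walk w N : ℝ)| |(walk w (N + 1) : ℝ)| with hle | hle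
  · refine ⟨N + 1, hNm, ?_⟩
    have : C * (1 + |(walk w N : ℝ)|) ≤ C * (1 + |(walk w (N + 1) : ℝ)|) := by gcongr
    linarith
  · refine ⟨N, hNm.le, ?_⟩
    have : C * (1 + |(walk w (N + 1) : ℝ)|) ≤ C * (1 + |(walk w N : ℝ)|) := by gcongr
    linarith

theorem measurable_collisionTime (e : ℤ → ℝ) (n : ℕ) :
    Measurable fun w : ℕ → ℤ => collisionTime e w n := by
  unfold collisionTime
  exact Finset.measurable_sum _ fun i _ =>
    measurable_walk_pair (fun a b => |e b - e a|) i (i + 1)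

theorem measurable_collisionNumber (e : ℤ → ℝ) (t : ℝ) :
    Measurable fun w : ℕ → ℤ => collisionNumber e w t := by
  have hpos : ∀ n : ℕ, MeasurableSet ((fun w : ℕ → ℤ => collisionNumber e w t) ⁻¹' {n + 1}) := by
    intro n
    have h : (fun w : ℕ → ℤ => collisionNumber e w t) ⁻¹' {n + 1} =
        {w | collisionTime e w (n + 1) ≤ t} ∩ {w | t < collisionTime e w (n + 2)} := by
      ext w
      simp only [Set.mem_preimage, Set.mem_singleton_iff, Set.mem_inter_iff, Set.mem_ofPred_eq]
      constructor
      · intro h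
        have hne : {m : ℕ | collisionTime e w m ≤ t}.Nonempty := by
          by_contra hem
          rw [Set.not_nonempty_iff_eq_empty] at hem
          rw [collisionNumber, hem, csSup_empty] at h
          exact absurd h (by simp)
        have hb : BddAbove {m : ℕ | collisionTime e w m ≤ t} := by
          by_contra hb
          rw [collisionNumber, Nat.sSup_of_not_bddAbove hb] at h
          omega
        have hmem := Nat.sSup_mem hne hb
        change collisionTime e w (collisionNumber e w t) ≤ t at hmem
        rw [h] at hmem
        refine ⟨hmem, ?_⟩
        by_contra hlt
        have : n + 2 ≤ collisionNumber e w t := le_csSup hb (not_lt.1 hlt)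
        omega
      · rintro ⟨h1, h2⟩
        refine le_antisymm ?_ (le_csSup ⟨_, bddAbove_of_lt_collisionTime h2⟩ h1)
        have h3 : collisionTime e w (collisionNumber e w t) ≤ t :=
          Nat.sSup_mem (s := {m : ℕ | collisionTime e w m ≤ t}) ⟨n + 1, h1⟩
            ⟨_, bddAbove_of_lt_collisionTime h2⟩
        by_contra hlt
        have h4 : n + 2 ≤ collisionNumber e w t := by omega
        exact absurd (h2.trans_le (collisionTime_mono e w h4)) (not_lt.2 h3)
    rw [h]
    exact (measurableSet_le (measurable_collisionTime e _) measurable_const).inter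
      (measurableSet_lt measurable_const (measurable_collisionTime e _))
  refine measurable_to_countable' fun n => ?_
  rcases n with _ | n
  -- The value 0 also collects the paths with unbounded supremum, so its fibre is obtained as a
  -- complement.
  · have h : (fun w : ℕ → ℤ => collisionNumber e w t) ⁻¹' {0} =
        (⋃ n : ℕ, (fun w : ℕ → ℤ => collisionNumber e w t) ⁻¹' {n + 1})ᶜ := by
      ext w
      simp only [Set.mem_preimage, Set.mem_singleton_iff, Set.mem_compl_iff, Set.mem_iUnion,
        not_exists]
      constructor
      · intro h n; omega
      · intro h
        by_contra h0
        exact h (collisionNumber e w t - 1) (by omega)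
    rw [h]
    exact (MeasurableSet.iUnion hpos).compl
  · exact hpos n

theorem measurable_process (e : ℤ → ℝ) (t : ℝ) :
    Measurable fun w : ℕ → ℤ => process e w t := by
  have h1 : Measurable fun p : ℕ × (ℕ → ℤ) =>
      e (walk p.2 p.1) + ((p.2 p.1).sign : ℝ) * (t - collisionTime e p.2 p.1) := by
    refine measurable_from_prod_countable_right fun n => ?_
    have h2 : Measurable fun w : ℕ → ℤ => e (walk w n) :=
      measurable_walk_pair (fun a _ => e a) n n
    have h3 : Measurable fun w : ℕ → ℤ => ((w n).sign : ℝ) := by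
      have h4 := (measurable_of_countable fun k : ℤ => (k.sign : ℝ)).comp
        (measurable_pi_apply (X := fun _ : ℕ => ℤ) n)
      simpa only [Function.comp_def] using h4
    exact h2.add (h3.mul ((measurable_collisionTime e n).const_sub t))
  have h2 := h1.comp ((measurable_collisionNumber e t).prodMk measurable_id)
  simpa only [Function.comp_def, id, process] using h2

end ProcessBounds

/-! ### Uniform integrability for the process. -/

section ProcessMoments

theorem tendsto_lintegral_add_rpow {Ξ ι : Type*} [MeasurableSpace Ξ] {ν : Measure Ξ} {l : Filter ι}
    {A B : ι → Ξ → ℝ≥0∞} {q : ℝ} (hq : 1 ≤ q) (hAm : ∀ i, Measurable (A i))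
    (hA : Tendsto (fun i => ∫⁻ x, A i x ^ q ∂ν) l (𝓝 0))
    (hB : Tendsto (fun i => ∫⁻ x, B i x ^ q ∂ν) l (𝓝 0)) :
    Tendsto (fun i => ∫⁻ x, (A i x + B i x) ^ q ∂ν) l (𝓝 0) := by
  have h2 : (2 : ℝ≥0∞) ^ (q - 1) ≠ ∞ :=
    ENNReal.rpow_ne_top_of_nonneg (by linarith) ENNReal.ofNat_ne_top
  have h : Tendsto (fun i => 2 ^ (q - 1) * (∫⁻ x, A i x ^ q ∂ν + ∫⁻ x, B i x ^ q ∂ν)) l (𝓝 0) := by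
    have := ENNReal.Tendsto.const_mul (hA.add hB) (Or.inr h2)
    simpa using this
  refine tendsto_of_tendsto_of_tendsto_of_le_of_le tendsto_const_nhds h
    (fun i => zero_le) fun i => ?_
  dsimp only
  rw [← lintegral_add_left ((hAm i).pow_const q), ← lintegral_const_mul' _ _ h2]
  exact lintegral_mono fun x => ENNReal.rpow_add_le_mul_rpow_add_rpow _ _ hq

variable {ρ : Measure ℤ} [IsProbabilityMeasure ρ] {μ : ℝ} {z : ℤ → ℝ}

theorem RegularEnvironment.exists_abs_le (hz : RegularEnvironment ρ μ z) :
    ∃ C, 1 ≤ C ∧ ∀ k : ℤ, |environment z k| ≤ C * (1 + |(k : ℝ)|) := by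
  obtain ⟨B, hB, h⟩ := hz.asymptotics 1 one_pos
  refine ⟨|μ| + 1 + B, by have := abs_nonneg μ; linarith, fun k => ?_⟩
  have h1 := abs_sub_abs_le_abs_sub (environment z k) (μ * k)
  rw [abs_mul] at h1
  nlinarith [h k, abs_nonneg μ, abs_nonneg (k : ℝ), mul_nonneg hB (abs_nonneg (k : ℝ))]

/-- With m = ⌈t/c⌉ and c from `time_lower`, at most m collisions occur by time t outside a rapidly
decaying event. There |X(t)| is bounded by the walk at some k ≤ m, and the walk may be capped at Dm
because |X(t)| ≤ t. `momentUI_of_le_add` is fed the small-step maximum as U, and the capped large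
jumps plus the exceptional event as B. -/
theorem momentUI_process (hρ : JumpLaw ρ) (hz : RegularEnvironment ρ μ z) {q q' : ℝ} (hq : 2 ≤ q)
    (hq' : q' ≤ q) (hnear : NearMoment ρ q) :
    MomentUI (pathLaw ρ) atTop q' fun (t : ℝ) w => (√t)⁻¹ * process (environment z) w t := by
  obtain ⟨K, hK, hKm⟩ := exists_lintegral_maxSmall_le hρ (s := q + 1) (by linarith)
  obtain ⟨C, hC1, hC⟩ := hz.exists_abs_le
  obtain ⟨c, hc, hdecay⟩ := hz.time_lower
  -- D ≥ c makes the cap Dm at least t; D ≥ 1 keeps it above √m.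
  set D := max c 1 with hD
  set s := √(1 / c + 1) with hs
  set m : ℝ → ℕ := fun t => ⌈t / c⌉₊ with hm
  have hm_lim : Tendsto m atTop atTop :=
    tendsto_nat_ceil_atTop.comp (tendsto_id.atTop_div_const hc)
  have hs0 : 0 ≤ s := Real.sqrt_nonneg _
  set C' : ℝ≥0∞ := ENNReal.ofReal (3 * C) * (1 + ENNReal.ofReal s) with hC'
  have hC't : C' ≠ ∞ := by rw [hC']; finiteness
  have hEm : ∀ t : ℝ, MeasurableSet {w : ℕ → ℤ | collisionTime (environment z) w (m t) ≤ t} :=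
    fun t => measurableSet_le (measurable_collisionTime _ _) measurable_const
  have ht_le : ∀ t : ℝ, t ≤ c * m t := fun t => by
    have := Nat.le_ceil (t / c)
    rwa [div_le_iff₀' hc] at this
  have hm1 : ∀ t : ℝ, 1 ≤ t → 1 ≤ m t := fun t ht => Nat.one_le_ceil_iff.2 (by positivity)
  refine momentUI_of_le_add (by linarith) hq'
    (U := fun t w => C' * ENNReal.ofReal (1 + maxSmall (m t) w))
    (B := fun t w => C' * ∑ i ∈ Finset.range (m t), bigJump (m t) (ENNReal.ofReal (D * m t)) (w i) +
      {w | collisionTime (environment z) w (m t) ≤ t}.indicator (fun _ => ENNReal.ofReal √t) w)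
    (fun t => ((measurable_const.add (measurable_maxSmall _)).ennreal_ofReal).const_mul _)
    (K := C' ^ (q + 1) * K)
    (ENNReal.mul_ne_top (ENNReal.rpow_ne_top_of_nonneg (by linarith) hC't) hK) ?_ ?_ ?_
  · filter_upwards [eventually_ge_atTop 1] with t ht w
    have hst : 0 < √t := Real.sqrt_pos.2 (by linarith)
    have ht0 : 0 ≤ t := by linarith
    have hle := abs_process_le (environment_zero z) w ht0
    rw [abs_mul, abs_of_pos (by positivity)]
    by_cases hw : w ∈ {w | collisionTime (environment z) w (m t) ≤ t}
    · rw [Set.indicator_of_mem hw]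
      refine le_trans (ENNReal.ofReal_le_ofReal ?_) (le_trans le_add_self le_add_self)
      rw [inv_mul_le_iff₀ hst, Real.mul_self_sqrt ht0]
      exact hle
    · rw [Set.indicator_of_notMem hw, add_zero]
      obtain ⟨k, hk, hX⟩ := exists_abs_process_le hC ht0 (not_le.1 hw)
      have hX2 : ENNReal.ofReal |process (environment z) w t| ≤ ENNReal.ofReal (3 * C) *
          (1 + min (ENNReal.ofReal |(walk w k : ℝ)|) (ENNReal.ofReal (D * m t))) := by
        rw [← ENNReal.ofReal_min, ← ENNReal.ofReal_one, ← ENNReal.ofReal_add zero_le_one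
          (by positivity), ← ENNReal.ofReal_mul (by linarith)]
        refine ENNReal.ofReal_le_ofReal ?_
        rcases min_cases |(walk w k : ℝ)| (D * m t) with ⟨h, _⟩ | ⟨h, _⟩ <;> rw [h]
        · exact hX
        · have h1 : c * m t ≤ D * m t := by gcongr; exact le_max_left _ _
          have h2 : 0 ≤ D * m t := by positivity
          nlinarith [ht_le t]
      set V := ENNReal.ofReal (maxSmall (m t) w) with hV
      set S := ∑ i ∈ Finset.range (m t), bigJump (m t) (ENNReal.ofReal (D * m t)) (w i) with hS
      have hW := min_abs_walk_le (hm1 t ht) hk (ENNReal.ofReal (D * m t)) w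
      rw [← hV, ← hS] at hW
      have hr1 : ENNReal.ofReal (√t)⁻¹ ≤ 1 := by
        rw [ENNReal.ofReal_le_one]
        exact inv_le_one_of_one_le₀ (Real.one_le_sqrt.2 ht)
      have hr2 : ENNReal.ofReal (√t)⁻¹ * ENNReal.ofReal √(m t : ℝ) ≤ ENNReal.ofReal s := by
        rw [← ENNReal.ofReal_mul (by positivity)]
        refine ENNReal.ofReal_le_ofReal ?_
        rw [inv_mul_le_iff₀ hst, hs, ← Real.sqrt_mul ht0]
        refine Real.sqrt_le_sqrt ?_
        have := (Nat.ceil_lt_add_one (div_nonneg ht0 hc.le)).le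
        calc (m t : ℝ) ≤ t / c + 1 := this
          _ ≤ t / c + t := by linarith
          _ = t * (1 / c + 1) := by ring
      have hV1 : ENNReal.ofReal (1 + maxSmall (m t) w) = 1 + V := by
        rw [ENNReal.ofReal_add zero_le_one (maxSmall_nonneg _ _), ENNReal.ofReal_one]
      rw [ENNReal.ofReal_mul (by positivity), hV1]
      calc ENNReal.ofReal (√t)⁻¹ * ENNReal.ofReal |process (environment z) w t|
          ≤ ENNReal.ofReal (√t)⁻¹ * (ENNReal.ofReal (3 * C) *
              (1 + ENNReal.ofReal √(m t : ℝ) * (V + S))) := by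
            gcongr
            exact hX2.trans (by gcongr)
        _ = ENNReal.ofReal (3 * C) * (ENNReal.ofReal (√t)⁻¹ +
              (ENNReal.ofReal (√t)⁻¹ * ENNReal.ofReal √(m t : ℝ)) * (V + S)) := by ring
        _ ≤ ENNReal.ofReal (3 * C) * (1 + ENNReal.ofReal s * (V + S)) := by gcongr
        _ ≤ ENNReal.ofReal (3 * C) * ((1 + ENNReal.ofReal s * (V + S)) +
              (V + S + ENNReal.ofReal s)) := by exact mul_le_mul_right le_self_add _
        _ = C' * (1 + V) + C' * S := by rw [hC']; ring
  · filter_upwards [eventually_ge_atTop 1] with t ht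
    simp only [ENNReal.mul_rpow_of_nonneg _ _ (show 0 ≤ q + 1 by linarith)]
    rw [lintegral_const_mul' _ _ (ENNReal.rpow_ne_top_of_nonneg (by linarith) hC't)]
    gcongr
    exact hKm _ (hm1 t ht)
  · have hSm : ∀ t, Measurable fun w : ℕ → ℤ =>
        ∑ i ∈ Finset.range (m t), bigJump (m t) (ENNReal.ofReal (D * m t)) (w i) := fun t => by
      refine Finset.measurable_sum _ fun i _ => ?_
      have h4 := (measurable_of_countable (bigJump (m t) (ENNReal.ofReal (D * m t)))).comp
        (measurable_pi_apply (X := fun _ : ℕ => ℤ) i)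
      simpa only [Function.comp_def] using h4
    refine tendsto_lintegral_add_rpow (by linarith) (fun t => (hSm t).const_mul C') ?_ ?_
    · have h1 := tendsto_lintegral_sum_rpow (ρ := ρ) (l := (atTop : Filter ℕ)) (m := fun n => n)
        (b := fun n => bigJump n (ENNReal.ofReal (D * n))) (q := q)
        (by
          filter_upwards [eventually_ge_atTop 1] with n hn x
          refine bigJump_eq_zero_or hn (ENNReal.ofReal_le_ofReal ?_) x
          have hn1 : (1 : ℝ) ≤ n := by exact_mod_cast hn
          calc √(n : ℝ) ≤ n := Real.sqrt_le_iff.2 ⟨by linarith, by nlinarith⟩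
            _ ≤ D * n := le_mul_of_one_le_left (by linarith) (le_max_right _ _)) (by linarith)
        (hnear.tendsto hq (le_max_right c 1))
      have hC'q : C' ^ q ≠ ∞ := ENNReal.rpow_ne_top_of_nonneg (by linarith) hC't
      have h2 := ENNReal.Tendsto.const_mul (h1.comp hm_lim) (Or.inr hC'q)
      rw [mul_zero] at h2
      refine h2.congr fun t => ?_
      simp only [ENNReal.mul_rpow_of_nonneg _ _ (show 0 ≤ q by linarith)]
      rw [lintegral_const_mul' _ _ hC'q]
      rfl
    -- On the exceptional event only |X(t)|/√t ≤ √t is known; its q-th power is polynomial in m and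
    -- loses to rapid decay.
    · obtain ⟨N, hN⟩ := exists_nat_ge q
      have h1 := ENNReal.Tendsto.const_mul ((hdecay.tendsto_mul_pow N).comp hm_lim)
        (Or.inr (show ENNReal.ofReal c ^ N ≠ ∞ by finiteness))
      rw [mul_zero] at h1
      refine tendsto_of_tendsto_of_tendsto_of_le_of_le' tendsto_const_nhds h1
        (Eventually.of_forall fun i => zero_le) ?_
      filter_upwards [eventually_ge_atTop 1] with t ht
      have h2 : ∀ w, {w | collisionTime (environment z) w (m t) ≤ t}.indicator
          (fun _ => ENNReal.ofReal √t) w ^ q = {w | collisionTime (environment z) w (m t) ≤ t}.indicator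
          (fun _ => ENNReal.ofReal √t ^ q) w := fun w => by
        by_cases hw : w ∈ {w | collisionTime (environment z) w (m t) ≤ t}
        · rw [Set.indicator_of_mem hw, Set.indicator_of_mem hw]
        · rw [Set.indicator_of_notMem hw, Set.indicator_of_notMem hw,
            ENNReal.zero_rpow_of_pos (by linarith)]
      simp only [h2]
      rw [lintegral_indicator_const (hEm t)]
      have h3 : ENNReal.ofReal √t ^ q ≤ ENNReal.ofReal c ^ N * (m t : ℝ≥0∞) ^ N := by
        rw [← mul_pow, ← ENNReal.ofReal_natCast, ← ENNReal.ofReal_mul hc.le,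
          ENNReal.ofReal_rpow_of_nonneg (by positivity) (by linarith),
          ← ENNReal.ofReal_pow (by positivity)]
        refine ENNReal.ofReal_le_ofReal ?_
        calc √t ^ q ≤ √t ^ (N : ℝ) :=
              Real.rpow_le_rpow_of_exponent_le (Real.one_le_sqrt.2 ht) hN
          _ = √t ^ N := Real.rpow_natCast _ _
          _ ≤ _ := by
            gcongr
            exact (Real.sqrt_le_iff.2 ⟨by linarith, by nlinarith⟩ : √t ≤ t).trans (ht_le t)
      calc _ ≤ ENNReal.ofReal c ^ N * (m t : ℝ≥0∞) ^ N *
            pathLaw ρ {w | collisionTime (environment z) w (m t) ≤ c * m t} := by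
            refine mul_le_mul' h3 (measure_mono fun w hw => ?_)
            exact le_trans (show collisionTime (environment z) w (m t) ≤ t from hw) (ht_le t)
        _ = _ := by rw [mul_assoc]; rfl

end ProcessMoments

/-! ### Limit in distribution. -/

section InvariancePrinciple

/-- Let N be the number of collisions by time t. Both N and n lie in [m₁, m₂], where any two
positions differ by at most 2L. Replacing e by μk costs εR + B at one site for the target and at two
for the current jump; moving from S_N to S_n and across the jump costs 2μL each. -/
theorem abs_process_sub_mul_walk_le {e : ℤ → ℝ} {μ ε B : ℝ} (hμ : 0 ≤ μ) (hε : 0 ≤ ε)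
    (he : ∀ k : ℤ, |e k - μ * k| ≤ ε * |(k : ℝ)| + B) {w : ℕ → ℤ} {t : ℝ} (ht : 0 ≤ t)
    {m₁ m₂ n : ℕ} (h₁ : collisionTime e w m₁ ≤ t) (h₂ : t < collisionTime e w m₂) (hn₁ : m₁ ≤ n)
    (hn₂ : n ≤ m₂) {L R : ℝ}
    (hL : ∀ k ≤ m₂ - m₁, |(walk w (m₁ + k) : ℝ) - walk w m₁| ≤ L)
    (hR : ∀ k ≤ m₂, |(walk w k : ℝ)| ≤ R) :
    |process e w t - μ * walk w n| ≤ 3 * (ε * R + B) + 4 * μ * L := by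
  set N := collisionNumber e w t with hN
  have hN₂ : N < m₂ := collisionNumber_lt ht h₂
  have hN₁ : m₁ ≤ N := le_csSup ⟨_, bddAbove_of_lt_collisionTime h₂⟩ h₁
  have hdiff : ∀ i j, m₁ ≤ i → i ≤ m₂ → m₁ ≤ j → j ≤ m₂ →
      |(walk w i : ℝ) - walk w j| ≤ 2 * L := by
    intro i j hi hi' hj hj'
    have h3 := hL (i - m₁) (by omega)
    have h4 := hL (j - m₁) (by omega)
    rw [Nat.add_sub_cancel' hi] at h3
    rw [Nat.add_sub_cancel' hj] at h4
    rw [abs_le] at *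
    constructor <;> linarith
  have hE : ∀ k ≤ m₂, |e (walk w k) - μ * walk w k| ≤ ε * R + B := fun k hk =>
    (he _).trans (by gcongr; exact hR k hk)
  have hX := abs_process_sub_le_of_lt ht h₂
  rw [← hN] at hX
  have hE1 := hE N hN₂.le
  have hE2 := hE (N + 1) hN₂
  have hd1 : |μ * ((walk w (N + 1) : ℝ) - walk w N)| ≤ μ * (2 * L) := by
    rw [abs_mul, abs_of_nonneg hμ]
    exact mul_le_mul_of_nonneg_left (hdiff _ _ (by omega) hN₂ hN₁ hN₂.le) hμ
  have hd2 : |μ * ((walk w N : ℝ) - walk w n)| ≤ μ * (2 * L) := by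
    rw [abs_mul, abs_of_nonneg hμ]
    exact mul_le_mul_of_nonneg_left (hdiff _ _ hN₁ hN₂.le hn₁ hn₂) hμ
  have hstep : |e (walk w (N + 1)) - e (walk w N)| ≤ 2 * (ε * R + B) + μ * (2 * L) := by
    rw [abs_le] at *
    constructor <;> linarith
  have h5 := hX.trans hstep
  rw [abs_le] at *
  constructor <;> linarith

variable {ρ : Measure ℤ} [IsProbabilityMeasure ρ]

theorem measure_exists_walk_sub_ge (hρ : JumpLaw ρ) (m n : ℕ) {r : ℝ} (hr : 0 < r) :
    pathLaw ρ {w | ∃ k ≤ n, r ≤ |(walk w (m + k) : ℝ) - walk w m|} ≤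
      ENNReal.ofReal (n * (∫ z : ℤ, (z : ℝ) ^ 2 ∂ρ) / r ^ 2) := by
  refine le_trans (le_of_eq ?_) (kolmogorov_maximal ρ hρ.integrable_cast
    (hρ.integral_eq_zero_of_odd fun z => by push_cast; ring) hρ.integrable_sq le_rfl hr n)
  have hms : MeasurableSet {x : ℕ → ℤ | ∃ k ≤ n, r ≤ |∑ i ∈ Finset.range k, (x i : ℝ)|} := by
    have h : {x : ℕ → ℤ | ∃ k ≤ n, r ≤ |∑ i ∈ Finset.range k, (x i : ℝ)|} =
        ⋃ k : ℕ, ⋃ _ : k ≤ n, {x : ℕ → ℤ | r ≤ |∑ i ∈ Finset.range k, (x i : ℝ)|} := by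
      ext x; simp
    rw [h]
    exact MeasurableSet.iUnion fun k => MeasurableSet.iUnion fun _ =>
      measurableSet_le measurable_const
        (continuous_abs.measurable.comp (measurable_stepSum (fun z : ℤ => (z : ℝ)) k))
  rw [← (measurePreserving_shift ρ m).measure_preimage hms.nullMeasurableSet]
  congr 1
  ext w
  simp only [Set.mem_preimage, Set.mem_ofPred_eq, walk, Finset.sum_range_add, Int.cast_add,
    Int.cast_sum, add_sub_cancel_left]

theorem measure_exists_walk_ge (hρ : JumpLaw ρ) (n : ℕ) {r : ℝ} (hr : 0 < r) :
    pathLaw ρ {w | ∃ k ≤ n, r ≤ |(walk w k : ℝ)|} ≤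
      ENNReal.ofReal (n * (∫ z : ℤ, (z : ℝ) ^ 2 ∂ρ) / r ^ 2) := by
  have h := measure_exists_walk_sub_ge hρ 0 n hr
  simpa only [zero_add, walk_zero, Int.cast_zero, sub_zero] using h

variable {μ : ℝ} {z : ℤ → ℝ}

/-- Four events of probability at most κ/4 are excluded: τ(m₁) too late, τ(m₂) too early, too much
movement between m₁ and m₂, and a walk that has gone too far. The law for τ handles the first two
and Kolmogorov's inequality the others. -/
theorem tendsto_measure_process_sub_walk (hρ : JumpLaw ρ) (hμ : 0 < μ)
    (hz : RegularEnvironment ρ μ z) {δ : ℝ} (hδ : 0 < δ) :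
    Tendsto (fun t : ℝ => pathLaw ρ {w | δ * √t ≤
      |process (environment z) w t - μ * walk w ⌊t / (μ * meanAbs ρ)⌋₊|}) atTop (𝓝 0) := by
  set a := μ * meanAbs ρ with ha
  have ha0 : 0 < a := mul_pos hμ hρ.meanAbs_pos
  set v := ∫ z : ℤ, (z : ℝ) ^ 2 ∂ρ with hv
  have hv0 : 0 ≤ v := integral_nonneg fun z => sq_nonneg _
  rw [ENNReal.tendsto_nhds_zero]
  intro κ' hκ'
  obtain ⟨κ, hκ, hκle⟩ := exists_pos_ofReal_le hκ'
  -- The constants r, ε and a large t make 4μL, 3εR and 3B at most δ√t/4 each, while η and R are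
  -- fitted to Kolmogorov's bound for the window and for the whole path.
  set r := δ / (16 * μ) with hr
  have hr0 : 0 < r := by positivity
  set η := min 1 (κ * a * r ^ 2 / (16 * (v + 1))) with hη
  have hη0 : 0 < η := lt_min one_pos (by positivity)
  have hη1 : η ≤ 1 := min_le_left _ _
  set R := 1 + 4 * (2 / a + 1) * v / κ with hR
  have hR1 : 1 ≤ R := by
    rw [hR]
    have : 0 ≤ 4 * (2 / a + 1) * v / κ := by positivity
    linarith
  set ε := δ / (12 * R) with hε
  have hε0 : 0 < ε := by positivity
  obtain ⟨B, hB, hasym⟩ := hz.asymptotics ε hε0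
  set m₁ : ℝ → ℕ := fun t => ⌊(1 - η) * (t / a)⌋₊ with hm₁
  set m₂ : ℝ → ℕ := fun t => ⌈(1 + η) * (t / a)⌉₊ with hm₂
  have hta : Tendsto (fun t : ℝ => t / a) atTop atTop := tendsto_id.atTop_div_const ha0
  have hm₂lim : Tendsto m₂ atTop atTop :=
    tendsto_nat_ceil_atTop.comp (hta.const_mul_atTop (by linarith))
  have hlow : ∀ᶠ t in atTop, pathLaw ρ {w | t < collisionTime (environment z) w (m₁ t)} ≤
      ENNReal.ofReal (κ / 4) := by
    -- For η = 1 the index m₁ is constantly 0 and does not tend to infinity, but then τ(m₁) = 0.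
    rcases hη1.eq_or_lt with h1 | h1
    · filter_upwards [eventually_ge_atTop 0] with t ht
      have : {w | t < collisionTime (environment z) w (m₁ t)} = ∅ := by
        ext w
        simp [hm₁, h1, collisionTime_zero, ht]
      rw [this, measure_empty]; exact zero_le
    have hm₁lim : Tendsto m₁ atTop atTop :=
      tendsto_nat_floor_atTop.comp (hta.const_mul_atTop (by linarith))
    have h2 := (hz.time_lln (a * η) (by positivity)).comp hm₁lim
    filter_upwards [h2.eventually_le_const
      (show (0 : ℝ≥0∞) < ENNReal.ofReal (κ / 4) by simpa using hκ), eventually_ge_atTop 0]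
      with t h3 ht
    refine (measure_mono fun w hw => ?_).trans h3
    have hw' : t < collisionTime (environment z) w (m₁ t) := hw
    have hfl : (m₁ t : ℝ) ≤ (1 - η) * (t / a) :=
      Nat.floor_le (mul_nonneg (by linarith) (by positivity))
    refine le_trans ?_
      (le_abs_self (collisionTime (environment z) w (m₁ t) - μ * meanAbs ρ * m₁ t))
    rw [← ha]
    have h4 : (a + a * η) * m₁ t ≤ t := by
      calc (a + a * η) * m₁ t ≤ (a + a * η) * ((1 - η) * (t / a)) := by gcongr
        _ = (1 - η ^ 2) * t := by field_simp; ring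
        _ ≤ t := by nlinarith [mul_nonneg (sq_nonneg η) ht]
    linarith
  have hhigh : ∀ᶠ t in atTop, pathLaw ρ {w | collisionTime (environment z) w (m₂ t) ≤ t} ≤
      ENNReal.ofReal (κ / 4) := by
    have h2 := (hz.time_lln (a * (η / 2)) (by positivity)).comp hm₂lim
    filter_upwards [h2.eventually_le_const
      (show (0 : ℝ≥0∞) < ENNReal.ofReal (κ / 4) by simpa using hκ), eventually_ge_atTop 0]
      with t h3 ht
    refine (measure_mono fun w hw => ?_).trans h3
    have hw' : collisionTime (environment z) w (m₂ t) ≤ t := hw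
    have hfl : (1 + η) * (t / a) ≤ m₂ t := Nat.le_ceil _
    refine le_trans ?_
      (neg_le_abs (collisionTime (environment z) w (m₂ t) - μ * meanAbs ρ * m₂ t))
    rw [← ha]
    have h4 : t ≤ (a - a * (η / 2)) * m₂ t := by
      have h5 : 0 ≤ a - a * (η / 2) := by nlinarith
      calc t ≤ (1 + η / 2 * (1 - η)) * t := by
            nlinarith [mul_nonneg (mul_nonneg hη0.le (sub_nonneg.2 hη1)) ht]
        _ = (a - a * (η / 2)) * ((1 + η) * (t / a)) := by field_simp; ring
        _ ≤ _ := by gcongr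
    linarith
  filter_upwards [hlow, hhigh, eventually_ge_atTop 1, eventually_ge_atTop (16 * v / (r ^ 2 * κ)),
    eventually_gt_atTop ((12 * B / δ) ^ 2)] with t hA hB' ht1 htv htB
  have ht0 : 0 ≤ t := by linarith
  have hst : 0 < √t := Real.sqrt_pos.2 (by linarith)
  have hta0 : 0 ≤ t / a := by positivity
  have hm₂le : (m₂ t : ℝ) ≤ (1 + η) * (t / a) + 1 := (Nat.ceil_lt_add_one (by positivity)).le
  have hm₁ge : (1 - η) * (t / a) - 1 ≤ m₁ t := (Nat.sub_one_lt_floor _).le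
  have hm₁₂ : m₁ t ≤ m₂ t :=
    (Nat.floor_le_floor (show (1 - η) * (t / a) ≤ (1 + η) * (t / a) by gcongr; linarith)).trans
      (Nat.floor_le_ceil _)
  have hn₁ : m₁ t ≤ ⌊t / a⌋₊ := Nat.floor_le_floor (by nlinarith)
  have hn₂ : ⌊t / a⌋₊ ≤ m₂ t :=
    (Nat.floor_le_floor (show t / a ≤ (1 + η) * (t / a) by nlinarith)).trans (Nat.floor_le_ceil _)
  have hC : pathLaw ρ {w | ∃ k ≤ m₂ t - m₁ t, r * √t ≤
      |(walk w (m₁ t + k) : ℝ) - walk w (m₁ t)|} ≤ ENNReal.ofReal (κ / 4) := by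
    refine (measure_exists_walk_sub_ge hρ _ _ (by positivity)).trans (ENNReal.ofReal_le_ofReal ?_)
    rw [← hv, mul_pow, Real.sq_sqrt ht0, div_le_iff₀ (by positivity), Nat.cast_sub hm₁₂]
    have h1 : (m₂ t : ℝ) - m₁ t ≤ 2 * η * (t / a) + 2 := by linarith
    have h2 : η * v / a ≤ κ * r ^ 2 / 16 := by
      have h3 : η ≤ κ * a * r ^ 2 / (16 * (v + 1)) := min_le_right _ _
      rw [le_div_iff₀ (by positivity)] at h3
      rw [div_le_iff₀ ha0]
      nlinarith
    have h4 : 2 * v ≤ κ * r ^ 2 / 8 * t := by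
      rw [div_le_iff₀ (by positivity)] at htv
      linarith
    calc ((m₂ t : ℝ) - m₁ t) * v ≤ (2 * η * (t / a) + 2) * v := by gcongr
      _ = 2 * (η * v / a) * t + 2 * v := by ring
      _ ≤ 2 * (κ * r ^ 2 / 16) * t + κ * r ^ 2 / 8 * t := by gcongr
      _ = κ / 4 * (r ^ 2 * t) := by ring
  have hD : pathLaw ρ {w | ∃ k ≤ m₂ t, R * √t ≤ |(walk w k : ℝ)|} ≤ ENNReal.ofReal (κ / 4) := by
    refine (measure_exists_walk_ge hρ _ (by positivity)).trans (ENNReal.ofReal_le_ofReal ?_)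
    rw [← hv, mul_pow, Real.sq_sqrt ht0, div_le_iff₀ (by positivity)]
    have h1 : (m₂ t : ℝ) ≤ (2 / a + 1) * t := by
      calc (m₂ t : ℝ) ≤ (1 + η) * (t / a) + 1 := hm₂le
        _ ≤ (1 + 1) * (t / a) + t := by gcongr
        _ = _ := by ring
    have h2 : (2 / a + 1) * v ≤ κ / 4 * R := by
      have : κ / 4 * R = κ / 4 + (2 / a + 1) * v := by rw [hR]; field_simp
      linarith
    have h3 : R ≤ R ^ 2 := by nlinarith
    calc (m₂ t : ℝ) * v ≤ (2 / a + 1) * t * v := by gcongr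
      _ = (2 / a + 1) * v * t := by ring
      _ ≤ κ / 4 * R ^ 2 * t :=
          mul_le_mul_of_nonneg_right (h2.trans (by gcongr)) ht0
      _ = _ := by ring
  refine le_trans ?_ hκle
  calc _ ≤ pathLaw ρ (({w | t < collisionTime (environment z) w (m₁ t)} ∪
          {w | collisionTime (environment z) w (m₂ t) ≤ t}) ∪
        ({w | ∃ k ≤ m₂ t - m₁ t, r * √t ≤ |(walk w (m₁ t + k) : ℝ) - walk w (m₁ t)|} ∪
          {w | ∃ k ≤ m₂ t, R * √t ≤ |(walk w k : ℝ)|})) := by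
        refine measure_mono fun w hw => ?_
        by_contra hcon
        simp only [Set.mem_union, Set.mem_ofPred_eq, not_or, not_lt, not_le, not_exists,
          not_and] at hcon
        obtain ⟨⟨c1, c2⟩, c3, c4⟩ := hcon
        have h := abs_process_sub_mul_walk_le hμ.le hε0.le hasym ht0 c1 c2 hn₁ hn₂
          (fun k hk => (c3 k hk).le) (fun k hk => (c4 k hk).le)
        have hw' : δ * √t ≤ |process (environment z) w t - μ * walk w ⌊t / a⌋₊| := hw
        have e1 : ε * (R * √t) = δ / 12 * √t := by rw [hε]; field_simp
        have e2 : 4 * μ * (r * √t) = δ / 4 * √t := by rw [hr]; field_simp; ring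
        have e3 : B < δ / 12 * √t := by
          have h6 : 12 * B / δ < √t := Real.lt_sqrt_of_sq_lt htB
          rw [div_lt_iff₀ hδ] at h6
          linarith
        rw [e1, e2] at h
        have : 0 < δ * √t := by positivity
        linarith
    _ ≤ (ENNReal.ofReal (κ / 4) + ENNReal.ofReal (κ / 4)) +
        (ENNReal.ofReal (κ / 4) + ENNReal.ofReal (κ / 4)) :=
        (measure_union_le _ _).trans (add_le_add ((measure_union_le _ _).trans (add_le_add hA hB'))
          ((measure_union_le _ _).trans (add_le_add hC hD)))
    _ = ENNReal.ofReal κ := by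
        rw [← ENNReal.ofReal_add (by positivity) (by positivity),
          ← ENNReal.ofReal_add (by positivity) (by positivity)]
        congr 1; ring

/-- The variance of the steps. -/
noncomputable def stepVar (ρ : Measure ℤ) : ℝ≥0 := (∫ z : ℤ, (z : ℝ) ^ 2 ∂ρ).toNNReal

theorem tendstoInDistribution_walk (hρ : JumpLaw ρ) :
    TendstoInDistribution (fun (n : ℕ) w => (√n)⁻¹ * (walk w n : ℝ)) atTop id
      (fun _ => pathLaw ρ) (gaussianReal 0 (stepVar ρ)) := by
  have hm : ∀ i, MeasurePreserving (fun w : ℕ → ℤ => w i) (pathLaw ρ) ρ :=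
    measurePreserving_eval ρ
  have hcast : Measurable fun k : ℤ => (k : ℝ) := measurable_of_countable _
  have hmean : ∫ w : ℕ → ℤ, (w 0 : ℝ) ∂pathLaw ρ = 0 := by
    have h := integral_map (μ := pathLaw ρ) (hm 0).measurable.aemeasurable
      (f := fun k : ℤ => (k : ℝ)) hcast.aestronglyMeasurable
    rw [← h, (hm 0).map_eq]
    exact hρ.integral_eq_zero_of_odd fun z => by push_cast; ring
  have hsq : ∫ w : ℕ → ℤ, (w 0 : ℝ) ^ 2 ∂pathLaw ρ = ∫ z : ℤ, (z : ℝ) ^ 2 ∂ρ := by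
    have h := integral_map (μ := pathLaw ρ) (hm 0).measurable.aemeasurable
      (f := fun k : ℤ => (k : ℝ) ^ 2) (hcast.pow_const 2).aestronglyMeasurable
    rw [← h, (hm 0).map_eq]
  have hmeas : ∀ i, Measurable fun w : ℕ → ℤ => (w i : ℝ) := fun i => by
    have := hcast.comp (hm i).measurable
    simpa only [Function.comp_def] using this
  have hL2 : MemLp (fun w : ℕ → ℤ => (w 0 : ℝ)) 2 (pathLaw ρ) := by
    rw [memLp_two_iff_integrable_sq (hmeas 0).aestronglyMeasurable]
    have := (hm 0).integrable_comp_of_integrable hρ.integrable_sq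
    simpa only [Function.comp_def] using this
  have hvar : Var[fun w : ℕ → ℤ => (w 0 : ℝ); pathLaw ρ] = ∫ z : ℤ, (z : ℝ) ^ 2 ∂ρ := by
    rw [variance_of_integral_eq_zero (hmeas 0).aemeasurable hmean]
    exact hsq
  have h := tendstoInDistribution_inv_sqrt_mul_sum_sub
    (X := fun i (w : ℕ → ℤ) => (w i : ℝ)) (P := pathLaw ρ)
    (P' := gaussianReal 0 (stepVar ρ)) (Y := id) (by rw [hvar]; exact HasLaw.id) hL2
    (iIndepFun_pathLaw ρ fun k => (k : ℝ))
    (fun i => ⟨(hmeas i).aemeasurable, (hmeas 0).aemeasurable, by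
      have h3 : ∀ j, Measure.map (fun w : ℕ → ℤ => (w j : ℝ)) (pathLaw ρ) =
          ρ.map fun k : ℤ => (k : ℝ) := fun j => by
        conv_rhs => rw [← (hm j).map_eq, Measure.map_map hcast (hm j).measurable]
        rfl
      rw [h3, h3]⟩)
  refine TendstoInDistribution.congr (fun n => ae_of_all _ fun w => ?_) EventuallyEq.rfl h
  dsimp only
  rw [hmean, mul_zero, sub_zero, walk]
  push_cast
  rfl

/-- Slutsky: with n = ⌊t/a⌋ and a = μ m̄, the main term μ S_n/√t is S_n/√n times μ√(n/t), and the
latter tends to μ/√a = √(μ/m̄). -/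
theorem tendstoInDistribution_process (hρ : JumpLaw ρ) (hμ : 0 < μ)
    (hz : RegularEnvironment ρ μ z) :
    TendstoInDistribution (fun (t : ℝ) w => (√t)⁻¹ * process (environment z) w t) atTop
      (fun y => y * √(μ / meanAbs ρ)) (fun _ => pathLaw ρ) (gaussianReal 0 (stepVar ρ)) := by
  have hmb := hρ.meanAbs_pos
  set a := μ * meanAbs ρ with ha
  have ha0 : 0 < a := mul_pos hμ hmb
  have hta : Tendsto (fun t : ℝ => t / a) atTop atTop := tendsto_id.atTop_div_const ha0
  have hn : Tendsto (fun t : ℝ => ⌊t / a⌋₊) atTop atTop := tendsto_nat_floor_atTop.comp hta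
  have hclt := tendstoInDistribution_walk hρ
  have h1 : TendstoInDistribution
      (fun (t : ℝ) w => (√(⌊t / a⌋₊ : ℝ))⁻¹ * (walk w ⌊t / a⌋₊ : ℝ)) atTop id
      (fun _ => pathLaw ρ) (gaussianReal 0 (stepVar ρ)) :=
    ⟨fun t => hclt.forall_aemeasurable _, hclt.aemeasurable_limit, hclt.tendsto.comp hn⟩
  have hscale : Tendsto (fun t : ℝ => μ * √((⌊t / a⌋₊ : ℝ) / t)) atTop (𝓝 √(μ / meanAbs ρ)) := by
    have h2 : Tendsto (fun t : ℝ => (⌊t / a⌋₊ : ℝ) / t) atTop (𝓝 (1 / a)) := by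
      have h3 := ((tendsto_nat_floor_div_atTop (R := ℝ)).comp hta).div_const a
      refine h3.congr' ?_
      filter_upwards [eventually_gt_atTop 0] with t ht
      simp only [Function.comp_apply]
      field_simp
    have h4 := ((Real.continuous_sqrt.tendsto _).comp h2).const_mul μ
    have h5 : μ / meanAbs ρ = μ ^ 2 * (1 / a) := by rw [ha]; field_simp
    rw [h5, Real.sqrt_mul (sq_nonneg _), Real.sqrt_sq hμ.le]
    exact h4
  have h2 := h1.continuous_comp_prodMk_of_tendstoInMeasure_const
    (g := fun p : ℝ × ℝ => p.1 * p.2) (by fun_prop)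
    (Y := fun (t : ℝ) _ => μ * √((⌊t / a⌋₊ : ℝ) / t)) (c := √(μ / meanAbs ρ))
    (fun ε hε => by
      refine tendsto_const_nhds.congr' ?_
      filter_upwards [(EMetric.tendsto_nhds.1 hscale) ε hε] with t ht
      simp only [not_le.2 ht, Set.ofPred_false, measure_empty]) (fun t => aemeasurable_const)
  refine tendstoInDistribution_of_tendstoInMeasure_sub _ _ h2 ?_
    (fun t => ((measurable_process _ t).const_mul _).aemeasurable)
  rw [tendstoInMeasure_iff_norm]
  intro δ hδ
  refine (tendsto_measure_process_sub_walk hρ hμ hz hδ).congr' ?_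
  filter_upwards [eventually_gt_atTop 0] with t ht
  have hst : 0 < √t := Real.sqrt_pos.2 ht
  congr 1
  ext w
  have e : (√t)⁻¹ * process (environment z) w t -
      (√(⌊t / a⌋₊ : ℝ))⁻¹ * (walk w ⌊t / a⌋₊ : ℝ) * (μ * √((⌊t / a⌋₊ : ℝ) / t)) =
      (√t)⁻¹ * (process (environment z) w t - μ * walk w ⌊t / a⌋₊) := by
    rcases Nat.eq_zero_or_pos ⌊t / a⌋₊ with h0 | h0
    · simp [h0, walk_zero]
    · have h6 : 0 < √(⌊t / a⌋₊ : ℝ) := Real.sqrt_pos.2 (by exact_mod_cast h0)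
      rw [Real.sqrt_div (Nat.cast_nonneg _)]
      field_simp
  simp only [Set.mem_ofPred_eq, Pi.sub_apply, Pi.zero_apply, sub_zero, Real.norm_eq_abs]
  rw [e, abs_mul, abs_of_pos (by positivity : 0 < (√t)⁻¹), le_inv_mul_iff₀ hst, mul_comm]

theorem tendstoInDistribution_map_id {Ξ ι : Type*} [MeasurableSpace Ξ] {ν : Measure Ξ}
    [IsProbabilityMeasure ν] {γ : Measure ℝ} [IsProbabilityMeasure γ] {l : Filter ι}
    {Z : ι → Ξ → ℝ} {f : ℝ → ℝ}
    [IsProbabilityMeasure (γ.map f)]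
    (h : TendstoInDistribution Z l f (fun _ => ν) γ) :
    TendstoInDistribution Z l id (fun _ => ν) (γ.map f) := by
  refine ⟨h.forall_aemeasurable, aemeasurable_id, ?_⟩
  have := h.tendsto
  simpa only [Measure.map_id] using this

end InvariancePrinciple

/-! ### Convergence of absolute and odd moments. -/

section Moments

variable {ρ : Measure ℤ} [IsProbabilityMeasure ρ]

theorem integrable_abs_rpow_gaussianReal (v : ℝ≥0) {q : ℝ} (hq : 0 ≤ q) :
    Integrable (fun y => |y| ^ q) (gaussianReal 0 v) := by
  lift q to ℝ≥0 using hq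
  simpa using (memLp_id_gaussianReal (μ := 0) (v := v) q).integrable_norm_rpow'

theorem continuous_abs_rpow {q : ℝ} (hq : 0 ≤ q) : Continuous fun x : ℝ => |x| ^ q :=
  continuous_abs.rpow_const fun _ => Or.inr hq

theorem rpow_le_one_add_rpow {x q r : ℝ} (hx : 0 ≤ x) (hq : 0 ≤ q) (hqr : q ≤ r) :
    x ^ q ≤ 1 + x ^ r := by
  have h0 : 0 ≤ x ^ r := Real.rpow_nonneg hx r
  rcases le_total x 1 with h | h
  · linarith [Real.rpow_le_one hx h hq]
  · linarith [Real.rpow_le_rpow_of_exponent_le h hqr]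

/-- Integer steps have modulus 0 or at least 1, so `lintegral_sum_rpow_le` applies to |z| itself. -/
theorem integrable_abs_walk_rpow {q r : ℝ} (hq : 0 ≤ q) (hqr : q ≤ r) (hr : 1 ≤ r)
    (hfin : ∫⁻ z : ℤ, ENNReal.ofReal |(z : ℝ)| ^ r ∂ρ ≠ ∞) (n : ℕ) :
    Integrable (fun w => |(walk w n : ℝ)| ^ q) (pathLaw ρ) := by
  have hm : Measurable fun w : ℕ → ℤ => (walk w n : ℝ) :=
    measurable_walk_pair (fun a _ => (a : ℝ)) n n
  have hI : Integrable (fun w => |(walk w n : ℝ)| ^ r) (pathLaw ρ) := by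
    refine ⟨((continuous_abs_rpow (by linarith)).measurable.comp hm).aestronglyMeasurable, ?_⟩
    rw [hasFiniteIntegral_iff_ofReal (ae_of_all _ fun w => by positivity)]
    have h := lintegral_sum_rpow_le ρ (b := fun z : ℤ => ENNReal.ofReal |(z : ℝ)|) (fun z => by
      rcases eq_or_ne z 0 with rfl | hz
      · simp
      · right
        rw [ENNReal.one_le_ofReal]
        exact_mod_cast Int.one_le_abs hz) hr n
    refine lt_of_le_of_lt (le_trans (lintegral_mono fun w => ?_) (le_self_add.trans h)) ?_
    · dsimp only
      rw [← ENNReal.ofReal_rpow_of_nonneg (abs_nonneg _) (by linarith)]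
      refine ENNReal.rpow_le_rpow ?_ (by linarith)
      rw [← ENNReal.ofReal_sum_of_nonneg fun i _ => abs_nonneg _]
      refine ENNReal.ofReal_le_ofReal ?_
      rw [walk]; push_cast
      exact Finset.abs_sum_le_sum_abs _ _
    · have h2 : (2 : ℝ≥0∞) ^ r ≠ ∞ :=
        ENNReal.rpow_ne_top_of_nonneg (by linarith) ENNReal.ofNat_ne_top
      exact ENNReal.pow_lt_top (by finiteness)
  refine ((integrable_const (1 : ℝ)).add hI).mono'
    ((continuous_abs_rpow hq).measurable.comp hm).aestronglyMeasurable (ae_of_all _ fun w => ?_)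
  rw [Real.norm_eq_abs, abs_of_nonneg (by positivity)]
  exact rpow_le_one_add_rpow (abs_nonneg _) hq hqr

theorem abs_inv_sqrt_mul_rpow {t : ℝ} (ht : 0 ≤ t) (x q : ℝ) :
    |(√t)⁻¹ * x| ^ q = |x| ^ q / t ^ (q / 2) := by
  rw [abs_mul, abs_of_nonneg (by positivity), Real.mul_rpow (by positivity) (abs_nonneg _),
    Real.inv_rpow (Real.sqrt_nonneg _), Real.sqrt_eq_rpow, ← Real.rpow_mul ht, inv_mul_eq_div]
  congr 2; ring

/-- The exponent max q 2 appears because large jumps are controlled only from order 2 on; smaller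
powers inherit uniform integrability from the second. -/
theorem tendsto_integral_abs_walk_rpow (hρ : JumpLaw ρ) {q : ℝ} (hq : 0 ≤ q)
    (hfin : ∫⁻ z : ℤ, ENNReal.ofReal |(z : ℝ)| ^ (max q 2) ∂ρ ≠ ∞) :
    Tendsto (fun n : ℕ => (∫ w, |(walk w n : ℝ)| ^ q ∂pathLaw ρ) / (n : ℝ) ^ (q / 2)) atTop
      (𝓝 (∫ y, |y| ^ q ∂gaussianReal 0 (stepVar ρ))) := by
  have hint : ∀ n : ℕ, Integrable (fun w => |(√n)⁻¹ * (walk w n : ℝ)| ^ q) (pathLaw ρ) := by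
    intro n
    simp only [abs_inv_sqrt_mul_rpow (Nat.cast_nonneg n)]
    exact (integrable_abs_walk_rpow hq (le_max_left q 2)
      (by linarith [le_max_right q 2]) hfin n).div_const _
  have h := tendsto_integral_of_momentUI
    (fun n => (measurable_walk_pair (fun a _ => (a : ℝ)) n n).const_mul _)
    (tendstoInDistribution_walk hρ) hq
    (momentUI_walk hρ (le_max_right q 2) (le_max_left q 2) hfin)
    (integrable_abs_rpow_gaussianReal _ hq) (Eventually.of_forall hint)
    (continuous_abs_rpow hq) (fun x => (abs_of_nonneg (by positivity)).le)
  refine h.congr fun n => ?_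
  simp only [abs_inv_sqrt_mul_rpow (Nat.cast_nonneg n)]
  rw [integral_div]

variable {μ : ℝ} {z : ℤ → ℝ}

theorem integrable_comp_process {e : ℤ → ℝ} (he : e 0 = 0) {t : ℝ} (ht : 0 ≤ t) {g : ℝ → ℝ}
    (hg : Continuous g) : Integrable (fun w => g (process e w t)) (pathLaw ρ) := by
  obtain ⟨C, hC⟩ := (isCompact_Icc (a := -t) (b := t)).exists_bound_of_continuousOn hg.continuousOn
  exact Integrable.of_bound (hg.measurable.comp (measurable_process e t)).aestronglyMeasurable C
    (ae_of_all _ fun w => hC _ (abs_le.1 (abs_process_le he w ht)))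

theorem tendsto_integral_comp_process (hρ : JumpLaw ρ) (hμ : 0 < μ)
    (hz : RegularEnvironment ρ μ z) {q : ℝ} (hq : 0 ≤ q) (hnear : NearMoment ρ (max q 2))
    {g : ℝ → ℝ} (hg : Continuous g) (hgq : ∀ x, |g x| ≤ |x| ^ q) :
    Tendsto (fun t : ℝ => ∫ w, g ((√t)⁻¹ * process (environment z) w t) ∂pathLaw ρ) atTop
      (𝓝 (∫ y, g (y * √(μ / meanAbs ρ)) ∂gaussianReal 0 (stepVar ρ))) := by
  set c := √(μ / meanAbs ρ) with hc
  have hcm : Measurable fun y : ℝ => y * c := measurable_id.mul_const c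
  have : IsProbabilityMeasure ((gaussianReal 0 (stepVar ρ)).map fun y => y * c) :=
    Measure.isProbabilityMeasure_map hcm.aemeasurable
  have hint : Integrable (fun y => |y| ^ q) ((gaussianReal 0 (stepVar ρ)).map fun y => y * c) := by
    rw [integrable_map_measure (continuous_abs_rpow hq).aestronglyMeasurable hcm.aemeasurable]
    refine ((integrable_abs_rpow_gaussianReal (stepVar ρ) hq).mul_const (|c| ^ q)).congr
      (ae_of_all _ fun y => ?_)
    simp only [Function.comp_apply, abs_mul]
    rw [Real.mul_rpow (abs_nonneg _) (abs_nonneg _)]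
  have h := tendsto_integral_of_momentUI
    (fun t => (measurable_process (environment z) t).const_mul _)
    (tendstoInDistribution_map_id (tendstoInDistribution_process hρ hμ hz)) hq
    (momentUI_process hρ hz (le_max_right q 2) (le_max_left q 2) hnear) hint
    ((eventually_ge_atTop 0).mono fun t ht =>
      integrable_comp_process (environment_zero z) ht
        ((continuous_abs_rpow hq).comp (continuous_const.mul continuous_id))) hg hgq
  rwa [integral_map hcm.aemeasurable hg.aestronglyMeasurable] at h

theorem tendsto_integral_abs_process_rpow (hρ : JumpLaw ρ) (hμ : 0 < μ)
    (hz : RegularEnvironment ρ μ z) {q : ℝ} (hq : 0 ≤ q) (hnear : NearMoment ρ (max q 2)) :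
    Tendsto (fun t : ℝ => (∫ w, |process (environment z) w t| ^ q ∂pathLaw ρ) / t ^ (q / 2)) atTop
      (𝓝 ((μ / meanAbs ρ) ^ (q / 2) * ∫ y, |y| ^ q ∂gaussianReal 0 (stepVar ρ))) := by
  have h := tendsto_integral_comp_process hρ hμ hz hq hnear (continuous_abs_rpow hq)
    (fun x => (abs_of_nonneg (by positivity)).le)
  have hc0 : 0 ≤ μ / meanAbs ρ := div_nonneg hμ.le hρ.meanAbs_pos.le
  have e : ∀ y : ℝ, |y * √(μ / meanAbs ρ)| ^ q = (μ / meanAbs ρ) ^ (q / 2) * |y| ^ q := fun y => by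
    rw [abs_mul, Real.mul_rpow (abs_nonneg _) (abs_nonneg _), abs_of_nonneg (Real.sqrt_nonneg _),
      Real.sqrt_eq_rpow, ← Real.rpow_mul hc0, mul_comm]
    congr 2; ring
  simp only [e, integral_const_mul] at h
  refine h.congr' ?_
  filter_upwards [eventually_ge_atTop 0] with t ht
  simp only [abs_inv_sqrt_mul_rpow ht]
  rw [integral_div]

theorem integral_odd_pow_gaussianReal (v : ℝ≥0) {r : ℕ} (hr : Odd r) :
    ∫ y, y ^ r ∂gaussianReal 0 v = 0 := by
  have h1 : (gaussianReal 0 v).map (fun y => -y) = gaussianReal 0 v := by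
    rw [gaussianReal_map_neg, neg_zero]
  have h2 : ∫ y, y ^ r ∂gaussianReal 0 v = ∫ y, (-y) ^ r ∂gaussianReal 0 v := by
    conv_lhs => rw [← h1]
    exact integral_map measurable_neg.aemeasurable (continuous_pow r).aestronglyMeasurable
  simp only [hr.neg_pow, integral_neg] at h2
  linarith

theorem tendsto_integral_process_odd_pow (hρ : JumpLaw ρ) (hμ : 0 < μ)
    (hz : RegularEnvironment ρ μ z) {r : ℕ} (hr : Odd r) (hnear : NearMoment ρ (max r 2)) :
    Tendsto (fun t : ℝ => (∫ w, process (environment z) w t ^ r ∂pathLaw ρ) / t ^ ((r : ℝ) / 2))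
      atTop (𝓝 0) := by
  have h := tendsto_integral_comp_process hρ hμ hz (Nat.cast_nonneg r) hnear (continuous_pow r)
    (fun x => by rw [abs_pow, Real.rpow_natCast])
  simp only [mul_pow, integral_mul_const, integral_odd_pow_gaussianReal _ hr, zero_mul,
    integral_const_mul] at h
  refine h.congr' ?_
  filter_upwards [eventually_ge_atTop 0] with t ht
  rw [div_eq_inv_mul, inv_pow, Real.sqrt_eq_rpow, ← Real.rpow_natCast, ← Real.rpow_mul ht]
  congr 3; ring

end Moments

/-! ### From the density to the step law. -/

section StepLaw

variable {ρ : Measure ℤ} [IsProbabilityMeasure ρ] {p : ℤ → ℝ}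

theorem lintegral_ofReal_ne_top_of_summable (hp : ∀ k, ρ.real {k} = p k) {f : ℤ → ℝ}
    (hf : ∀ k, 0 ≤ f k) (h : Summable fun k => f k * p k) :
    ∫⁻ k, ENNReal.ofReal (f k) ∂ρ ≠ ∞ := by
  rw [lintegral_countable']
  have e : ∀ k, ENNReal.ofReal (f k) * ρ {k} = ENNReal.ofReal (f k * p k) := fun k => by
    rw [ENNReal.ofReal_mul (hf k), ← hp k, ofReal_measureReal]
  simp only [e]
  exact h.tsum_ofReal_ne_top

theorem integral_eq_tsum_mul {κ : Measure ℤ} (hp : ∀ k, κ.real {k} = p k) {f : ℤ → ℝ} (hf : Integrable f κ) :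
    ∫ k, f k ∂κ = ∑' k, f k * p k := by
  rw [integral_countable hf]
  simp only [hp, smul_eq_mul, mul_comm]

/-- If p 1 were 0, monotonicity and symmetry would put all mass at the origin and the variance would
vanish. -/
theorem jumpLaw_of_density (hp : ∀ k, ρ.real {k} = p k) (hsymm : ∀ k, p (-k) = p k)
    (hmono : ∀ k, 0 ≤ k → p (k + 1) ≤ p k) (hvar : Summable fun k : ℤ => (k : ℝ) ^ 2 * p k)
    (hpos : 0 < jumpVariance p) : JumpLaw ρ := by
  have hp0 : ∀ k, 0 ≤ p k := fun k => hp k ▸ measureReal_nonneg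
  refine ⟨⟨fun k => by rw [hp, hp, hsymm], fun k hk => by rw [hp, hp]; exact hmono k hk⟩, ?_, ?_⟩
  · rw [hp]
    by_contra hcon
    have h1 : p 1 = 0 := le_antisymm (not_lt.1 hcon) (hp0 1)
    have hnat : ∀ n : ℕ, p (n + 1) = 0 := fun n => by
      induction n with
      | zero => simpa using h1
      | succ n ih =>
        refine le_antisymm ?_ (hp0 _)
        have := hmono (n + 1) (by positivity)
        rw [ih] at this
        exact_mod_cast this
    have hall : ∀ k : ℤ, (k : ℝ) ^ 2 * p k = 0 := fun k => by
      rcases lt_trichotomy k 0 with h | h | h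
      · have := hnat (-k - 1).toNat
        rw [Int.toNat_of_nonneg (by omega), sub_add_cancel, hsymm] at this
        rw [this, mul_zero]
      · simp [h]
      · have := hnat (k - 1).toNat
        rw [Int.toNat_of_nonneg (by omega), sub_add_cancel] at this
        rw [this, mul_zero]
    simp [jumpVariance, hall] at hpos
  · refine ⟨(measurable_of_countable _).aestronglyMeasurable, ?_⟩
    rw [hasFiniteIntegral_iff_ofReal (ae_of_all _ fun k => sq_nonneg _)]
    exact (lintegral_ofReal_ne_top_of_summable hp (fun k => sq_nonneg _) hvar).lt_top

theorem lintegral_ofReal_abs_rpow_ne_top (hp : ∀ k, ρ.real {k} = p k) {q : ℝ} (hq : 0 ≤ q)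
    (h : Summable fun k : ℤ => |(k : ℝ)| ^ q * p k) :
    ∫⁻ z : ℤ, ENNReal.ofReal |(z : ℝ)| ^ q ∂ρ ≠ ∞ := by
  have := lintegral_ofReal_ne_top_of_summable hp (fun k : ℤ => by positivity) h
  simpa only [ENNReal.ofReal_rpow_of_nonneg (abs_nonneg _) hq] using this

theorem lintegral_ofReal_abs_rpow_two_ne_top {κ : Measure ℤ} (hρ : JumpLaw κ) :
    ∫⁻ z : ℤ, ENNReal.ofReal |(z : ℝ)| ^ (2 : ℝ) ∂κ ≠ ∞ := by
  have h := (hasFiniteIntegral_iff_ofReal (ae_of_all _ fun k => sq_nonneg _)).1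
    hρ.integrable_sq.hasFiniteIntegral
  simpa only [ENNReal.ofReal_rpow_of_nonneg (abs_nonneg _) zero_le_two, Real.rpow_two, sq_abs]
    using h.ne

theorem lintegral_abs_rpow_ne_top_of_le {q r : ℝ} (hq : 0 ≤ q) (hqr : q ≤ r)
    (h : ∫⁻ z : ℤ, ENNReal.ofReal |(z : ℝ)| ^ r ∂ρ ≠ ∞) :
    ∫⁻ z : ℤ, ENNReal.ofReal |(z : ℝ)| ^ q ∂ρ ≠ ∞ := by
  refine ne_top_of_le_ne_top (b := ∫⁻ z : ℤ, (1 + ENNReal.ofReal |(z : ℝ)| ^ r) ∂ρ) ?_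
    (lintegral_mono fun z => ?_)
  · rw [lintegral_add_left measurable_const, lintegral_const, measure_univ, mul_one]
    exact ENNReal.add_ne_top.2 ⟨ENNReal.one_ne_top, h⟩
  · dsimp only
    rw [ENNReal.ofReal_rpow_of_nonneg (abs_nonneg _) hq,
      ENNReal.ofReal_rpow_of_nonneg (abs_nonneg _) (hq.trans hqr), ← ENNReal.ofReal_one,
      ← ENNReal.ofReal_add zero_le_one (by positivity)]
    exact ENNReal.ofReal_le_ofReal (rpow_le_one_add_rpow (abs_nonneg _) hq hqr)

/-- For q > 2 one has 1 + q/2 < q ≤ q̄, so some finite moment has order above 1 + q/2. This is what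
admits q = q̄ itself; for q ≤ 2 the variance is used. -/
theorem nearMoment_of_le_qbar (hρ : JumpLaw ρ) (hp : ∀ k, ρ.real {k} = p k) {q : ℝ}
    (hq : (q : EReal) ≤ qbar p) : NearMoment ρ (max q 2) := by
  rcases le_or_gt q 2 with h | h
  · rw [max_eq_right h]
    exact Or.inl (lintegral_ofReal_abs_rpow_two_ne_top hρ)
  · rw [max_eq_left h.le]
    have h1 : ((1 + q / 2 : ℝ) : EReal) < qbar p :=
      lt_of_lt_of_le (EReal.coe_lt_coe_iff.2 (by linarith)) hq
    obtain ⟨_, ⟨r, ⟨hr0, hr⟩, rfl⟩, hlt⟩ := lt_sSup_iff.1 h1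
    have hlt' : 1 + q / 2 < r := EReal.coe_lt_coe_iff.1 hlt
    have hfin := lintegral_ofReal_abs_rpow_ne_top hp hr0.le hr
    rcases le_or_gt q r with h2 | h2
    · exact Or.inl (lintegral_abs_rpow_ne_top_of_le (by linarith) h2 hfin)
    · exact Or.inr ⟨r, hlt', h2, hfin⟩

theorem lintegral_abs_rpow_max_two_ne_top (hρ : JumpLaw ρ) (hp : ∀ k, ρ.real {k} = p k) {q : ℝ}
    (hq : 0 ≤ q) (h : Summable fun k : ℤ => |(k : ℝ)| ^ q * p k) :
    ∫⁻ z : ℤ, ENNReal.ofReal |(z : ℝ)| ^ (max q 2) ∂ρ ≠ ∞ := by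
  rcases max_cases q 2 with ⟨h1, _⟩ | ⟨h1, _⟩ <;> rw [h1]
  · exact lintegral_ofReal_abs_rpow_ne_top hp hq h
  · exact lintegral_ofReal_abs_rpow_two_ne_top hρ

theorem map_eq_pathLaw {Ξ : Type*} [MeasurableSpace Ξ] {Q : Measure Ξ} [IsProbabilityMeasure Q]
    {ξ : ℕ → Ξ → ℤ} (hm : ∀ i, Measurable (ξ i)) (hi : iIndepFun ξ Q)
    (hlaw : ∀ i k, Q.real {s | ξ i s = k} = Q.real {s | ξ 0 s = k}) :
    Q.map (fun s i => ξ i s) = pathLaw (Q.map (ξ 0)) := by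
  have h : ∀ i, Q.map (ξ i) = Q.map (ξ 0) := fun i => by
    refine Measure.ext_of_singleton fun k => ?_
    rw [Measure.map_apply (hm i) (measurableSet_singleton k),
      Measure.map_apply (hm 0) (measurableSet_singleton k)]
    exact (measureReal_eq_measureReal_iff).1 (hlaw i k)
  have h2 := hi.map_fun_eq_infinitePi_map hm
  simp only [h] at h2
  exact h2

end StepLaw

end LevyEnv

/-! ### Transfer from path space to the given probability spaces. -/

theorem theorem2
    -- the random environment: i.i.d. positive gaps with finite mean
    {Ω : Type*} [MeasurableSpace Ω] (P : MeasureTheory.Measure Ω)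
    [MeasureTheory.IsProbabilityMeasure P]
    (ζ : ℤ → Ω → ℝ) (hζ_meas : ∀ j, Measurable (ζ j))
    (hζ_indep : ProbabilityTheory.iIndepFun ζ P)
    (hζ_ident : ∀ j, ProbabilityTheory.IdentDistrib (ζ j) (ζ 0) P P)
    (hζ_pos : ∀ j, ∀ᵐ a ∂P, 0 < ζ j a)
    (hζ_int : MeasureTheory.Integrable (ζ 0) P)
    -- the i.i.d. integer-valued increments of the underlying walk, with density `p`
    {Ξ : Type*} [MeasurableSpace Ξ] (Q : MeasureTheory.Measure Ξ)
    [MeasureTheory.IsProbabilityMeasure Q]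
    (ξ : ℕ → Ξ → ℤ) (hξ_meas : ∀ i, Measurable (ξ i))
    (hξ_indep : ProbabilityTheory.iIndepFun ξ Q)
    (p : ℤ → ℝ) (hξ_law : ∀ i k, Q.real {s | ξ i s = k} = p k)
    (hp_symm : ∀ k, p (-k) = p k)
    (hp_mono : ∀ k, 0 ≤ k → p (k + 1) ≤ p k)
    (hp_var : Summable fun k : ℤ => (k : ℝ) ^ 2 * p k)
    (hp_var_pos : 0 < LevyEnv.jumpVariance p)
    (q : ℝ) (hq_nonneg : 0 ≤ q) (hq_le : (q : EReal) ≤ LevyEnv.qbar p) :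
    -- `m_q` is the limit of the rescaled absolute moments of the underlying walk
    ((Summable fun k : ℤ => |(k : ℝ)| ^ q * p k) →
      (∀ n : ℕ, MeasureTheory.Integrable
        (fun s => |(LevyEnv.walk (fun i => ξ i s) n : ℝ)| ^ q) Q) ∧
      Filter.Tendsto
        (fun n : ℕ => (∫ s, |(LevyEnv.walk (fun i => ξ i s) n : ℝ)| ^ q ∂Q) / (n : ℝ) ^ (q / 2))
        Filter.atTop (nhds (LevyEnv.gaussMoment p q))) ∧
    -- quenched convergence of the absolute moments
    (∀ᵐ a ∂P,
      (∀ t : ℝ, 0 ≤ t → MeasureTheory.Integrable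
        (fun s => |LevyEnv.process (LevyEnv.environment fun j => ζ j a) (fun i => ξ i s) t| ^ q)
        Q) ∧
      Filter.Tendsto
        (fun t : ℝ =>
          (∫ s, |LevyEnv.process (LevyEnv.environment fun j => ζ j a) (fun i => ξ i s) t| ^ q ∂Q)
            / t ^ (q / 2))
        Filter.atTop
        (nhds (((∫ a', ζ 0 a' ∂P) / LevyEnv.meanAbsJump p) ^ (q / 2) *
          LevyEnv.gaussMoment p q))) ∧
    -- quenched convergence of the odd moments
    (∀ r : ℕ, Odd r → q = r → ∀ᵐ a ∂P,
      (∀ t : ℝ, 0 ≤ t → MeasureTheory.Integrable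
        (fun s => LevyEnv.process (LevyEnv.environment fun j => ζ j a) (fun i => ξ i s) t ^ r)
        Q) ∧
      Filter.Tendsto
        (fun t : ℝ =>
          (∫ s, LevyEnv.process (LevyEnv.environment fun j => ζ j a) (fun i => ξ i s) t ^ r ∂Q)
            / t ^ (q / 2))
        Filter.atTop (nhds 0)) := by
  have hξm : Measurable fun s i => ξ i s := measurable_pi_lambda _ hξ_meas
  have hp : ∀ k, (Q.map (ξ 0)).real {k} = p k := fun k => by
    rw [MeasureTheory.map_measureReal_apply (hξ_meas 0) (MeasurableSet.singleton k), ← hξ_law 0 k]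
    rfl
  have hpath : Q.map (fun s i => ξ i s) = LevyEnv.pathLaw (Q.map (ξ 0)) :=
    LevyEnv.map_eq_pathLaw hξ_meas hξ_indep fun i k => by rw [hξ_law, hξ_law]
  set ρ := Q.map (ξ 0) with hρ_def
  have : MeasureTheory.IsProbabilityMeasure ρ :=
    MeasureTheory.Measure.isProbabilityMeasure_map (hξ_meas 0).aemeasurable
  have hρ : LevyEnv.JumpLaw ρ :=
    LevyEnv.jumpLaw_of_density hp hp_symm hp_mono hp_var hp_var_pos
  have hint : ∀ {F : (ℕ → ℤ) → ℝ}, Measurable F →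
      ∫ s, F (fun i => ξ i s) ∂Q = ∫ w, F w ∂LevyEnv.pathLaw ρ := fun {F} hF => by
    rw [← hpath, MeasureTheory.integral_map hξm.aemeasurable hF.aestronglyMeasurable]
  have hintegrable : ∀ {F : (ℕ → ℤ) → ℝ}, MeasureTheory.Integrable F (LevyEnv.pathLaw ρ) →
      MeasureTheory.Integrable (fun s => F fun i => ξ i s) Q := fun {F} hF => by
    rw [← hpath] at hF
    exact hF.comp_measurable hξm
  have hgauss : LevyEnv.gaussMoment p q =
      ∫ y, |y| ^ q ∂(ProbabilityTheory.gaussianReal 0 (LevyEnv.stepVar ρ)) := by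
    rw [LevyEnv.gaussMoment, LevyEnv.stepVar, LevyEnv.jumpVariance,
      LevyEnv.integral_eq_tsum_mul hp hρ.integrable_sq]
  have hmeanAbs : LevyEnv.meanAbsJump p = LevyEnv.meanAbs ρ := by
    rw [LevyEnv.meanAbsJump, LevyEnv.meanAbs, LevyEnv.integral_eq_tsum_mul hp hρ.integrable_abs]
  have hnear := LevyEnv.nearMoment_of_le_qbar hρ hp hq_le
  have hμ : 0 < ∫ a, ζ 0 a ∂P := by
    rw [MeasureTheory.integral_pos_iff_support_of_nonneg_ae
      ((hζ_pos 0).mono fun a ha => ha.le) hζ_int]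
    have h : Function.support (ζ 0) =ᵐ[P] Set.univ := by
      filter_upwards [hζ_pos 0] with a ha
      exact eq_true ha.ne'
    rw [MeasureTheory.measure_congr h, MeasureTheory.measure_univ]
    exact one_pos
  have henv := LevyEnv.ae_regularEnvironment hρ hζ_meas hζ_indep hζ_ident hζ_pos hζ_int
  refine ⟨fun hsum => ?_, ?_, fun r hr hqr => ?_⟩
  · have hfin := LevyEnv.lintegral_abs_rpow_max_two_ne_top hρ hp hq_nonneg hsum
    have hI := LevyEnv.integrable_abs_walk_rpow hq_nonneg (le_max_left q 2)
      (by linarith [le_max_right q 2]) hfin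
    refine ⟨fun n => hintegrable (hI n), ?_⟩
    rw [hgauss]
    refine (LevyEnv.tendsto_integral_abs_walk_rpow hρ hq_nonneg hfin).congr fun n => ?_
    rw [hint (LevyEnv.measurable_walk_pair (fun a _ => |(a : ℝ)| ^ q) n n)]
  · filter_upwards [henv] with a ha
    refine ⟨fun t ht => hintegrable (LevyEnv.integrable_comp_process
      (LevyEnv.environment_zero _) ht (LevyEnv.continuous_abs_rpow hq_nonneg)), ?_⟩
    rw [hgauss, hmeanAbs]
    refine (LevyEnv.tendsto_integral_abs_process_rpow hρ hμ ha hq_nonneg hnear).congr fun t => ?_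
    have hm : Measurable fun w : ℕ → ℤ =>
        |LevyEnv.process (LevyEnv.environment fun j => ζ j a) w t| ^ q :=
      (LevyEnv.continuous_abs_rpow hq_nonneg).measurable.comp (LevyEnv.measurable_process _ t)
    rw [hint hm]
  · subst hqr
    filter_upwards [henv] with a ha
    refine ⟨fun t ht => hintegrable (LevyEnv.integrable_comp_process
      (LevyEnv.environment_zero _) ht (continuous_pow r)), ?_⟩
    refine (LevyEnv.tendsto_integral_process_odd_pow hρ hμ ha hr hnear).congr fun t => ?_
    rw [hint ((LevyEnv.measurable_process _ t).pow_const r)]
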